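/- Let $B=(V,E)$ be a stationary Bratteli diagram: $V_0=\{v_0\}$, all $V_n,E_n$ are finite, every vertex is the source of some edge and every vertex other than $v_0$ is the range of some edge, and, after each $V_n$ ($n\ge 1$) is identified with one finite set $\{1,\dots,N\}$, the number of edges from $w\in V_n$ to $v\in V_{n+1}$ equals $f_{vw}$ for all $n\ge1$, where $F=(f_{vw})$ is a fixed matrix with non-negative integer entries (the edges between $v_0$ and $V_1$ are unrestricted). Let $X_B$ be the space of infinite paths starting at $v_0$, with the topology generated by cylinder sets, and let $\mathcal R$ be the tail equivalence relation on $X_B$. Put $A=F^T$. Let $G(A)$ be the directed graph on $\{1,\dots,N\}$ with an arrow from $i$ to $j$ iff $A_{ij}>0$. The vertices of the reduced graph $R(A)$ are the classes of mutually accessible vertices of $G(A)$ (a vertex is accessible from itself); for a class $\alpha$ let $A_\alpha$ be the corresponding diagonal block of $A$ and $\rho_\alpha$ its spectral radius. A class $\alpha$ is distinguished if $\rho_\alpha>\rho_\beta$ for every class $\beta\ne\alpha$ that has access to $\alpha$ in $G(A)$. Suppose that every $\mathcal R$-class is infinite and that every nonzero diagonal block of $F$ is primitive. For a class $\alpha$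 with $A_\alpha\neq0$, let $Y_\alpha\subset X_B$ be the path space of the simple subdiagram $B_\alpha$ formed by $v_0$, the vertices of the class $\alpha$ at all levels $n\ge1$, and the edges connecting them, and let $X_\alpha$ be the set of all paths that are $\mathcal R$-equivalent to a path in $Y_\alpha$. Then: 1. For every class $\alpha$ with $A_\alpha\ne0$ there is a unique probability measure $\nu_\alpha$ on $Y_\alpha$ that is invariant under $\mathcal R\cap(Y_\alpha\times Y_\alpha)$, and there is a unique $\mathcal R$-invariant Borel measure $\widetilde\nu_\alpha$ on $X_B$ that agrees with $\nu_\alpha$ on $Y_\alpha$ and vanishes off $X_\alpha$. 2. If $A_\alpha\ne 0$ and $\alpha$ is not distinguished, then $\widetilde\nu_\alpha$ is an infinite, $\sigma$-finite, ergodic $\mathcal R$-invariant measure that is positive and finite on some open set, and the map sending $\alpha$ to the class of $\widetilde\nu_\alpha$ is a one-to-one correspondence between the set of non-distinguished vertices $\alpha$ of $R(A)$ with $A_\alpha\neq0$ and the set of all ergodic infinite $\sigma$-finite $\mathcal R$-invariant Borel measures on $X_B$ that are positive and finite on at least one open set (depending on the measure), modulo positive constant multiples. For such $\alpha$, the measure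 $\widetilde\nu_\alpha$ is non-atomic if and only if $A_\alpha$ is not the $1\times1$ matrix $[1]$. -/

import Mathlib

open MeasureTheory Set
open scoped ENNReal NNReal

universe u v w

/-! ## Invariant and ergodic measures for an equivalence relation -/

/-- A measure is invariant under an equivalence relation `r` if every Borel automorphism
whose graph is contained in `r` preserves it. (When `r` is the orbit relation of a
countable group of Borel automorphisms, this is the same as invariance under any such group.) -/
def RelInvariant {X : Type*} [MeasurableSpace X] (r : Setoid X) (μ : Measure X) : Prop :=
  ∀ φ : X ≃ᵐ X, (∀ x, r x (φ x)) → MeasurePreserving φ μ μ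

/-- Every measurable `r`-saturated set is null or conull. -/
def RelErgodic {X : Type*} [MeasurableSpace X] (r : Setoid X) (μ : Measure X) : Prop :=
  ∀ S : Set X, MeasurableSet S → (∀ x y, r x y → x ∈ S → y ∈ S) → μ S = 0 ∨ μ Sᶜ = 0

/-- Every equivalence class is infinite. -/
def RelAperiodic {X : Type*} (r : Setoid X) : Prop :=
  ∀ x, {y | r x y}.Infinite

/-- Ergodic invariant `σ`-finite infinite measures which are positive and finite on some
open set. -/
structure IsErgodicInfinite {X : Type*} [TopologicalSpace X] [MeasurableSpace X]
    (r : Setoid X) (μ : Measure X) : Prop where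
  invariant : RelInvariant r μ
  ergodic : RelErgodic r μ
  sigmaFinite : SigmaFinite μ
  infinite : μ univ = ∞
  exists_open : ∃ U : Set X, IsOpen U ∧ 0 < μ U ∧ μ U < ∞

/-- Two such measures are identified when they differ by a positive constant multiple. -/
def scalingSetoid {X : Type*} [TopologicalSpace X] [MeasurableSpace X] (r : Setoid X) :
    Setoid {μ : Measure X // IsErgodicInfinite r μ} where
  r μ μ' := ∃ c : ℝ≥0, c ≠ 0 ∧ μ'.1 = c • μ.1
  iseqv :=
    { refl := fun μ => ⟨1, one_ne_zero, (one_smul _ _).symm⟩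
      symm := by
        rintro μ μ' ⟨c, hc, h⟩
        exact ⟨c⁻¹, inv_ne_zero hc, by rw [h, smul_smul, inv_mul_cancel₀ hc, one_smul]⟩
      trans := by
        rintro μ μ' μ'' ⟨c, hc, h⟩ ⟨d, hd, h'⟩
        exact ⟨d * c, mul_ne_zero hd hc, by rw [h', h, smul_smul]⟩ }

/-! ## The reduced graph of a non-negative integer matrix -/

namespace NonnegMatrix

/-- There is a (possibly empty) path from `i` to `j` in the directed graph of `M`, which has
an arrow from `i` to `j` iff `M i j > 0`. -/
def Access {ι : Type w} (M : Matrix ι ι ℕ) (i j : ι) : Prop :=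
  Relation.ReflTransGen (fun k l => 0 < M k l) i j

/-- Vertices are equivalent if each has access to the other. -/
def commSetoid {ι : Type w} (M : Matrix ι ι ℕ) : Setoid ι where
  r i j := Access M i j ∧ Access M j i
  iseqv :=
    { refl := fun _ => ⟨Relation.ReflTransGen.refl, Relation.ReflTransGen.refl⟩
      symm := fun h => ⟨h.2, h.1⟩
      trans := fun h h' => ⟨h.1.trans h'.1, h'.2.trans h.2⟩ }

/-- The vertices of the reduced graph `R(M)`: the equivalence classes. -/
abbrev ReducedVertex {ι : Type w} (M : Matrix ι ι ℕ) : Type w :=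
  Quotient (commSetoid M)

/-- The class `α`, as a set of vertices of the graph of `M`. -/
def classSet {ι : Type w} (M : Matrix ι ι ℕ) (α : ReducedVertex M) : Set ι :=
  {i | Quotient.mk (commSetoid M) i = α}

/-- The class `α` has access to the class `β` in `R(M)`. -/
def ClassAccess {ι : Type w} (M : Matrix ι ι ℕ) (α β : ReducedVertex M) : Prop :=
  ∃ i ∈ classSet M α, ∃ j ∈ classSet M β, Access M i j

/-- The diagonal block `M_α`. -/
def block {ι : Type w} (M : Matrix ι ι ℕ) (α : ReducedVertex M) :
    Matrix (classSet M α) (classSet M α) ℕ :=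
  M.submatrix (fun i => i.1) (fun i => i.1)

open Classical in
/-- `ρ_α`, the spectral radius of the diagonal block `M_α` (as a complex matrix). -/
noncomputable def classRadius {ι : Type w} [Fintype ι] (M : Matrix ι ι ℕ)
    (α : ReducedVertex M) : ℝ≥0∞ :=
  spectralRadius ℂ ((block M α).map (fun k : ℕ => (k : ℂ)))

/-- `α` is distinguished: `ρ_α > ρ_β` for every other class `β` with access to `α`. -/
def Distinguished {ι : Type w} [Fintype ι] (M : Matrix ι ι ℕ) (α : ReducedVertex M) : Prop :=
  ∀ β : ReducedVertex M, β ≠ α → ClassAccess M β α → classRadius M β < classRadius M α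

open Classical in
/-- Every nonzero diagonal block (irreducible component) of `M` is primitive. -/
def PrimitiveBlocks {ι : Type w} [Fintype ι] (M : Matrix ι ι ℕ) : Prop :=
  ∀ α : ReducedVertex M, block M α ≠ 0 →
    ((block M α).map (fun k : ℕ => (k : ℤ))).IsPrimitive

/-- The block `M_α` is the `1 × 1` matrix `[1]`. -/
def IsUnitBlock {ι : Type w} (M : Matrix ι ι ℕ) (α : ReducedVertex M) : Prop :=
  ∃ i : ι, classSet M α = {i} ∧ M i i = 1

end NonnegMatrix

/-! ## Bratteli diagrams -/

/-- A Bratteli diagram. `E n` is the set of edges from level `n` to level `n + 1`. -/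
structure BratteliDiagram where
  V : ℕ → Type u
  E : ℕ → Type v
  src : ∀ n, E n → V n
  rng : ∀ n, E n → V (n + 1)
  root : Nonempty (Unique (V 0))
  finite_V : ∀ n, Finite (V n)
  finite_E : ∀ n, Finite (E n)
  src_surjective : ∀ n, Function.Surjective (src n)
  rng_surjective : ∀ n, Function.Surjective (rng n)

namespace BratteliDiagram

/-- The incidence matrix between levels `n` and `n + 1`. -/
noncomputable def incidence (B : BratteliDiagram.{u, v}) (n : ℕ) :
    Matrix (B.V (n + 1)) (B.V n) ℕ :=
  fun a b => Nat.card {e : B.E n // B.rng n e = a ∧ B.src n e = b}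

/-- `B` is stationary with incidence matrix `F`: after the vertices at each level `n ≥ 1` are
labelled by `ι`, all the incidence matrices between levels `n` and `n + 1`, `n ≥ 1`, equal `F`.
The edges from the root to level `1` are unrestricted. -/
def IsStationary (B : BratteliDiagram.{u, v}) {ι : Type w} (lab : ∀ n, ι ≃ B.V (n + 1))
    (F : Matrix ι ι ℕ) : Prop :=
  ∀ n, (B.incidence (n + 1)).submatrix (lab (n + 1)) (lab n) = F

/-- The space `X_B` of infinite paths starting at the root. -/
def PathSpace (B : BratteliDiagram.{u, v}) : Type v :=
  {x : ∀ n, B.E n // ∀ n, B.rng n (x n) = B.src (n + 1) (x (n + 1))}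

/-- The topology generated by the cylinder sets. -/
instance (B : BratteliDiagram.{u, v}) : TopologicalSpace B.PathSpace :=
  TopologicalSpace.generateFrom
    {U | ∃ (e : ∀ n, B.E n) (n : ℕ), U = {x : B.PathSpace | ∀ i < n, x.1 i = e i}}

instance (B : BratteliDiagram.{u, v}) : MeasurableSpace B.PathSpace :=
  borel B.PathSpace

instance (B : BratteliDiagram.{u, v}) : BorelSpace B.PathSpace :=
  ⟨rfl⟩

/-- The tail equivalence relation `R`. -/
def tail (B : BratteliDiagram.{u, v}) : Setoid B.PathSpace where
  r x y := ∃ n₀, ∀ n ≥ n₀, x.1 n = y.1 n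
  iseqv :=
    { refl := fun _ => ⟨0, fun _ _ => rfl⟩
      symm := fun ⟨n₀, h⟩ => ⟨n₀, fun n hn => (h n hn).symm⟩
      trans := fun ⟨n₀, h⟩ ⟨n₁, h'⟩ => ⟨max n₀ n₁, fun n hn =>
        (h n (le_trans (le_max_left _ _) hn)).trans (h' n (le_trans (le_max_right _ _) hn))⟩ }

/-- The path space, inside `X_B`, of the stationary subdiagram consisting of the root, the
vertices at levels `n ≥ 1` with label in `C`, and the edges which connect them. -/
def subPaths (B : BratteliDiagram.{u, v}) {ι : Type w} (lab : ∀ n, ι ≃ B.V (n + 1))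
    (C : Set ι) : Set B.PathSpace :=
  {x | ∀ n, (lab n).symm (B.rng n (x.1 n)) ∈ C}

/-- The restriction of tail equivalence to the path space of a subdiagram. -/
def subTail (B : BratteliDiagram.{u, v}) {ι : Type w} (lab : ∀ n, ι ≃ B.V (n + 1))
    (C : Set ι) : Setoid (B.subPaths lab C) :=
  B.tail.comap Subtype.val

/-- The set of paths tail equivalent to a path of the subdiagram. -/
def saturation (B : BratteliDiagram.{u, v}) {ι : Type w} (lab : ∀ n, ι ≃ B.V (n + 1))
    (C : Set ι) : Set B.PathSpace :=
  {x | ∃ y ∈ B.subPaths lab C, B.tail x y}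

/-- `ν` is an invariant probability measure of the subdiagram. -/
def IsSubInvariantProb (B : BratteliDiagram.{u, v}) {ι : Type w}
    (lab : ∀ n, ι ≃ B.V (n + 1)) (C : Set ι) (ν : Measure (B.subPaths lab C)) : Prop :=
  IsProbabilityMeasure ν ∧ RelInvariant (B.subTail lab C) ν

/-- `μ` is the `R`-invariant extension of the measure `ν` on the path space of the subdiagram:
it is `R`-invariant, agrees with `ν` there, and is carried by the `R`-saturation of that
path space. -/
structure IsInvariantExtension (B : BratteliDiagram.{u, v}) {ι : Type w}
    (lab : ∀ n, ι ≃ B.V (n + 1)) (C : Set ι) (ν : Measure (B.subPaths lab C))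
    (μ : Measure B.PathSpace) : Prop where
  invariant : RelInvariant B.tail μ
  extends_sub : ∀ S : Set (B.subPaths lab C), MeasurableSet S → μ (Subtype.val '' S) = ν S
  null_compl : μ (B.saturation lab C)ᶜ = 0

end BratteliDiagram

/-! An arrow between two different classes of `G(A)` cannot be undone, so every path eventually
stays in one class, whose block is then nonzero. The sets `X_α` therefore split `X_B` into finitely
many saturated Borel sets, and a nonzero ergodic measure is carried by one of them. The set `X_α` is
a countable union of images of pieces of `Y_α` under changes of prefix. Hence an invariant measure
on `Y_α` spreads to an invariant measure on `X_α` (`partialInvariant_satExtension`), and in only one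
way (`ext_of_partialInvariant`).

By invariance, the mass of the paths that follow a given prefix to the vertex `i` of level `n + 1`
and stay in `α` afterwards depends only on `n` and `i`. These masses form vectors with `p n = A_α p
(n + 1)`. For a primitive block the non-negative solutions lie on one ray
(`exists_eq_mul_of_backward`, a Harnack argument), so the nonzero ones are geometric: a Perron
eigenvector divided by `ρ_α ^ n`. This yields uniqueness of `ν_α`. It also yields ergodicity,
because the normalized restriction to a saturated set that charges `Y_α` is again a normalized
extension. Existence is a compactness argument (`exists_partialInvariant`) free of matrix theory, so
the Perron eigenvectors can be read off from the measures.

Let `ξ` be the Perron eigenvector extended by zero. Inside a cylinder ending at `i` on level 1, the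
paths that are in `α` from level `N + 1` on have mass proportional to `(A ^ N ξ) i / ρ_α ^ N`. So
the extension is finite exactly when `A ^ N ξ` is `O(ρ_α ^ N)`. If `α` is distinguished, a vector `p
≥ ξ` with `A p ≤ ρ_α p` gives the bound (`exists_classOrbit_le`). Conversely, a bound makes the
normalized orbit increase to an eigenvector of `A` that is positive on everything with access to
`α`, and comparison with the Perron eigenvector of an upstream class `β` excludes `ρ_β ≥ ρ_α`
(`lt_of_classOrbit_le`).

An ergodic infinite measure that is positive and finite on an open set gives, by primitivity, finite
positive mass to some `Y_α`; it is thus a multiple of the extension, and `α` is not distinguished.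
Points are null when `ρ_α > 1`, since the relevant cylinder masses decay like `ρ_α ^ (-n)`; the only
primitive block with `ρ_α ≤ 1` is `[1]`, for which `Y_α` is finite. -/

/-! ## Invariance under partial automorphisms -/

section PartialAutomorphisms

variable {X : Type*} [MeasurableSpace X] {r : Setoid X} {μ ν : Measure X} {Y : Set X}

/-- The measure of a measurable subset of `Y` is preserved by every injective measurable map
into `Y` whose graph is contained in `r`. -/
def PartialInvariant (r : Setoid X) (Y : Set X) (μ : Measure X) : Prop :=
  ∀ (f : X → X) (S : Set X), Measurable f → MeasurableSet S → InjOn f S → S ⊆ Y → f '' S ⊆ Y →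
    (∀ x ∈ S, r x (f x)) → μ (f '' S) = μ S

theorem PartialInvariant.smul (h : PartialInvariant r Y μ) (c : ℝ≥0∞) :
    PartialInvariant r Y (c • μ) := fun f S hf hS hi h1 h2 h3 => by
  simp [h f S hf hS hi h1 h2 h3]

theorem PartialInvariant.relInvariant (h : PartialInvariant r univ μ) : RelInvariant r μ := by
  intro φ hφ
  refine ⟨φ.measurable, ?_⟩
  ext S hS
  rw [Measure.map_apply φ.measurable hS]
  have := h φ (φ ⁻¹' S) φ.measurable (φ.measurable hS) φ.injective.injOn (subset_univ _)
    (subset_univ _) (fun x _ => hφ x)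
  rw [← this, image_preimage_eq _ φ.surjective]

theorem measure_eq_tsum_inter {K : Type*} [Countable K] {J : K → Set X}
    (hJ : ∀ k, MeasurableSet (J k)) (hd : Pairwise (Function.onFun Disjoint J))
    (h0 : μ (⋃ k, J k)ᶜ = 0) {S : Set X} (hS : MeasurableSet S) :
    μ S = ∑' k, μ (S ∩ J k) := by
  rw [← measure_iUnion (fun i j hij => (hd hij).mono inter_subset_right inter_subset_right)
    (fun k => hS.inter (hJ k)), ← inter_iUnion]
  refine le_antisymm ?_ (measure_mono inter_subset_left)
  calc μ S ≤ μ (S ∩ ⋃ k, J k) + μ (⋃ k, J k)ᶜ := by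
        refine (measure_mono ?_).trans (measure_union_le _ _)
        intro x hx
        by_cases h : x ∈ ⋃ k, J k
        · exact Or.inl ⟨hx, h⟩
        · exact Or.inr h
    _ = _ := by rw [h0, add_zero]

variable [StandardBorelSpace X]

/-- By Lusin–Souslin, injective Borel images are Borel; the inverse is completed by the identity off
the image. -/
theorem exists_measurable_leftInverse {f : X → X} {S : Set X} (hf : Measurable f)
    (hS : MeasurableSet S) (hi : InjOn f S) :
    ∃ g : X → X, Measurable g ∧ ∀ x ∈ S, g (f x) = x := by
  classical
  rcases isEmpty_or_nonempty X with hX | hX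
  · exact ⟨id, measurable_id, fun x => (hX.false x).elim⟩
  have hfS : MeasurableSet (f '' S) := hS.image_of_measurable_injOn hf hi
  refine ⟨fun x => if x ∈ f '' S then Function.invFunOn f S x else x, ?_, ?_⟩
  · intro A hA
    have : (fun x => if x ∈ f '' S then Function.invFunOn f S x else x) ⁻¹' A
        = f '' (S ∩ A) ∪ (A \ f '' S) := by
      ext x
      simp only [mem_preimage, mem_union, mem_sdiff]
      by_cases hx : x ∈ f '' S
      · simp only [hx, if_true, not_true, and_false, or_false]
        obtain ⟨y, hy, rfl⟩ := hx
        rw [hi.leftInvOn_invFunOn hy]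
        constructor
        · exact fun h => ⟨y, ⟨hy, h⟩, rfl⟩
        · rintro ⟨z, ⟨hz, hzA⟩, h⟩
          rwa [← hi hz hy h]
      · simp only [hx, if_false, not_false_iff, and_true]
        constructor
        · exact Or.inr
        · rintro (⟨z, ⟨hz, -⟩, rfl⟩ | h)
          · exact (hx ⟨z, hz, rfl⟩).elim
          · exact h
    rw [this]
    exact ((hS.inter hA).image_of_measurable_injOn hf (hi.mono inter_subset_left)).union
      (hA.diff hfS)
  · intro x hx
    simp only [mem_image_of_mem f hx, if_true]
    exact hi.leftInvOn_invFunOn hx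

/-- Exchanging `S` with `f '' S` and fixing all other points is a Borel involution with graph in
`r`, to which invariance applies. -/
theorem RelInvariant.measure_image_of_disjoint (h : RelInvariant r μ) {f : X → X} {S : Set X}
    (hf : Measurable f) (hS : MeasurableSet S) (hi : InjOn f S) (hr : ∀ x ∈ S, r x (f x))
    (hd : Disjoint S (f '' S)) : μ (f '' S) = μ S := by
  classical
  obtain ⟨g, hg, hgf⟩ := exists_measurable_leftInverse hf hS hi
  have hfS : MeasurableSet (f '' S) := hS.image_of_measurable_injOn hf hi
  set φ : X → X := fun x => if x ∈ S then f x else if x ∈ f '' S then g x else x with hφ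
  have h1 : ∀ x ∈ S, φ x = f x := fun x hx => by simp only [hφ, hx, if_true]
  have h2 : ∀ x ∈ S, φ (f x) = x := fun x hx => by
    have : f x ∉ S := fun h => disjoint_left.1 hd h ⟨x, hx, rfl⟩
    simp only [hφ, this, if_false, mem_image_of_mem f hx, if_true, hgf x hx]
  have h3 : ∀ x, x ∉ S → x ∉ f '' S → φ x = x := fun x hx hx' => by
    simp only [hφ, hx, hx', if_false]
  have hinv : Function.Involutive φ := by
    intro x
    by_cases hx : x ∈ S
    · rw [h1 x hx, h2 x hx]
    by_cases hx' : x ∈ f '' S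
    · obtain ⟨y, hy, rfl⟩ := hx'
      rw [h2 y hy, h1 y hy]
    rw [h3 x hx hx', h3 x hx hx']
  have hφm : Measurable φ := Measurable.ite hS hf (Measurable.ite hfS hg measurable_id)
  let Φ : X ≃ᵐ X := ⟨hinv.toPerm φ, hφm, hφm⟩
  have hΦ : ∀ x, r x (Φ x) := by
    intro x
    change r x (φ x)
    by_cases hx : x ∈ S
    · rw [h1 x hx]; exact hr x hx
    by_cases hx' : x ∈ f '' S
    · obtain ⟨y, hy, rfl⟩ := hx'
      rw [h2 y hy]; exact r.symm (hr y hy)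
    rw [h3 x hx hx']
  have := (h Φ hΦ).measure_preimage hfS.nullMeasurableSet
  rw [← this]
  congr 1
  ext x
  change φ x ∈ f '' S ↔ x ∈ S
  constructor
  · intro hx
    obtain ⟨y, hy, hyx⟩ := hx
    have : x = φ (f y) := by rw [hyx, hinv]
    rw [this, h2 y hy]; exact hy
  · intro hx
    rw [h1 x hx]; exact ⟨x, hx, rfl⟩

/-- Countable additivity over a disjointed cover. It serves to cut the domain of a partial map into
pieces where the map has a simple form. -/
theorem measure_image_eq_of_cover {f : X → X} {S : Set X} (hf : Measurable f)
    (hS : MeasurableSet S) (hi : InjOn f S) {K : Type*} [Countable K] (T : K → Set X)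
    (hT : ∀ k, MeasurableSet (T k)) (hcov : S ⊆ ⋃ k, T k)
    (h : ∀ k, ∀ S' ⊆ S ∩ T k, MeasurableSet S' → μ (f '' S') = ν S') :
    μ (f '' S) = ν S := by
  rcases isEmpty_or_nonempty K with hK | hK
  · have : S = ∅ := by simpa using hcov
    have h0 : S ⊆ ∅ := this.subset
    subst this; simp
  obtain ⟨e, he⟩ := exists_surjective_nat K
  set J : ℕ → Set X := fun n => S ∩ disjointed (fun n => T (e n)) n with hJ
  have hJm : ∀ n, MeasurableSet (J n) := fun n =>
    hS.inter (MeasurableSet.disjointed (fun n => hT (e n)) n)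
  have hSu : S = ⋃ n, J n := by
    rw [hJ, ← inter_iUnion, iUnion_disjointed, eq_comm, inter_eq_left]
    intro x hx
    obtain ⟨k, hk⟩ := mem_iUnion.1 (hcov hx)
    obtain ⟨n, rfl⟩ := he k
    exact mem_iUnion.2 ⟨n, hk⟩
  have hd : Pairwise (Function.onFun Disjoint J) := fun i j hij =>
    (disjoint_disjointed _ hij).mono inter_subset_right inter_subset_right
  have hJS : ∀ n, J n ⊆ S := fun n => inter_subset_left
  rw [hSu, image_iUnion, measure_iUnion hd hJm, measure_iUnion]
  · refine tsum_congr fun n => ?_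
    exact h (e n) (J n) (inter_subset_inter_right _ (disjointed_subset _ n)) (hJm n)
  · intro i j hij
    refine disjoint_left.2 ?_
    rintro _ ⟨x, hx, rfl⟩ ⟨y, hy, hxy⟩
    rw [hi (hJS j hy) (hJS i hx) hxy] at hy
    exact disjoint_left.1 (hd hij) hx hy
  · exact fun n => (hJm n).image_of_measurable_injOn hf (hi.mono (hJS n))

/-- A countable separating family cuts the set of moved points into pieces disjoint from their
images, where the exchange involution is available; on fixed points nothing is to be shown. -/
theorem RelInvariant.partialInvariant (h : RelInvariant r μ) : PartialInvariant r univ μ := by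
  intro f S hf hS hi _ _ hr
  obtain ⟨C, hC, hsep⟩ := exists_seq_separating X MeasurableSet.empty univ
  have hsplit : ∀ x, f x = x ∨ ∃ n, (x ∈ C n ∧ f x ∉ C n) ∨ (x ∉ C n ∧ f x ∈ C n) := by
    intro x
    by_contra! hx
    refine hx.1 (hsep _ (mem_univ _) _ (mem_univ _) fun n => ⟨fun h => ?_, fun h => (hx.2 n).1 h⟩)
    by_contra h'
    exact (hx.2 n).2 h' h
  refine measure_image_eq_of_cover hf hS hi
    (T := fun k : Option (ℕ × Bool) => match k with
      | none => {x | f x = x}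
      | some (n, true) => C n ∩ f ⁻¹' (C n)ᶜ
      | some (n, false) => (C n)ᶜ ∩ f ⁻¹' (C n)) ?_ ?_ ?_
  · rintro (_ | ⟨n, (_ | _)⟩)
    · exact measurableSet_eq_fun hf measurable_id
    · exact (hC n).compl.inter (hf (hC n))
    · exact (hC n).inter (hf (hC n).compl)
  · intro x _
    rcases hsplit x with h | ⟨n, h | h⟩
    · exact mem_iUnion.2 ⟨none, h⟩
    · exact mem_iUnion.2 ⟨some (n, true), h⟩
    · exact mem_iUnion.2 ⟨some (n, false), h⟩
  · rintro (_ | ⟨n, (_ | _)⟩) S' hS' hS'm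
    · congr 1
      have : EqOn f id S' := fun x hx => (hS' hx).2
      rw [this.image_eq, image_id]
    · refine h.measure_image_of_disjoint hf hS'm (hi.mono fun x hx => (hS' hx).1)
        (fun x hx => hr x (hS' hx).1) (disjoint_left.2 ?_)
      rintro _ hx ⟨y, hy, rfl⟩
      exact (hS' hx).2.1 (hS' hy).2.2
    · refine h.measure_image_of_disjoint hf hS'm (hi.mono fun x hx => (hS' hx).1)
        (fun x hx => hr x (hS' hx).1) (disjoint_left.2 ?_)
      rintro _ hx ⟨y, hy, rfl⟩
      exact (hS' hy).2.2 (hS' hx).2.1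

/-- A partial map of `X` becomes a self-map of `Y` by using the identity wherever it leaves `Y`, and
an automorphism of `Y` extends to `X` by the identity. -/
theorem relInvariant_comap_iff (hY : MeasurableSet Y) (ν : Measure Y) :
    RelInvariant (r.comap Subtype.val) ν ↔ PartialInvariant r Y (ν.map Subtype.val) := by
  classical
  have : StandardBorelSpace Y := hY.standardBorel
  constructor
  · intro h f S hf hS hi hSY hfY hr
    have hfS : MeasurableSet (f '' S) := hS.image_of_measurable_injOn hf hi
    rw [Measure.map_apply measurable_subtype_coe hfS, Measure.map_apply measurable_subtype_coe hS]
    have hex : ∃ g : Y → Y, Measurable g ∧ ∀ y : Y, f y ∈ Y → (g y : X) = f y := by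
      refine ⟨fun y => if h : f y ∈ Y then ⟨f y, h⟩ else y, ?_, ?_⟩
      · rw [← (MeasurableEmbedding.subtype_coe hY).measurable_comp_iff]
        have hfm : Measurable fun y : Y => f y := hf.comp measurable_subtype_coe
        have : (Subtype.val ∘ fun y : Y => if h : f y ∈ Y then (⟨f y, h⟩ : Y) else y)
            = fun y : Y => if f y ∈ Y then f y else (y : X) := by
          ext y
          by_cases h : f y ∈ Y <;> simp [h]
        rw [this]
        exact Measurable.ite (hfm hY) hfm measurable_subtype_coe
      · intro y hy; simp [hy]
    obtain ⟨g, hg, hgf⟩ := hex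
    have hm : ∀ y : Y, (y : X) ∈ S → (g y : X) = f y := fun y hy => hgf y (hfY ⟨y, hy, rfl⟩)
    have := h.partialInvariant g (Subtype.val ⁻¹' S) hg (measurable_subtype_coe hS) ?_
      (subset_univ _) (subset_univ _) ?_
    · rw [← this]
      congr 1
      ext y
      constructor
      · rintro ⟨x, hx, hxy⟩
        exact ⟨⟨x, hSY hx⟩, hx, Subtype.ext ((hm _ hx).trans hxy)⟩
      · rintro ⟨x, hx, rfl⟩
        exact ⟨x, hx, (hm x hx).symm⟩
    · intro x hx y hy hxy
      apply Subtype.ext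
      apply hi hx hy
      rw [← hm x hx, ← hm y hy, hxy]
    · intro x hx
      change r x (g x)
      rw [hm x hx]; exact hr x hx
  · intro h φ hφ
    refine ⟨φ.measurable, ?_⟩
    ext S hS
    rw [Measure.map_apply φ.measurable hS]
    have hval : ∀ T : Set Y, MeasurableSet T →
        ν.map Subtype.val (Subtype.val '' T) = ν T := fun T hT => by
      rw [Measure.map_apply measurable_subtype_coe (hY.subtype_image hT),
        preimage_image_eq _ Subtype.val_injective]
    have hex : ∃ g : X → X, Measurable g ∧ ∀ y : Y, g y = φ y := by
      refine ⟨fun x => if h : x ∈ Y then φ ⟨x, h⟩ else x, ?_, ?_⟩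
      · exact Measurable.dite (measurable_subtype_coe.comp φ.measurable)
          (measurable_subtype_coe) hY
      · intro y; simp
    obtain ⟨g, hg, hgf⟩ := hex
    have himg : g '' (Subtype.val '' (φ ⁻¹' S)) = Subtype.val '' S := by
      rw [image_image]
      simp only [hgf]
      rw [← image_image Subtype.val φ, image_preimage_eq _ φ.surjective]
    have hpre : MeasurableSet (φ ⁻¹' S) := φ.measurable hS
    have := h g (Subtype.val '' (φ ⁻¹' S)) hg (hY.subtype_image hpre) ?_ ?_ ?_ ?_
    · rw [himg, hval _ hS, hval _ hpre] at this
      exact this.symm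
    · rintro _ ⟨x, -, rfl⟩ _ ⟨y, -, rfl⟩ hxy
      rw [hgf, hgf] at hxy
      rw [φ.injective (Subtype.ext hxy)]
    · rintro _ ⟨x, -, rfl⟩; exact x.2
    · rw [himg]; rintro _ ⟨x, -, rfl⟩; exact x.2
    · rintro _ ⟨x, -, rfl⟩
      rw [hgf]; exact hφ x

end PartialAutomorphisms

/-! ## Extending a measure invariantly to the saturation -/

section Extension

variable {X : Type*} [MeasurableSpace X] [StandardBorelSpace X] {r : Setoid X}
  {D : ℕ → Set X} {G : ℕ → X → X} {Y : Set X} {μ μ' ν : Measure X}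

/-- The relation `r` is the union of the graphs of the partial injections `G k` on `D k`. -/
structure GeneratedBy (r : Setoid X) (D : ℕ → Set X) (G : ℕ → X → X) : Prop where
  measurableSet : ∀ k, MeasurableSet (D k)
  measurable : ∀ k, Measurable (G k)
  injOn : ∀ k, InjOn (G k) (D k)
  rel : ∀ k, ∀ x ∈ D k, r x (G k x)
  cover : ∀ x y, r x y → ∃ k, x ∈ D k ∧ G k x = y

/-- The set of points equivalent to a point of `Y`. -/
def relSaturation (r : Setoid X) (Y : Set X) : Set X := {x | ∃ y ∈ Y, r x y}

omit [MeasurableSpace X] [StandardBorelSpace X] in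
theorem subset_relSaturation (r : Setoid X) (Y : Set X) : Y ⊆ relSaturation r Y :=
  fun x hx => ⟨x, hx, r.refl x⟩

/-- A partition of the saturation of `Y` into images of subsets of `Y` under the generators. -/
def satPiece (D : ℕ → Set X) (G : ℕ → X → X) (Y : Set X) (k : ℕ) : Set X :=
  disjointed (fun k => G k '' (D k ∩ Y)) k

/-- The candidate for the invariant extension of `ν` from `Y` to its saturation. -/
noncomputable def satExtension (D : ℕ → Set X) (G : ℕ → X → X) (Y : Set X) (ν : Measure X) :
    Measure X :=
  Measure.sum fun k => (ν.restrict (D k ∩ Y ∩ G k ⁻¹' satPiece D G Y k)).map (G k)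

namespace GeneratedBy

/-- Every partial map inside `r` coincides with one of the generators on each of countably many
pieces. -/
theorem partialInvariant (hG : GeneratedBy r D G)
    (h : ∀ k S, MeasurableSet S → S ⊆ D k → S ⊆ Y → G k '' S ⊆ Y → μ (G k '' S) = μ S) :
    PartialInvariant r Y μ := by
  intro f S hf hS hi hSY hfY hr
  refine measure_image_eq_of_cover hf hS hi (T := fun k => D k ∩ {x | f x = G k x})
    (fun k => (hG.measurableSet k).inter (measurableSet_eq_fun hf (hG.measurable k))) ?_ ?_
  · intro x hx
    obtain ⟨k, hk, h⟩ := hG.cover _ _ (hr x hx)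
    exact mem_iUnion.2 ⟨k, hk, h.symm⟩
  · intro k S' hS' hS'm
    have : EqOn f (G k) S' := fun x hx => (hS' hx).2.2
    rw [this.image_eq]
    refine h k S' hS'm (fun x hx => (hS' hx).2.1) (fun x hx => hSY (hS' hx).1) ?_
    rw [← this.image_eq]
    exact (image_mono fun x hx => (hS' hx).1).trans hfY

section

variable (hG : GeneratedBy r D G) (hY : MeasurableSet Y)
include hG hY

theorem measurableSet_satPiece (k : ℕ) : MeasurableSet (satPiece D G Y k) :=
  MeasurableSet.disjointed (fun k => ((hG.measurableSet k).inter hY).image_of_measurable_injOn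
    (hG.measurable k) ((hG.injOn k).mono inter_subset_left)) k

omit [StandardBorelSpace X] hY in
theorem iUnion_satPiece : ⋃ k, satPiece D G Y k = relSaturation r Y := by
  unfold satPiece
  rw [iUnion_disjointed]
  ext x
  simp only [mem_iUnion, relSaturation, mem_ofPred_eq]
  constructor
  · rintro ⟨k, y, ⟨hy, hyY⟩, rfl⟩
    exact ⟨y, hyY, r.symm (hG.rel k y hy)⟩
  · rintro ⟨y, hy, h⟩
    obtain ⟨k, hk, rfl⟩ := hG.cover _ _ (r.symm h)
    exact ⟨k, y, ⟨hk, hy⟩, rfl⟩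

theorem measurableSet_relSaturation : MeasurableSet (relSaturation r Y) := by
  rw [← hG.iUnion_satPiece]
  exact MeasurableSet.iUnion (hG.measurableSet_satPiece hY)

omit [MeasurableSpace X] [StandardBorelSpace X] hG hY in
theorem pairwise_disjoint_satPiece :
    Pairwise (Function.onFun Disjoint (satPiece D G Y)) := disjoint_disjointed _

omit [MeasurableSpace X] [StandardBorelSpace X] hG hY in
theorem satPiece_subset (k : ℕ) : satPiece D G Y k ⊆ G k '' (D k ∩ Y) := disjointed_subset _ k

theorem measure_eq_tsum_satPiece (h0 : μ (relSaturation r Y)ᶜ = 0) {S : Set X}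
    (hS : MeasurableSet S) : μ S = ∑' k, μ (S ∩ satPiece D G Y k) :=
  measure_eq_tsum_inter (hG.measurableSet_satPiece hY) pairwise_disjoint_satPiece
    (by rwa [hG.iUnion_satPiece]) hS

omit [MeasurableSpace X] [StandardBorelSpace X] hG hY in
theorem image_source {k : ℕ} {T : Set X} (hT : T ⊆ satPiece D G Y k) :
    G k '' (D k ∩ Y ∩ G k ⁻¹' T) = T := by
  ext x
  constructor
  · rintro ⟨y, hy, rfl⟩; exact hy.2
  · intro hx
    obtain ⟨y, hy, rfl⟩ := satPiece_subset k (hT hx)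
    exact ⟨y, ⟨hy, hx⟩, rfl⟩

omit [StandardBorelSpace X] in
theorem measurableSet_source {k : ℕ} {T : Set X} (hT : MeasurableSet T) :
    MeasurableSet (D k ∩ Y ∩ G k ⁻¹' T) :=
  ((hG.measurableSet k).inter hY).inter (hG.measurable k hT)

omit [StandardBorelSpace X] hY in
theorem satExtension_apply_piece {k : ℕ} {T : Set X} (hT : MeasurableSet T)
    (hTk : T ⊆ satPiece D G Y k) : satExtension D G Y ν T = ν (D k ∩ Y ∩ G k ⁻¹' T) := by
  rw [satExtension, Measure.sum_apply _ hT, tsum_eq_single k]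
  · rw [Measure.map_apply (hG.measurable k) hT, Measure.restrict_apply (hG.measurable k hT)]
    congr 1
    ext x
    simp only [mem_inter_iff, mem_preimage]
    exact ⟨fun h => ⟨h.2.1, h.1⟩, fun h => ⟨h.2, h.1, hTk h.2⟩⟩
  · intro l hl
    rw [Measure.map_apply (hG.measurable l) hT, Measure.restrict_apply (hG.measurable l hT)]
    convert measure_empty (μ := ν)
    refine eq_empty_of_forall_notMem fun x hx => ?_
    exact disjoint_left.1 (pairwise_disjoint_satPiece hl) hx.2.2 (hTk hx.1)

theorem satExtension_compl : satExtension D G Y ν (relSaturation r Y)ᶜ = 0 := by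
  have hm := (hG.measurableSet_relSaturation hY).compl
  rw [satExtension, Measure.sum_apply _ hm, ENNReal.tsum_eq_zero]
  intro l
  rw [Measure.map_apply (hG.measurable l) hm, Measure.restrict_apply (hG.measurable l hm)]
  convert measure_empty (μ := ν)
  refine eq_empty_of_forall_notMem fun x hx => hx.1 ?_
  rw [← hG.iUnion_satPiece]
  exact mem_iUnion.2 ⟨l, hx.2.2⟩

/-- On the part of the `k`-th piece that `f` sends into the `l`-th piece, both masses are `ν`-masses
of sources in `Y`. The partial map "inverse of `G l`, after `f`, after `G k`" matches these sources
inside `Y`, where `ν` is invariant. -/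
theorem partialInvariant_satExtension (hν : PartialInvariant r Y ν) :
    PartialInvariant r univ (satExtension D G Y ν) := by
  intro f S hf hS hi _ _ hr
  refine measure_image_eq_of_cover hf hS hi
    (T := fun p : Option (ℕ × ℕ) => match p with
      | none => (relSaturation r Y)ᶜ
      | some (k, l) => satPiece D G Y k ∩ f ⁻¹' satPiece D G Y l) ?_ ?_ ?_
  · rintro (_ | ⟨k, l⟩)
    · exact (hG.measurableSet_relSaturation hY).compl
    · exact (hG.measurableSet_satPiece hY k).inter (hf (hG.measurableSet_satPiece hY l))
  · intro x hx
    by_cases h : x ∈ relSaturation r Y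
    · have hfx : f x ∈ relSaturation r Y := by
        obtain ⟨y, hy, hxy⟩ := h
        exact ⟨y, hy, r.trans (r.symm (hr x hx)) hxy⟩
      rw [← hG.iUnion_satPiece] at h hfx
      obtain ⟨k, hk⟩ := mem_iUnion.1 h
      obtain ⟨l, hl⟩ := mem_iUnion.1 hfx
      exact mem_iUnion.2 ⟨some (k, l), hk, hl⟩
    · exact mem_iUnion.2 ⟨none, h⟩
  · rintro (_ | ⟨k, l⟩) T hT hTm
    · rw [measure_mono_null (fun x hx => (hT hx).2) (hG.satExtension_compl hY),
        measure_mono_null _ (hG.satExtension_compl hY)]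
      rintro _ ⟨x, hx, rfl⟩ ⟨y, hy, hxy⟩
      exact (hT hx).2 ⟨y, hy, r.trans (hr x (hT hx).1) hxy⟩
    · have hTk : T ⊆ satPiece D G Y k := fun x hx => (hT hx).2.1
      have hTl : f '' T ⊆ satPiece D G Y l := by
        rintro _ ⟨x, hx, rfl⟩; exact (hT hx).2.2
      have hiT : InjOn f T := hi.mono fun x hx => (hT hx).1
      have hfT : MeasurableSet (f '' T) := hTm.image_of_measurable_injOn hf hiT
      rw [hG.satExtension_apply_piece hTm hTk, hG.satExtension_apply_piece hfT hTl]
      obtain ⟨g, hg, hgG⟩ := exists_measurable_leftInverse (hG.measurable l)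
        ((hG.measurableSet l).inter hY) ((hG.injOn l).mono inter_subset_left)
      have key : ∀ x ∈ D k ∩ Y ∩ G k ⁻¹' T, ∃ y ∈ D l ∩ Y, G l y = f (G k x) ∧
          g (f (G k x)) = y := by
        intro x hx
        obtain ⟨y, hy, hyx⟩ := satPiece_subset l (hTl ⟨_, hx.2, rfl⟩)
        exact ⟨y, hy, hyx, by rw [← hyx, hgG y hy]⟩
      have himg : (g ∘ f ∘ G k) '' (D k ∩ Y ∩ G k ⁻¹' T) = D l ∩ Y ∩ G l ⁻¹' (f '' T) := by
        ext y
        constructor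
        · rintro ⟨x, hx, rfl⟩
          obtain ⟨y, hy, h1, h2⟩ := key x hx
          simp only [Function.comp, h2]
          exact ⟨hy, by rw [mem_preimage, h1]; exact ⟨_, hx.2, rfl⟩⟩
        · rintro ⟨hy, z, hz, hzy⟩
          rw [← image_source hTk] at hz
          obtain ⟨x, hx, rfl⟩ := hz
          refine ⟨x, hx, ?_⟩
          simp only [Function.comp]
          rw [hzy, hgG y hy]
      rw [← himg]
      refine hν _ _ (hg.comp (hf.comp (hG.measurable k))) (hG.measurableSet_source hY hTm) ?_
        (fun x hx => hx.1.2) ?_ ?_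
      · intro x hx x' hx' h
        obtain ⟨y, hy, h1, h2⟩ := key x hx
        obtain ⟨y', hy', h1', h2'⟩ := key x' hx'
        simp only [Function.comp, h2, h2'] at h
        subst h
        exact hG.injOn k hx.1.1 hx'.1.1 (hiT hx.2 hx'.2 (h1.symm.trans h1'))
      · rw [himg]; exact fun x hx => hx.1.2
      · intro x hx
        obtain ⟨y, hy, h1, h2⟩ := key x hx
        simp only [Function.comp, h2]
        refine r.trans (hG.rel k x hx.1.1) (r.trans (hr _ (hT hx.2).1) ?_)
        rw [← h1]
        exact r.symm (hG.rel l y hy.1)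

/-- A point of `Y` may lie in a piece whose generator moves it, so invariance of `ν` is needed to
compare the piece with its source. -/
theorem satExtension_apply_of_subset (hν : PartialInvariant r Y ν) {T : Set X}
    (hT : MeasurableSet T) (hTY : T ⊆ Y) : satExtension D G Y ν T = ν T := by
  have hres : ν T = ν.restrict Y T := by rw [Measure.restrict_apply hT, inter_eq_left.2 hTY]
  rw [hG.measure_eq_tsum_satPiece hY (hG.satExtension_compl hY) hT, hres,
    hG.measure_eq_tsum_satPiece hY (μ := ν.restrict Y) _ hT]
  · refine tsum_congr fun k => ?_
    have hm := hT.inter (hG.measurableSet_satPiece hY k)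
    have hs : T ∩ satPiece D G Y k ⊆ satPiece D G Y k := inter_subset_right
    rw [hG.satExtension_apply_piece hm hs, Measure.restrict_apply hm,
      inter_eq_left.2 (inter_subset_left.trans hTY)]
    have := hν (G k) _ (hG.measurable k) (hG.measurableSet_source hY hm)
      ((hG.injOn k).mono fun x hx => hx.1.1) (fun x hx => hx.1.2)
      (by rw [image_source hs]; exact inter_subset_left.trans hTY)
      (fun x hx => hG.rel k x hx.1.1)
    rw [image_source hs] at this
    exact this.symm
  · rw [Measure.restrict_apply (hG.measurableSet_relSaturation hY).compl]
    convert measure_empty (μ := ν)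
    refine eq_empty_of_forall_notMem fun x hx => hx.1 (subset_relSaturation r Y hx.2)

omit [StandardBorelSpace X] in
theorem measure_piece (hμ : PartialInvariant r univ μ) {k : ℕ} {T : Set X} (hT : MeasurableSet T)
    (hTk : T ⊆ satPiece D G Y k) : μ T = μ (D k ∩ Y ∩ G k ⁻¹' T) := by
  have := hμ (G k) _ (hG.measurable k) (hG.measurableSet_source hY hT)
      ((hG.injOn k).mono fun x hx => hx.1.1) (subset_univ _) (subset_univ _)
      (fun x hx => hG.rel k x hx.1.1)
  rwa [image_source hTk] at this

theorem ext_of_partialInvariant (hμ : PartialInvariant r univ μ)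
    (hμ' : PartialInvariant r univ μ') (h0 : μ (relSaturation r Y)ᶜ = 0)
    (h0' : μ' (relSaturation r Y)ᶜ = 0)
    (h : ∀ T, MeasurableSet T → T ⊆ Y → μ T = μ' T) : μ = μ' := by
  ext S hS
  rw [hG.measure_eq_tsum_satPiece hY h0 hS, hG.measure_eq_tsum_satPiece hY h0' hS]
  refine tsum_congr fun k => ?_
  have hm := hS.inter (hG.measurableSet_satPiece hY k)
  rw [hG.measure_piece hY hμ hm inter_subset_right, hG.measure_piece hY hμ' hm inter_subset_right]
  exact h _ (hG.measurableSet_source hY hm) fun x hx => hx.1.2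

theorem sigmaFinite (hμ : PartialInvariant r univ μ) (h0 : μ (relSaturation r Y)ᶜ = 0)
    (hfin : μ Y ≠ ∞) : SigmaFinite μ := by
  refine Measure.sigmaFinite_of_countable
    (S := insert (relSaturation r Y)ᶜ (range (satPiece D G Y)))
    ((countable_range _).insert _) ?_ ?_
  · rintro s (rfl | ⟨k, rfl⟩)
    · simp [h0]
    · rw [hG.measure_piece hY hμ (hG.measurableSet_satPiece hY k) subset_rfl]
      exact (measure_mono fun x hx => hx.1.2).trans_lt hfin.lt_top
  · rw [sUnion_insert, sUnion_range, hG.iUnion_satPiece, compl_union_self]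

/-- The generators pull every piece of a saturated set back into its intersection with `Y`. -/
theorem measure_saturated_eq_zero (hμ : PartialInvariant r univ μ)
    (h0 : μ (relSaturation r Y)ᶜ = 0) {S : Set X} (hS : MeasurableSet S)
    (hsat : ∀ x y, r x y → x ∈ S → y ∈ S) (h : μ (S ∩ Y) = 0) : μ S = 0 := by
  rw [hG.measure_eq_tsum_satPiece hY h0 hS, ENNReal.tsum_eq_zero]
  intro k
  rw [hG.measure_piece hY hμ (hS.inter (hG.measurableSet_satPiece hY k)) inter_subset_right]
  have hsub : D k ∩ Y ∩ G k ⁻¹' (S ∩ satPiece D G Y k) ⊆ S ∩ Y := fun x hx =>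
    ⟨hsat _ _ (r.symm (hG.rel k x hx.1.1)) hx.2.1, hx.1.2⟩
  exact measure_mono_null hsub h

end

end GeneratedBy

end Extension

/-! ## The path space -/

namespace BratteliDiagram

variable {B : BratteliDiagram.{u, v}}

/-- The cylinder of all paths sharing the first `n + 1` edges with `x`. -/
def cyl (x : B.PathSpace) (n : ℕ) : Set B.PathSpace := {z | ∀ i ≤ n, z.1 i = x.1 i}

theorem mem_cyl_self (x : B.PathSpace) (n : ℕ) : x ∈ cyl x n := fun _ _ => rfl

theorem cyl_eq_of_mem {x z : B.PathSpace} {n : ℕ} (h : z ∈ cyl x n) : cyl z n = cyl x n := by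
  ext y
  exact ⟨fun hy i hi => (hy i hi).trans (h i hi), fun hy i hi => (hy i hi).trans (h i hi).symm⟩

theorem cyl_anti (x : B.PathSpace) {m n : ℕ} (h : m ≤ n) : cyl x n ⊆ cyl x m :=
  fun _ hz i hi => hz i (hi.trans h)

theorem isOpen_cyl (x : B.PathSpace) (n : ℕ) : IsOpen (cyl x n) := by
  refine TopologicalSpace.isOpen_generateFrom_of_mem ⟨x.1, n + 1, ?_⟩
  ext z
  simp [cyl]

theorem isOpen_of_cyl {U : Set B.PathSpace} (n : ℕ) (h : ∀ x ∈ U, cyl x n ⊆ U) : IsOpen U := by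
  have : U = ⋃ x ∈ U, cyl x n := by
    ext y
    simp only [mem_iUnion]
    exact ⟨fun hy => ⟨y, hy, mem_cyl_self y n⟩, fun ⟨x, hx, hy⟩ => h x hx hy⟩
  rw [this]
  exact isOpen_biUnion fun x _ => isOpen_cyl x n

theorem isClosed_of_cyl {U : Set B.PathSpace} (n : ℕ) (h : ∀ x ∈ U, cyl x n ⊆ U) :
    IsClosed U := by
  refine isOpen_compl_iff.1 (isOpen_of_cyl n fun x hx z hz hzU => hx (h z hzU ?_))
  rw [cyl_eq_of_mem hz]
  exact mem_cyl_self x n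

theorem isClosed_cyl (x : B.PathSpace) (n : ℕ) : IsClosed (cyl x n) :=
  isClosed_of_cyl n fun _ hy => (cyl_eq_of_mem hy).subset

theorem measurableSet_cyl (x : B.PathSpace) (n : ℕ) : MeasurableSet (cyl x n) :=
  (isOpen_cyl x n).measurableSet

section Topology

attribute [local instance] BratteliDiagram.finite_E

/-- The sequence of edges of a path. -/
def edges (x : B.PathSpace) : ∀ n, B.E n := x.1

/-- Being a path is a countable family of closed conditions in a product of finite discrete spaces.
Compactness and the Polish structure of `X_B` come from here. -/
theorem isClosedEmbedding_edges [∀ n, TopologicalSpace (B.E n)] [∀ n, DiscreteTopology (B.E n)] :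
    Topology.IsClosedEmbedding (edges : B.PathSpace → ∀ n, B.E n) := by
  refine ⟨⟨⟨le_antisymm ?_ ?_⟩, fun x y h => Subtype.ext h⟩, ?_⟩
  · refine continuous_iff_le_induced.1 (continuous_pi fun n => continuous_discrete_rng.2 fun e => ?_)
    refine isOpen_of_cyl n fun x hx z hz => ?_
    exact (hz n le_rfl).trans hx
  · refine le_generateFrom ?_
    rintro _ ⟨e, n, rfl⟩
    refine isOpen_induced_iff.2 ⟨(Set.Iio n).pi fun i => {e i},
      isOpen_set_pi (Set.finite_Iio n) fun i _ => isOpen_discrete _, ?_⟩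
    ext x
    simp [edges]
  · have : range (edges : B.PathSpace → ∀ n, B.E n) =
        ⋂ n, {x | B.rng n (x n) = B.src (n + 1) (x (n + 1))} := by
      ext x
      simp only [mem_range, mem_iInter]
      exact ⟨fun ⟨y, hy⟩ n => hy ▸ y.2 n, fun h => ⟨⟨x, h⟩, rfl⟩⟩
    rw [this]
    refine isClosed_iInter fun n => ?_
    let _ : TopologicalSpace (B.V (n + 1)) := ⊥
    have : DiscreteTopology (B.V (n + 1)) := ⟨rfl⟩
    exact isClosed_eq ((continuous_of_discreteTopology (f := B.rng n)).comp (continuous_apply n))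
      ((continuous_of_discreteTopology (f := B.src (n + 1))).comp (continuous_apply (n + 1)))

instance : CompactSpace B.PathSpace := by
  let _ : ∀ n, TopologicalSpace (B.E n) := fun _ => ⊥
  have : ∀ n, DiscreteTopology (B.E n) := fun _ => ⟨rfl⟩
  exact (isClosedEmbedding_edges (B := B)).compactSpace

instance : PolishSpace B.PathSpace := by
  let _ : ∀ n, TopologicalSpace (B.E n) := fun _ => ⊥
  have : ∀ n, DiscreteTopology (B.E n) := fun _ => ⟨rfl⟩
  have : ∀ n, PolishSpace (B.E n) := fun n => inferInstance
  exact (isClosedEmbedding_edges (B := B)).polishSpace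

end Topology

theorem exists_seq_dense (B : BratteliDiagram.{u, v}) [Nonempty B.PathSpace] :
    ∃ s : ℕ → B.PathSpace, ∀ x n, ∃ k, s k ∈ cyl x n := by
  refine ⟨TopologicalSpace.denseSeq B.PathSpace, fun x n => ?_⟩
  exact (TopologicalSpace.denseRange_denseSeq B.PathSpace).exists_mem_open
    (isOpen_cyl x n) ⟨x, mem_cyl_self x n⟩

theorem exists_mem_cyl_succ (x : B.PathSpace) (n : ℕ) (e : B.E (n + 1))
    (he : B.src (n + 1) e = B.rng n (x.1 n)) : ∃ y ∈ cyl x n, y.1 (n + 1) = e := by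
  choose next hnext using fun (m : ℕ) (f : B.E m) => B.src_surjective (m + 1) (B.rng m f)
  -- The recursion copies `x` up to index `n`, takes `e` at `n + 1` (the case `i = n`), and then
  -- continues with chosen successors.
  let y : ∀ m, B.E m := fun m => Nat.rec (motive := B.E) (x.1 0)
    (fun i f => if i ≤ n then Function.update x.1 (n + 1) e (i + 1) else next i f) m
  have hle : ∀ i ≤ n, y i = x.1 i := by
    rintro (_ | i) hi
    · rfl
    · change (if i ≤ n then _ else _) = _
      rw [if_pos (Nat.le_of_succ_le hi), Function.update_of_ne (by omega)]
  have heq : y (n + 1) = e := by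
    change (if n ≤ n then _ else _) = _
    simp
  refine ⟨⟨y, fun i => ?_⟩, hle, heq⟩
  rcases lt_trichotomy i n with hi | rfl | hi
  · rw [hle i hi.le, hle (i + 1) hi]; exact x.2 i
  · rw [hle i le_rfl, heq, he]
  · have : y (i + 1) = next i (y i) := by
      change (if i ≤ n then _ else _) = _
      rw [if_neg (by omega)]
    rw [this, hnext]

theorem exists_path (n : ℕ) (e : B.E n) : ∃ x : B.PathSpace, x.1 n = e := by
  induction n with
  | zero =>
    choose next hnext using fun (m : ℕ) (f : B.E m) => B.src_surjective (m + 1) (B.rng m f)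
    exact ⟨⟨fun m => Nat.rec (motive := B.E) e (fun i f => next i f) m, fun i => (hnext i _).symm⟩,
      rfl⟩
  | succ n ih =>
    obtain ⟨f, hf⟩ := B.rng_surjective n (B.src (n + 1) e)
    obtain ⟨x, hx⟩ := ih f
    obtain ⟨y, -, hy⟩ := exists_mem_cyl_succ x n e (by rw [hx, hf])
    exact ⟨y, hy⟩

instance : Nonempty B.PathSpace := by
  obtain ⟨v⟩ := B.root
  obtain ⟨e, -⟩ := B.src_surjective 0 v.default
  exact ⟨(exists_path 0 e).choose⟩

/-! ### Changing a prefix -/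

open Classical in
/-- Replace the first `n + 1` edges of `x` by those of `b` if the result is a path. -/
noncomputable def splice (b : B.PathSpace) (n : ℕ) (x : B.PathSpace) : B.PathSpace :=
  if h : B.rng n (b.1 n) = B.rng n (x.1 n) then
    ⟨fun i => if i ≤ n then b.1 i else x.1 i, by
      intro i
      rcases lt_trichotomy i n with hi | rfl | hi
      · simp only [hi.le, Nat.succ_le_of_lt hi, if_true]; exact b.2 i
      · simp [h, x.2 i]
      · simp only [not_le.2 hi, not_le.2 (Nat.lt_succ_of_lt hi), if_false]; exact x.2 i⟩
  else x

theorem splice_apply_le {b x : B.PathSpace} {n i : ℕ} (h : B.rng n (b.1 n) = B.rng n (x.1 n))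
    (hi : i ≤ n) : (splice b n x).1 i = b.1 i := by
  simp [splice, h, hi]

theorem splice_apply_gt {b x : B.PathSpace} {n i : ℕ} (hi : n < i) :
    (splice b n x).1 i = x.1 i := by
  by_cases h : B.rng n (b.1 n) = B.rng n (x.1 n) <;> simp [splice, h, not_le.2 hi]

theorem tail_splice (b : B.PathSpace) (n : ℕ) (x : B.PathSpace) : B.tail x (splice b n x) :=
  ⟨n + 1, fun _ hi => (splice_apply_gt hi).symm⟩

theorem splice_mem_cyl {b x : B.PathSpace} {n : ℕ} (h : B.rng n (b.1 n) = B.rng n (x.1 n)) :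
    splice b n x ∈ cyl b n := fun _ hi => splice_apply_le h hi

theorem ext_path {x y : B.PathSpace} (h : ∀ i, x.1 i = y.1 i) : x = y :=
  Subtype.ext (funext h)

theorem splice_splice {a b x : B.PathSpace} {n : ℕ} (h : B.rng n (a.1 n) = B.rng n (b.1 n))
    (hx : x ∈ cyl a n) : splice a n (splice b n x) = x := by
  have h1 : B.rng n (b.1 n) = B.rng n (x.1 n) := by rw [hx n le_rfl, h]
  refine ext_path fun i => ?_
  rcases le_or_gt i n with hi | hi
  · rw [splice_apply_le _ hi, hx i hi]
    rw [splice_apply_le h1 le_rfl, h]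
  · rw [splice_apply_gt hi, splice_apply_gt hi]

theorem injOn_splice {a b : B.PathSpace} {n : ℕ} (h : B.rng n (a.1 n) = B.rng n (b.1 n)) :
    InjOn (splice b n) (cyl a n) := fun x hx y hy hxy => by
  rw [← splice_splice h hx, ← splice_splice h hy, hxy]

/-- Prefix changes match long cylinders with long cylinders, which allows invariance to be tested on
cylinders. -/
theorem preimage_splice_cyl {b x : B.PathSpace} {n m : ℕ} (hmn : n ≤ m) {z : B.PathSpace}
    (hz : z ∈ cyl b n) (h : B.rng n (x.1 n) = B.rng n (b.1 n)) :
    splice b n ⁻¹' (cyl z m) ∩ cyl x n = cyl (splice x n z) m := by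
  have hxz : B.rng n (x.1 n) = B.rng n (z.1 n) := by rw [hz n le_rfl, h]
  ext y
  constructor
  · rintro ⟨h1, h2⟩ i hi
    rcases le_or_gt i n with hin | hin
    · rw [splice_apply_le hxz hin, h2 i hin]
    · rw [splice_apply_gt hin, ← h1 i hi, splice_apply_gt hin]
  · intro hy
    have hyx : y ∈ cyl x n := fun i hi => by
      rw [hy i (hi.trans hmn), splice_apply_le hxz hi]
    refine ⟨fun i hi => ?_, hyx⟩
    rcases le_or_gt i n with hin | hin
    · rw [splice_apply_le _ hin, hz i hin]
      rw [hyx n le_rfl, h]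
    · rw [splice_apply_gt hin, hy i hi, splice_apply_gt hin]

theorem continuous_splice (b : B.PathSpace) (n : ℕ) : Continuous (splice b n) := by
  refine continuous_generateFrom_iff.2 ?_
  rintro _ ⟨e, m, rfl⟩
  refine isOpen_of_cyl (max m n) fun x hx z hz i hi => ?_
  rw [← hx i hi]
  have h1 : z.1 i = x.1 i := hz i (hi.le.trans (le_max_left _ _))
  have h2 : z.1 n = x.1 n := hz n (le_max_right _ _)
  rcases le_or_gt i n with hin | hin
  · by_cases h : B.rng n (b.1 n) = B.rng n (x.1 n)
    · rw [splice_apply_le h hin, splice_apply_le (h2 ▸ h) hin]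
    · have h' : ¬ B.rng n (b.1 n) = B.rng n (z.1 n) := h2 ▸ h
      simp [splice, h, h', h1]
  · rw [splice_apply_gt hin, splice_apply_gt hin, h1]

theorem measurable_splice (b : B.PathSpace) (n : ℕ) : Measurable (splice b n) :=
  (continuous_splice b n).measurable

end BratteliDiagram

namespace BratteliDiagram

variable {B : BratteliDiagram.{u, v}}

/-! ### Measures on the path space -/

theorem cyl_subset_or_disjoint (x y : B.PathSpace) {n m : ℕ} (h : n ≤ m) :
    cyl y m ⊆ cyl x n ∨ Disjoint (cyl y m) (cyl x n) := by
  by_cases hy : y ∈ cyl x n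
  · left
    rw [← cyl_eq_of_mem hy]
    exact cyl_anti y h
  · right
    refine disjoint_left.2 fun z hz hz' => hy ?_
    rw [← cyl_eq_of_mem hz', cyl_eq_of_mem (cyl_anti y h hz)]
    exact mem_cyl_self y n

theorem isPiSystem_cyl (n : ℕ) :
    IsPiSystem {U : Set B.PathSpace | ∃ x, ∃ m ≥ n, U = cyl x m} := by
  rintro _ ⟨x, m, hm, rfl⟩ _ ⟨y, k, hk, rfl⟩ hne
  rcases le_total m k with h | h
  · rcases cyl_subset_or_disjoint x y h with h' | h'
    · rw [inter_eq_right.2 h']; exact ⟨y, k, hk, rfl⟩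
    · exact (hne.ne_empty h'.symm.inter_eq).elim
  · rcases cyl_subset_or_disjoint y x h with h' | h'
    · rw [inter_eq_left.2 h']; exact ⟨x, m, hm, rfl⟩
    · exact (hne.ne_empty h'.inter_eq).elim

theorem isTopologicalBasis_cyl (n : ℕ) :
    TopologicalSpace.IsTopologicalBasis {U : Set B.PathSpace | ∃ x, ∃ m ≥ n, U = cyl x m} := by
  refine TopologicalSpace.isTopologicalBasis_of_isOpen_of_nhds ?_ ?_
  · rintro _ ⟨x, m, -, rfl⟩; exact isOpen_cyl x m
  · intro x U hx hU
    suffices h : ∀ V, TopologicalSpace.GenerateOpen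
        {U | ∃ (e : ∀ n, B.E n) (n : ℕ), U = {x : B.PathSpace | ∀ i < n, x.1 i = e i}} V →
        ∀ x ∈ V, ∃ m ≥ n, cyl x m ⊆ V by
      obtain ⟨m, hm, h⟩ := h U hU x hx
      exact ⟨_, ⟨x, m, hm, rfl⟩, mem_cyl_self x m, h⟩
    intro V hV
    induction hV with
    | basic V hV =>
      obtain ⟨e, k, rfl⟩ := hV
      intro x hx
      exact ⟨max n k, le_max_left _ _, fun z hz i hi =>
        (hz i (hi.le.trans (le_max_right _ _))).trans (hx i hi)⟩
    | univ => exact fun x _ => ⟨n, le_rfl, subset_univ _⟩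
    | inter V W _ _ hV hW =>
      intro x hx
      obtain ⟨m, hm, h⟩ := hV x hx.1
      obtain ⟨k, hk, h'⟩ := hW x hx.2
      exact ⟨max m k, hm.trans (le_max_left _ _), subset_inter
        ((cyl_anti x (le_max_left _ _)).trans h) ((cyl_anti x (le_max_right _ _)).trans h')⟩
    | sUnion 𝒱 _ ih =>
      rintro x ⟨V, hV, hx⟩
      obtain ⟨m, hm, h⟩ := ih V hV x hx
      exact ⟨m, hm, h.trans (subset_sUnion_of_mem hV)⟩

theorem countable_cyl : {U : Set B.PathSpace | ∃ x n, U = cyl x n}.Countable := by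
  obtain ⟨s, hs⟩ := exists_seq_dense B
  refine (countable_range fun p : ℕ × ℕ => cyl (s p.1) p.2).mono ?_
  rintro _ ⟨x, n, rfl⟩
  obtain ⟨k, hk⟩ := hs x n
  exact ⟨(k, n), cyl_eq_of_mem hk⟩

theorem borel_eq_generateFrom_cyl (n : ℕ) :
    borel B.PathSpace =
      MeasurableSpace.generateFrom {U : Set B.PathSpace | ∃ x, ∃ m ≥ n, U = cyl x m} :=
  (isTopologicalBasis_cyl n).borel_eq_generateFrom

/-- Cylinders beyond a given length still form a π-system and a base. The freedom in `n` matters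
because a prefix change at `n` is controlled only on cylinders at least that long. -/
theorem ext_of_cyl {μ ν : Measure B.PathSpace} [IsFiniteMeasure μ] (n : ℕ)
    (h : ∀ x, ∀ m ≥ n, μ (cyl x m) = ν (cyl x m)) : μ = ν := by
  refine Measure.ext_of_generateFrom_of_cover_subset (borel_eq_generateFrom_cyl n)
    (isPiSystem_cyl n) subset_rfl (countable_cyl.mono ?_) ?_ (fun s _ => measure_ne_top μ s) ?_
  · rintro _ ⟨x, m, -, rfl⟩
    exact ⟨x, m, rfl⟩
  · exact eq_univ_of_forall fun x => ⟨_, ⟨x, n, le_rfl, rfl⟩, mem_cyl_self x n⟩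
  · rintro _ ⟨x, m, hm, rfl⟩
    exact h x m hm

/-- Tail equivalent paths differ by the exchange of two prefixes with the same end vertex, and
prefixes taken from a dense sequence exhaust all of them. -/
theorem exists_generatedBy_tail (B : BratteliDiagram.{u, v}) :
    ∃ (D : ℕ → Set B.PathSpace) (G : ℕ → B.PathSpace → B.PathSpace), GeneratedBy B.tail D G ∧
      ∀ k, ∃ (a b : B.PathSpace) (n : ℕ), B.rng n (a.1 n) = B.rng n (b.1 n) ∧
        D k ⊆ cyl a n ∧ G k = splice b n := by
  classical
  obtain ⟨s, hs⟩ := exists_seq_dense B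
  have : Nonempty {p : ℕ × ℕ × ℕ //
      B.rng p.1 ((s p.2.1).1 p.1) = B.rng p.1 ((s p.2.2).1 p.1)} := ⟨⟨(0, 0, 0), rfl⟩⟩
  obtain ⟨e, he⟩ := exists_surjective_nat
    {p : ℕ × ℕ × ℕ // B.rng p.1 ((s p.2.1).1 p.1) = B.rng p.1 ((s p.2.2).1 p.1)}
  refine ⟨fun k => cyl (s (e k).1.2.1) (e k).1.1, fun k => splice (s (e k).1.2.2) (e k).1.1,
    ⟨fun k => measurableSet_cyl _ _, fun k => measurable_splice _ _, fun k => ?_, fun k x _ => ?_,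
      ?_⟩, fun k => ⟨s (e k).1.2.1, s (e k).1.2.2, (e k).1.1, (e k).2, subset_rfl, rfl⟩⟩
  · exact injOn_splice (e k).2
  · exact tail_splice _ _ _
  · rintro x y ⟨n, hn⟩
    obtain ⟨a, ha⟩ := hs x n
    obtain ⟨b, hb⟩ := hs y n
    have hab : B.rng n ((s a).1 n) = B.rng n ((s b).1 n) := by
      rw [ha n le_rfl, hb n le_rfl, hn n le_rfl]
    obtain ⟨k, hk⟩ := he ⟨(n, a, b), hab⟩
    have hx : x ∈ cyl (s a) n := by rw [cyl_eq_of_mem ha]; exact mem_cyl_self x n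
    refine ⟨k, by simpa only [hk] using hx, ?_⟩
    simp only [hk]
    refine ext_path fun i => ?_
    rcases le_or_gt i n with hi | hi
    · rw [splice_apply_le _ hi, hb i hi]
      rw [← hab, hx n le_rfl]
    · rw [splice_apply_gt hi, hn i hi.le]

/-- A finite measure carried by `Y` which assigns equal mass to cylinders of equal length and
equal end vertex that meet `Y` is invariant, if `Y` is stable under changes of prefixes within
`Y`. -/
theorem partialInvariant_of_cyl {Y : Set B.PathSpace}
    (hsplice : ∀ x ∈ Y, ∀ y ∈ Y, ∀ n, B.rng n (x.1 n) = B.rng n (y.1 n) → splice x n y ∈ Y)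
    {μ : Measure B.PathSpace} [IsFiniteMeasure μ] (h0 : μ Yᶜ = 0)
    (h : ∀ x ∈ Y, ∀ y ∈ Y, ∀ n, B.rng n (x.1 n) = B.rng n (y.1 n) → μ (cyl x n) = μ (cyl y n)) :
    PartialInvariant B.tail Y μ := by
  obtain ⟨D, G, hG, hDG⟩ := exists_generatedBy_tail B
  refine hG.partialInvariant fun k S hS hSD hSY hGY => ?_
  obtain ⟨a, b, n, hab, hD, hGk⟩ := hDG k
  rw [hGk] at hGY ⊢
  have hSa := hSD.trans hD
  rcases S.eq_empty_or_nonempty with rfl | ⟨x, hx⟩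
  · simp
  have hxY := hSY hx
  set y := splice b n x with hy
  have hyY : y ∈ Y := hGY ⟨x, hx, rfl⟩
  have hbx : B.rng n (b.1 n) = B.rng n (x.1 n) := by rw [hSa hx n le_rfl, hab]
  have hyb : y ∈ cyl b n := splice_mem_cyl hbx
  have hxy : B.rng n (x.1 n) = B.rng n (y.1 n) := by rw [hyb n le_rfl, hbx]
  have hcx : cyl x n = cyl a n := cyl_eq_of_mem (hSa hx)
  have hcy : cyl y n = cyl b n := cyl_eq_of_mem hyb
  have hres : ∀ {T : Set B.PathSpace}, (∀ z ∈ Y, z ∉ T) → μ T = 0 := fun {T} hT =>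
    measure_mono_null (fun z hz hzY => hT z hzY hz) h0
  -- Since `h` only concerns cylinders around points of `Y`, test cylinders meeting `Y` are
  -- rewritten around such a point, and the others are shown to be null on both sides.
  have key : (μ.restrict (cyl a n)).map (splice b n) = μ.restrict (cyl b n) := by
    refine ext_of_cyl n ?_
    · intro z m hm
      rw [Measure.map_apply (measurable_splice b n) (measurableSet_cyl z m),
        Measure.restrict_apply (measurable_splice b n (measurableSet_cyl z m)),
        Measure.restrict_apply (measurableSet_cyl z m)]
      rcases cyl_subset_or_disjoint b z hm with hz | hz
      · have hzb : z ∈ cyl b n := hz (mem_cyl_self z m)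
        rw [inter_eq_left.2 hz]
        rw [preimage_splice_cyl hm hzb hab]
        by_cases hne : ∃ t ∈ Y, t ∈ cyl z m
        · obtain ⟨t, htY, ht⟩ := hne
          have htb : t ∈ cyl b n := hz ht
          have htx : B.rng n (x.1 n) = B.rng n (t.1 n) := by rw [htb n le_rfl, hbx]
          have htaY := hsplice x hxY t htY n htx
          have e1 : cyl (splice a n z) m = cyl (splice x n t) m := by
            rw [← preimage_splice_cyl hm hzb hab, ← cyl_eq_of_mem ht, ← hcx,
              preimage_splice_cyl hm htb hbx.symm]
          rw [e1, ← cyl_eq_of_mem ht]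
          refine h _ htaY _ htY m ?_
          rcases hm.eq_or_lt with rfl | hm
          · rw [splice_apply_le htx le_rfl, htx]
          · rw [splice_apply_gt hm]
        -- If the source cylinder met `Y`, splicing in the prefix of `y` would produce a point of
        -- `Y` in the target cylinder.
        · push Not at hne
          rw [hres hne, hres]
          intro t htY ht
          rw [← preimage_splice_cyl hm hzb hab, ← hcx] at ht
          refine hne (splice y n t) (hsplice y hyY t htY n ?_) ?_
          · rw [ht.2 n le_rfl, hxy]
          · have h1 : splice y n t = splice b n t := by
              refine ext_path fun i => ?_
              have h2 : B.rng n (b.1 n) = B.rng n (t.1 n) := by rw [ht.2 n le_rfl, hbx]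
              rcases le_or_gt i n with hi | hi
              · rw [splice_apply_le _ hi, splice_apply_le h2 hi, hyb i hi]
                rw [hyb n le_rfl, h2]
              · rw [splice_apply_gt hi, splice_apply_gt hi]
            rw [h1]; exact ht.1
      · rw [hz.inter_eq, measure_empty]
        convert measure_empty (μ := μ)
        refine eq_empty_of_forall_notMem fun t ht => disjoint_left.1 hz ht.1 ?_
        exact splice_mem_cyl (by rw [ht.2 n le_rfl, hab])
  have himg : MeasurableSet (splice b n '' S) :=
    hS.image_of_measurable_injOn (measurable_splice b n) ((injOn_splice hab).mono hSa)
  have hsub : splice b n '' S ⊆ cyl b n := by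
    rintro _ ⟨t, ht, rfl⟩
    exact splice_mem_cyl (by rw [hSa ht n le_rfl, hab])
  have := congrArg (fun m => m (splice b n '' S)) key
  simp only [Measure.map_apply (measurable_splice b n) himg, Measure.restrict_apply himg,
    Measure.restrict_apply (measurable_splice b n himg), inter_eq_left.2 hsub] at this
  rw [← this]
  congr 1
  ext t
  constructor
  · rintro ⟨⟨s, hs, hst⟩, ht⟩
    rwa [← injOn_splice hab (hSa hs) ht hst]
  · exact fun ht => ⟨⟨t, ht, rfl⟩, hSa ht⟩

end BratteliDiagram

/-! ### Existence of invariant probability measures by weak limits -/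

namespace BratteliDiagram

variable {B : BratteliDiagram.{u, v}}

attribute [local instance] BratteliDiagram.finite_E in
theorem finite_eq_above (t : B.PathSpace) (N : ℕ) :
    {z : B.PathSpace | ∀ i > N, z.1 i = t.1 i}.Finite := by
  refine Set.Finite.of_injOn (f := fun z (i : Fin (N + 1)) => (z.1 i : B.E i)) (t := univ)
    (fun _ _ => mem_univ _) ?_ finite_univ
  intro x hx y hy hxy
  refine ext_path fun i => ?_
  rcases le_or_gt i N with hi | hi
  · exact congrFun hxy ⟨i, Nat.lt_succ_of_le hi⟩
  · exact (hx i hi).trans (hy i hi).symm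

open Filter Topology ProbabilityTheory in
/-- A closed set of paths, stable under changes of prefixes, carries an invariant probability
measure. -/
theorem exists_partialInvariant {Y : Set B.PathSpace} (hY : IsClosed Y) (hne : Y.Nonempty)
    (hsplice : ∀ x ∈ Y, ∀ y ∈ Y, ∀ n, B.rng n (x.1 n) = B.rng n (y.1 n) → splice x n y ∈ Y) :
    ∃ μ : Measure B.PathSpace, IsProbabilityMeasure μ ∧ μ Yᶜ = 0 ∧
      PartialInvariant B.tail Y μ := by
  obtain ⟨t, ht⟩ := hne
  -- A finite part of the tail class of `t`. Its uniform measure gives equal mass to cylinders with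
  -- a common end vertex at any index `n ≤ N`, as prefix changes permute the points; a weak limit
  -- inherits this for all `n`.
  let Z : ℕ → Set B.PathSpace := fun N => Y ∩ {z | ∀ i > N, z.1 i = t.1 i}
  have hZf : ∀ N, (Z N).Finite := fun N => (finite_eq_above t N).inter_of_right Y
  have hZne : ∀ N, (Z N).Nonempty := fun N => ⟨t, ht, fun _ _ => rfl⟩
  have hprob : ∀ N, IsProbabilityMeasure (uniformOn (Z N)) := fun N =>
    isProbabilityMeasure_uniformOn (hZf N) (hZne N)
  let m : ℕ → ProbabilityMeasure B.PathSpace := fun N => ⟨uniformOn (Z N), hprob N⟩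
  let _ := TopologicalSpace.upgradeIsCompletelyMetrizable B.PathSpace
  let U : Ultrafilter (ProbabilityMeasure B.PathSpace) := (hyperfilter ℕ).map m
  obtain ⟨μ, -, hμ⟩ := isCompact_univ.ultrafilter_le_nhds U (by simp)
  have hlim : Tendsto m (hyperfilter ℕ) (𝓝 μ) := hμ
  have hnull : (μ : Measure B.PathSpace) Yᶜ = 0 := by
    have := ProbabilityMeasure.le_liminf_measure_open_of_tendsto hlim hY.isOpen_compl
    refine le_antisymm (this.trans ?_) zero_le
    have h0 : ∀ N, (m N : Measure B.PathSpace) Yᶜ = 0 := fun N => by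
      change uniformOn (Z N) Yᶜ = 0
      rw [uniformOn_eq_zero_iff (hZf N)]
      exact eq_empty_of_forall_notMem fun x hx => hx.2 hx.1.1
    simp [h0]
  refine ⟨μ, inferInstance, hnull, partialInvariant_of_cyl hsplice hnull ?_⟩
  · intro x hx y hy n hxy
    have hcl : ∀ z : B.PathSpace, Tendsto (fun N => (m N : Measure B.PathSpace) (cyl z n))
        (hyperfilter ℕ) (𝓝 ((μ : Measure B.PathSpace) (cyl z n))) := fun z =>
      -- Cylinders are clopen, so their masses converge along the ultrafilter.
      ProbabilityMeasure.tendsto_measure_of_null_frontier_of_tendsto' hlim (by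
        rw [IsClopen.frontier_eq ⟨isClosed_cyl z n, isOpen_cyl z n⟩, measure_empty])
    refine tendsto_nhds_unique_of_eventuallyEq (hcl x) (hcl y) ?_
    have hev : ∀ᶠ N in hyperfilter ℕ, n ≤ N :=
      (Nat.hyperfilter_le_atTop) (eventually_ge_atTop n)
    filter_upwards [hev] with N hN
    change uniformOn (Z N) (cyl x n) = uniformOn (Z N) (cyl y n)
    have himg : splice y n '' (Z N ∩ cyl x n) = Z N ∩ cyl y n := by
      have hmaps : ∀ a ∈ Y, ∀ b ∈ Y, B.rng n (a.1 n) = B.rng n (b.1 n) → ∀ z ∈ Z N ∩ cyl a n,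
          splice b n z ∈ Z N ∩ cyl b n := by
        intro a ha b hb hab z hz
        have hbz : B.rng n (b.1 n) = B.rng n (z.1 n) := by rw [hz.2 n le_rfl, hab]
        refine ⟨⟨hsplice b hb z hz.1.1 n hbz, fun i hi => ?_⟩, splice_mem_cyl hbz⟩
        rw [splice_apply_gt (hN.trans_lt hi)]
        exact hz.1.2 i hi
      refine Subset.antisymm ?_ ?_
      · rintro _ ⟨z, hz, rfl⟩
        exact hmaps x hx y hy hxy z hz
      · intro z hz
        exact ⟨splice x n z, hmaps y hy x hx hxy.symm z hz, splice_splice hxy.symm hz.2⟩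
    have henc : (Z N ∩ cyl x n).encard = (Z N ∩ cyl y n).encard := by
      rw [← himg, ((injOn_splice hxy).mono inter_subset_right).encard_image]
    rw [uniformOn, cond_apply (hZf N).measurableSet, cond_apply (hZf N).measurableSet,
      Measure.count_apply ((hZf N).measurableSet.inter (measurableSet_cyl x n)),
      Measure.count_apply ((hZf N).measurableSet.inter (measurableSet_cyl y n)), henc]

end BratteliDiagram

/-! ## Non-negative matrices -/

namespace NonnegMatrix

/-! ### Backward orbits of primitive matrices -/

section Primitive

variable {κ : Type*} [Fintype κ] [DecidableEq κ] {M : Matrix κ κ ℝ}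

theorem mulVec_pow_iterate {p : ℕ → κ → ℝ} (hp : ∀ n, p n = M.mulVec (p (n + 1))) (n k : ℕ) :
    p n = (M ^ k).mulVec (p (n + k)) := by
  induction k with
  | zero => simp
  | succ k ih => rw [ih, hp (n + k), Matrix.mulVec_mulVec, ← pow_succ, Nat.add_assoc]

theorem pow_nonneg_apply (hM : ∀ i j, 0 ≤ M i j) (k : ℕ) (i j : κ) : 0 ≤ (M ^ k) i j := by
  induction k generalizing i j with
  | zero => rw [pow_zero, Matrix.one_apply]; split_ifs <;> norm_num
  | succ k ih =>
    rw [pow_succ, Matrix.mul_apply]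
    exact Finset.sum_nonneg fun l _ => mul_nonneg (ih i l) (hM l j)

omit [DecidableEq κ] in
theorem mulVec_mono (hM : ∀ i j, 0 ≤ M i j) {x y : κ → ℝ} (h : ∀ i, x i ≤ y i) (i : κ) :
    M.mulVec x i ≤ M.mulVec y i :=
  Finset.sum_le_sum fun j _ => mul_le_mul_of_nonneg_left (h j) (hM i j)

/-- Harnack inequality for the backward orbits of a primitive matrix. -/
theorem exists_harnack (hprim : ∃ k, ∀ i j, 0 < (M ^ k) i j) :
    ∃ K > 0, ∀ p : ℕ → κ → ℝ, (∀ n i, 0 ≤ p n i) → (∀ n, p n = M.mulVec (p (n + 1))) →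
      ∀ n i j, p n i ≤ K * p n j := by
  rcases isEmpty_or_nonempty κ with hκ | hκ
  · exact ⟨1, one_pos, fun _ _ _ _ i => (hκ.false i).elim⟩
  obtain ⟨k, hk⟩ := hprim
  obtain ⟨m, hm⟩ := Finite.exists_min fun ij : κ × κ => (M ^ k) ij.1 ij.2
  obtain ⟨N, hN⟩ := Finite.exists_max fun ij : κ × κ => (M ^ k) ij.1 ij.2
  set a := (M ^ k) m.1 m.2
  set b := (M ^ k) N.1 N.2
  have ha : 0 < a := hk _ _
  have hb : 0 < b := hk _ _
  -- Every coordinate of `p n` lies between `a` and `b` times the coordinate sum of `p (n + k)`,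
  -- where `a` and `b` are the extreme entries of `M ^ k`.
  refine ⟨b / a, div_pos hb ha, fun p hp0 hp n i j => ?_⟩
  have h1 : p n i ≤ b * ∑ l, p (n + k) l := by
    rw [mulVec_pow_iterate hp n k, Finset.mul_sum]
    exact Finset.sum_le_sum fun l _ => mul_le_mul_of_nonneg_right (hN (i, l)) (hp0 _ l)
  have h2 : a * ∑ l, p (n + k) l ≤ p n j := by
    conv_rhs => rw [mulVec_pow_iterate hp n k]
    rw [Finset.mul_sum]
    exact Finset.sum_le_sum fun l _ => mul_le_mul_of_nonneg_right (hm (j, l)) (hp0 _ l)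
  calc p n i ≤ b / a * (a * ∑ l, p (n + k) l) := by
        rw [← mul_assoc, div_mul_cancel₀ _ ha.ne']; exact h1
    _ ≤ _ := mul_le_mul_of_nonneg_left h2 (div_pos hb ha).le

/-- The backward orbits of a primitive matrix in the positive cone form a single ray. -/
theorem exists_eq_mul_of_backward (hM : ∀ i j, 0 ≤ M i j) (hprim : ∃ k, ∀ i j, 0 < (M ^ k) i j)
    {p q : ℕ → κ → ℝ} (hp0 : ∀ n i, 0 ≤ p n i) (hq0 : ∀ n i, 0 < q n i)
    (hp : ∀ n, p n = M.mulVec (p (n + 1))) (hq : ∀ n, q n = M.mulVec (q (n + 1))) :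
    ∃ t, 0 ≤ t ∧ ∀ n i, p n i = t * q n i := by
  rcases isEmpty_or_nonempty κ with hκ | ⟨⟨o⟩⟩
  · exact ⟨0, le_rfl, fun n i => (hκ.false i).elim⟩
  obtain ⟨K, hK, hhar⟩ := exists_harnack hprim
  -- The largest multiple `t` of `q` below `p` is attained, and the remainder `p - t q` is again a
  -- non-negative backward orbit. If it were nonzero, a further multiple of `q` could be subtracted.
  let T : Set ℝ := {t | ∀ n i, t * q n i ≤ p n i}
  have h0T : (0 : ℝ) ∈ T := fun n i => by simpa using hp0 n i
  have hbdd : BddAbove T := ⟨p 0 o / q 0 o, fun t ht => by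
    rw [le_div_iff₀ (hq0 0 o)]; exact ht 0 o⟩
  set t := sSup T with ht
  have htT : t ∈ T := by
    intro n i
    rw [← le_div_iff₀ (hq0 n i)]
    refine csSup_le ⟨0, h0T⟩ fun s hs => ?_
    rw [le_div_iff₀ (hq0 n i)]
    exact hs n i
  refine ⟨t, le_csSup hbdd h0T, ?_⟩
  by_contra! hne
  obtain ⟨n₀, i₀, hne⟩ := hne
  let r : ℕ → κ → ℝ := fun n i => p n i - t * q n i
  have hr0 : ∀ n i, 0 ≤ r n i := fun n i => sub_nonneg.2 (htT n i)
  have hr : ∀ n, r n = M.mulVec (r (n + 1)) := fun n => by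
    have : ∀ m, r m = p m - t • q m := fun m => rfl
    rw [this, this, Matrix.mulVec_sub, Matrix.mulVec_smul, ← hp, ← hq]
  have hpos : 0 < r n₀ i₀ := (hr0 _ _).lt_of_ne fun h => hne (sub_eq_zero.1 h.symm)
  -- At a later level, Harnack for `r` and for `q` bounds `r` by `K * K` times its ratio to `q` at
  -- any single coordinate. Pulled back to `n₀`, this bounds `r n₀ i₀`, so all later ratios are at
  -- least `s`.
  set s := r n₀ i₀ / q n₀ i₀ / (K * K) with hs
  have hspos : 0 < s := div_pos (div_pos hpos (hq0 _ _)) (mul_pos hK hK)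
  have hlarge : ∀ k j, s * q (n₀ + k) j ≤ r (n₀ + k) j := by
    intro k j
    have hq' := hq0 (n₀ + k) j
    set c := K * K * (r (n₀ + k) j / q (n₀ + k) j) with hc
    have h1 : ∀ i, r (n₀ + k) i ≤ c * q (n₀ + k) i := fun i => by
      calc r (n₀ + k) i ≤ K * r (n₀ + k) j := hhar r hr0 hr _ _ _
        _ = K * (r (n₀ + k) j / q (n₀ + k) j) * q (n₀ + k) j := by field_simp
        _ ≤ K * (r (n₀ + k) j / q (n₀ + k) j) * (K * q (n₀ + k) i) :=
          mul_le_mul_of_nonneg_left (hhar q (fun n i => (hq0 n i).le) hq _ _ _)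
            (mul_nonneg hK.le (div_nonneg (hr0 _ _) hq'.le))
        _ = c * q (n₀ + k) i := by rw [hc]; ring
    have h2 : r n₀ i₀ ≤ c * q n₀ i₀ := by
      rw [mulVec_pow_iterate hr n₀ k, mulVec_pow_iterate hq n₀ k, ← smul_eq_mul, ← Pi.smul_apply,
        ← Matrix.mulVec_smul]
      exact mulVec_mono (pow_nonneg_apply hM k) h1 i₀
    rw [← le_div_iff₀ hq', hs, div_le_iff₀ (mul_pos hK hK), div_le_iff₀ (hq0 _ _)]
    calc _ ≤ c * q n₀ i₀ := h2
      _ = _ := by rw [hc]; ring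
  have hall : t + s ∈ T := by
    intro n i
    have h3 : s * q n i ≤ r n i := by
      rcases le_total n₀ n with h | h
      · obtain ⟨k, rfl⟩ := Nat.exists_eq_add_of_le h
        exact hlarge k i
      · obtain ⟨k, rfl⟩ := Nat.exists_eq_add_of_le h
        rw [mulVec_pow_iterate hr n k, mulVec_pow_iterate hq n k, ← smul_eq_mul, ← Pi.smul_apply,
          ← Matrix.mulVec_smul]
        exact mulVec_mono (pow_nonneg_apply hM k) (fun j => hlarge 0 j) i
    have : r n i = p n i - t * q n i := rfl
    linarith
  have := le_csSup hbdd hall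
  linarith

/-- If the ray of backward orbits contains a positive sequence, it is geometric. -/
theorem exists_eigenvector_of_backward (hM : ∀ i j, 0 ≤ M i j)
    (hprim : ∃ k, ∀ i j, 0 < (M ^ k) i j) [Nonempty κ]
    {p : ℕ → κ → ℝ} (hp0 : ∀ n i, 0 < p n i) (hp : ∀ n, p n = M.mulVec (p (n + 1))) :
    ∃ l > 0, (∀ i, M.mulVec (p 0) i = l * p 0 i) ∧ ∀ n i, p n i = p 0 i / l ^ n := by
  -- The shift of a backward orbit is a backward orbit, hence lies on the same ray; its factor is
  -- the inverse eigenvalue.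
  obtain ⟨t, ht0, ht⟩ := exists_eq_mul_of_backward hM hprim (p := fun n => p (n + 1))
    (fun n i => (hp0 (n + 1) i).le) hp0 (fun n => hp (n + 1)) hp
  have htpos : 0 < t := by
    obtain ⟨o⟩ := ‹Nonempty κ›
    have := hp0 1 o
    rw [ht 0 o] at this
    exact (pos_iff_pos_of_mul_pos this).2 (hp0 0 o)
  refine ⟨t⁻¹, inv_pos.2 htpos, fun i => ?_, fun n i => ?_⟩
  · have h1 : p 1 = t • p 0 := funext fun j => ht 0 j
    have h2 := hp 0
    rw [zero_add, h1, Matrix.mulVec_smul] at h2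
    have := congrFun h2 i
    rw [Pi.smul_apply, smul_eq_mul] at this
    rw [this, inv_mul_cancel_left₀ htpos.ne']
  · induction n with
    | zero => simp
    | succ n ih => rw [ht n i, ih, inv_pow, inv_pow, div_inv_eq_mul, div_inv_eq_mul]; ring

end Primitive

/-! ### Spectral radius and positive eigenvectors -/

section SpectralRadius

variable {κ : Type*} [Fintype κ] [DecidableEq κ]

/-- At a coordinate maximizing `‖v i‖ / η i`, the eigenvalue equation of a complex eigenvector `v`
forces the modulus of its eigenvalue below `ρ`; and `η` itself realizes `ρ`. -/
theorem spectralRadius_eq_of_pos_eigenvector [Nonempty κ] (M : Matrix κ κ ℕ) {η : κ → ℝ}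
    (hη : ∀ i, 0 < η i) {ρ : ℝ} (hρ : 0 ≤ ρ) (h : ∀ i, ∑ j, (M i j : ℝ) * η j = ρ * η i) :
    spectralRadius ℂ (M.map (fun k : ℕ => (k : ℂ))) = ENNReal.ofReal ρ := by
  have hspec : ∀ z : ℂ, z ∈ spectrum ℂ (M.map (fun k : ℕ => (k : ℂ))) ↔
      ∃ v : κ → ℂ, v ≠ 0 ∧ ∀ i, ∑ j, (M i j : ℂ) * v j = z * v i := by
    intro z
    rw [← Matrix.spectrum_toLin', ← Module.End.hasEigenvalue_iff_mem_spectrum]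
    constructor
    · intro hz
      obtain ⟨v, hv⟩ := hz.exists_hasEigenvector
      refine ⟨v, hv.2, fun i => ?_⟩
      have := congrFun hv.apply_eq_smul i
      simpa [Matrix.toLin'_apply, Matrix.mulVec, dotProduct] using this
    · rintro ⟨v, hv0, hv⟩
      refine Module.End.hasEigenvalue_of_hasEigenvector (x := v)
        ⟨Module.End.mem_eigenspace_iff.2 (funext fun i => ?_), hv0⟩
      simpa [Matrix.toLin'_apply, Matrix.mulVec, dotProduct] using hv i
  unfold spectralRadius
  refine le_antisymm (iSup₂_le fun z hz => ?_) ?_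
  · obtain ⟨v, hv0, hv⟩ := (hspec z).1 hz
    obtain ⟨i, hi⟩ := Finite.exists_max fun i => ‖v i‖ / η i
    have hvi : 0 < ‖v i‖ / η i := by
      obtain ⟨j, hj⟩ := Function.ne_iff.1 hv0
      exact (div_pos (norm_pos_iff.2 hj) (hη j)).trans_le (hi j)
    have h1 : ‖z‖ * ‖v i‖ ≤ ρ * ‖v i‖ := by
      calc ‖z‖ * ‖v i‖ = ‖∑ j, (M i j : ℂ) * v j‖ := by rw [hv, norm_mul]
        _ ≤ ∑ j, ‖(M i j : ℂ) * v j‖ := norm_sum_le _ _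
        _ ≤ ∑ j, (M i j : ℝ) * (‖v i‖ / η i * η j) := by
          refine Finset.sum_le_sum fun j _ => ?_
          rw [norm_mul, Complex.norm_natCast]
          exact mul_le_mul_of_nonneg_left ((div_le_iff₀ (hη j)).1 (hi j)) (Nat.cast_nonneg _)
        _ = ‖v i‖ / η i * ∑ j, (M i j : ℝ) * η j := by
          rw [Finset.mul_sum]; exact Finset.sum_congr rfl fun j _ => by ring
        _ = ρ * ‖v i‖ := by rw [h]; field_simp [(hη i).ne']
    have hvi' : 0 < ‖v i‖ := by
      have := mul_pos hvi (hη i)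
      rwa [div_mul_cancel₀ _ (hη i).ne'] at this
    have h2 : ‖z‖ ≤ ρ := le_of_mul_le_mul_right h1 hvi'
    change ‖z‖ₑ ≤ _
    rw [← ofReal_norm z]
    exact ENNReal.ofReal_le_ofReal h2
  · have hmem : (ρ : ℂ) ∈ spectrum ℂ (M.map (fun k : ℕ => (k : ℂ))) := by
      refine (hspec _).2 ⟨fun i => η i, fun h0 => ?_, fun i => ?_⟩
      · obtain ⟨o⟩ := ‹Nonempty κ›
        exact (hη o).ne' (by simpa using congrFun h0 o)
      · have := congrArg (fun x : ℝ => (x : ℂ)) (h i)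
        push_cast at this
        exact this
    refine le_trans ?_ (le_iSup₂ (f := fun k (_ : k ∈ spectrum ℂ _) => (‖k‖₊ : ℝ≥0∞)) _ hmem)
    change _ ≤ ‖(ρ : ℂ)‖ₑ
    rw [← ofReal_norm (ρ : ℂ), Complex.norm_real, Real.norm_of_nonneg hρ]

/-- A primitive matrix with Perron eigenvalue at most one is the matrix `[1]`. -/
theorem subsingleton_of_eigenvalue_le_one (M : Matrix κ κ ℕ) (hprim : ∃ k, ∀ i j, 0 < (M ^ k) i j)
    {η : κ → ℝ} (hη : ∀ i, 0 < η i) {l : ℝ} (hl : 0 < l) (hl1 : l ≤ 1)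
    (h : ∀ i, ∑ j, (M i j : ℝ) * η j = l * η i) : Subsingleton κ ∧ ∀ i, M i i = 1 := by
  obtain ⟨k, hk⟩ := hprim
  have hpow : ∀ n i, ∑ j, ((M ^ n) i j : ℝ) * η j = l ^ n * η i := by
    intro n
    induction n with
    | zero => intro i; simp [Matrix.one_apply]
    | succ n ih =>
      intro i
      simp only [pow_succ M n, Matrix.mul_apply, Nat.cast_sum, Nat.cast_mul, Finset.sum_mul]
      rw [Finset.sum_comm]
      have : ∀ y, ∑ x, ((M ^ n) i y : ℝ) * (M y x) * η x = ((M ^ n) i y : ℝ) * η y * l := fun y => by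
        simp only [mul_assoc, ← Finset.mul_sum, h]
        ring
      simp only [this, ← Finset.sum_mul, ih]
      ring
  have hsub : Subsingleton κ := by
    refine ⟨fun i j => ?_⟩
    by_contra hij
    -- Positive integer entries are at least one, so an eigenvalue at most one leaves no room for a
    -- second coordinate.
    have h1 : ∑ j, η j ≤ η i := by
      calc ∑ j, η j ≤ ∑ j, ((M ^ k) i j : ℝ) * η j := by
            refine Finset.sum_le_sum fun j _ => le_mul_of_one_le_left (hη j).le ?_
            exact_mod_cast hk i j
        _ = l ^ k * η i := hpow k i
        _ ≤ η i := mul_le_of_le_one_left (hη i).le (pow_le_one₀ hl.le hl1)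
    have h2 : η i + η j ≤ ∑ j, η j := by
      rw [← Finset.sum_pair hij]
      exact Finset.sum_le_sum_of_subset_of_nonneg (Finset.subset_univ _) fun x _ _ => (hη x).le
    linarith [hη j]
  refine ⟨hsub, fun i => ?_⟩
  have h1 := h i
  rw [Fintype.sum_subsingleton _ i] at h1
  have h2 : (M i i : ℝ) = l := mul_right_cancel₀ (hη i).ne' h1
  have h3 : (M i i : ℝ) ≤ 1 := h2 ▸ hl1
  have h4 : (0 : ℝ) < M i i := h2 ▸ hl
  have h3' : M i i ≤ 1 := by exact_mod_cast h3
  have h4' : 0 < M i i := by exact_mod_cast h4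
  omega

end SpectralRadius

end NonnegMatrix

namespace NonnegMatrix

/-! ### Growth of `A ^ N ξ` and distinguished classes -/

section Growth

variable {ι : Type w} [Fintype ι] {A : Matrix ι ι ℕ}

/-- The class of a vertex. -/
abbrev cls (A : Matrix ι ι ℕ) (i : ι) : ReducedVertex A := Quotient.mk (commSetoid A) i

omit [Fintype ι] in
theorem cls_eq_iff {i j : ι} : cls A i = cls A j ↔ Access A i j ∧ Access A j i :=
  Quotient.eq

omit [Fintype ι] in
theorem Access.single {i j : ι} (h : 0 < A i j) : Access A i j := Relation.ReflTransGen.single h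

open Classical in
/-- The real vector `A ^ N ξ`, where `ξ` is `η` on the class `α` and zero elsewhere. -/
noncomputable def classOrbit (A : Matrix ι ι ℕ) (α : ReducedVertex A) (η : ι → ℝ) : ℕ → ι → ℝ
  | 0 => fun i => if cls A i = α then η i else 0
  | N + 1 => fun i => ∑ j, (A i j : ℝ) * classOrbit A α η N j

open Classical in
/-- A positive vector whose restriction to each class is an eigenvector of the diagonal block,
with the given eigenvalues. -/
structure IsBlockEigenvector (A : Matrix ι ι ℕ) (η : ι → ℝ) (ρ : ReducedVertex A → ℝ) : Prop where
  pos : ∀ i, 0 < η i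
  nonneg : ∀ β, 0 ≤ ρ β
  eigen : ∀ i, ∑ j, (A i j : ℝ) * (if cls A j = cls A i then η j else 0) = ρ (cls A i) * η i

variable {α : ReducedVertex A} {η : ι → ℝ} {ρ : ReducedVertex A → ℝ}

theorem classOrbit_nonneg (h : IsBlockEigenvector A η ρ) (N : ℕ) (i : ι) :
    0 ≤ classOrbit A α η N i := by
  induction N generalizing i with
  | zero => unfold classOrbit; split_ifs; exacts [(h.pos i).le, le_rfl]
  | succ N ih => exact Finset.sum_nonneg fun j _ => mul_nonneg (Nat.cast_nonneg _) (ih j)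

/-- The number of accessible vertices serves as a height on the classes: after leaving a class, that
class is no longer accessible. -/
theorem ncard_access_lt {j k : ι} (hjk : 0 < A j k) (hne : cls A k ≠ cls A j) :
    {l | Access A k l}.ncard < {l | Access A j l}.ncard := by
  refine Set.ncard_lt_ncard ⟨fun l hl => (Access.single hjk).trans hl, fun h => hne ?_⟩
    (Set.toFinite _)
  exact cls_eq_iff.2 ⟨h (Relation.ReflTransGen.refl : Access A j j), Access.single hjk⟩

/-- If all the classes with access to `α` have smaller eigenvalue, the orbit grows at most like
the powers of the eigenvalue of `α`. -/
theorem exists_classOrbit_le (h : IsBlockEigenvector A η ρ)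
    (hdist : ∀ β ≠ α, ClassAccess A β α → ρ β < ρ α) :
    ∃ K, ∀ N i, classOrbit A α η N i ≤ K * ρ α ^ N := by
  classical
  set S : ℝ := ∑ j, ∑ k, (A j k : ℝ) * η k with hS
  have hSj : ∀ j, ∑ k, (A j k : ℝ) * η k ≤ S := fun j =>
    Finset.single_le_sum (f := fun j => ∑ k, (A j k : ℝ) * η k)
      (fun j _ => Finset.sum_nonneg fun k _ => mul_nonneg (Nat.cast_nonneg _) (h.pos k).le)
      (Finset.mem_univ j)
  -- `K` is so large that the gap `ρ α - ρ β` of each upstream class `β` absorbs all arrows leaving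
  -- that class.
  obtain ⟨K, hK1, hK⟩ : ∃ K : ℝ, 1 ≤ K ∧ ∀ j, cls A j ≠ α → ClassAccess A (cls A j) α →
      S ≤ K * ((ρ α - ρ (cls A j)) * η j) := by
    have : ∀ᶠ K : ℝ in Filter.atTop, ∀ j, cls A j ≠ α → ClassAccess A (cls A j) α →
        S ≤ K * ((ρ α - ρ (cls A j)) * η j) := by
      refine Filter.eventually_all.2 fun j => ?_
      by_cases hj : cls A j ≠ α ∧ ClassAccess A (cls A j) α
      · have hpos : 0 < (ρ α - ρ (cls A j)) * η j :=
          mul_pos (sub_pos.2 (hdist _ hj.1 hj.2)) (h.pos j)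
        filter_upwards [Filter.eventually_ge_atTop (S / ((ρ α - ρ (cls A j)) * η j))] with K hK _ _
        exact (div_le_iff₀ hpos).1 hK
      · exact Filter.Eventually.of_forall fun K h1 h2 => (hj ⟨h1, h2⟩).elim
    obtain ⟨K, h1, h2⟩ := (this.and (Filter.eventually_ge_atTop 1)).exists
    exact ⟨K, h2, h1⟩
  have hK0 : 0 < K := one_pos.trans_le hK1
  let ht : ι → ℕ := fun j => {l | Access A j l}.ncard
  -- A supersolution `A p ≤ ρ_α p`. Arrows leaving `α` end where `p` vanishes; arrows leaving an
  -- upstream class lower the height, which gains a factor `K` to be set against the gap.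
  let p : ι → ℝ := fun j => if ClassAccess A (cls A j) α then K ^ ht j * η j else 0
  have hp0 : ∀ j, 0 ≤ p j := fun j => by
    simp only [p]; split_ifs
    exacts [mul_nonneg (pow_nonneg hK0.le _) (h.pos j).le, le_rfl]
  have hacc : ∀ {j k}, 0 < A j k → ClassAccess A (cls A k) α → ClassAccess A (cls A j) α := by
    rintro j k hjk ⟨i, hi, l, hl, hil⟩
    exact ⟨j, rfl, l, hl, (Access.single hjk).trans ((cls_eq_iff.1 hi).2.trans hil)⟩
  have hsup : ∀ j, ∑ k, (A j k : ℝ) * p k ≤ ρ α * p j := by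
    intro j
    by_cases hj : ClassAccess A (cls A j) α
    swap
    · have : ∀ k, (A j k : ℝ) * p k = 0 := fun k => by
        rcases Nat.eq_zero_or_pos (A j k) with h0 | h0
        · simp [h0]
        · have : ¬ ClassAccess A (cls A k) α := fun hk => hj (hacc h0 hk)
          simp [p, this]
      simp [this, p, hj]
    have hpj : p j = K ^ ht j * η j := if_pos hj
    have hsame : ∀ k, cls A k = cls A j → p k = K ^ ht j * η k := fun k hk => by
      have h1 : ht k = ht j := by
        obtain ⟨h1, h2⟩ := cls_eq_iff.1 hk
        simp only [ht]
        congr 1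
        ext l
        exact ⟨fun h => h2.trans h, fun h => h1.trans h⟩
      simp only [p, hk, hj, if_true, h1]
    by_cases hjα : cls A j = α
    · have : ∀ k, (A j k : ℝ) * p k
          = K ^ ht j * ((A j k : ℝ) * (if cls A k = cls A j then η k else 0)) := fun k => by
        rcases Nat.eq_zero_or_pos (A j k) with h0 | h0
        · simp [h0]
        by_cases hk : cls A k = cls A j
        · rw [hsame k hk, if_pos hk]; ring
        · have : ¬ ClassAccess A (cls A k) α := by
            rintro ⟨i, hi, l, hl, hil⟩
            refine hk (cls_eq_iff.2 ⟨?_, Access.single h0⟩)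
            have hl' : cls A l = cls A j := hl.trans hjα.symm
            exact ((cls_eq_iff.1 hi).2.trans hil).trans (cls_eq_iff.1 hl').1
          simp [p, this, hk]
      simp only [this, ← Finset.mul_sum]
      rw [h.eigen, hpj, hjα]
      exact le_of_eq (by ring)
    · have hhj : ht j ≠ 0 := by
        simp only [ht]
        exact (Set.ncard_pos (Set.toFinite _)).2 ⟨j, Relation.ReflTransGen.refl⟩ |>.ne'
      obtain ⟨m, hm⟩ := Nat.exists_eq_succ_of_ne_zero hhj
      have hbound : ∀ k, (A j k : ℝ) * p k
          ≤ K ^ ht j * ((A j k : ℝ) * (if cls A k = cls A j then η k else 0))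
            + K ^ m * ((A j k : ℝ) * η k) := fun k => by
        rcases Nat.eq_zero_or_pos (A j k) with h0 | h0
        · simp [h0]
        have hη := (h.pos k).le
        by_cases hk : cls A k = cls A j
        · rw [hsame k hk, if_pos hk]
          have : 0 ≤ K ^ m * ((A j k : ℝ) * η k) := by positivity
          linarith
        · have hlt : ht k < ht j := ncard_access_lt h0 hk
          have hpk : p k ≤ K ^ m * η k := by
            simp only [p]
            split_ifs
            · exact mul_le_mul_of_nonneg_right (pow_le_pow_right₀ hK1 (by omega)) hη
            · positivity
          rw [if_neg hk, mul_zero, mul_zero, zero_add, mul_left_comm]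
          exact mul_le_mul_of_nonneg_left hpk (Nat.cast_nonneg _)
      calc ∑ k, (A j k : ℝ) * p k
          ≤ K ^ ht j * (ρ (cls A j) * η j) + K ^ m * ∑ k, (A j k : ℝ) * η k := by
            rw [← h.eigen j, Finset.mul_sum, Finset.mul_sum, ← Finset.sum_add_distrib]
            exact Finset.sum_le_sum fun k _ => hbound k
        _ ≤ K ^ ht j * (ρ (cls A j) * η j)
            + K ^ m * (K * ((ρ α - ρ (cls A j)) * η j)) := by
            gcongr
            exact (hSj j).trans (hK j hjα hj)
        _ = ρ α * p j := by rw [hpj, hm, pow_succ]; ring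
  have hmain : ∀ N i, classOrbit A α η N i ≤ ρ α ^ N * p i := by
    intro N
    induction N with
    | zero =>
      intro i
      rw [pow_zero, one_mul]
      unfold classOrbit
      split_ifs with hi
      · have : ClassAccess A (cls A i) α := ⟨i, rfl, i, hi, Relation.ReflTransGen.refl⟩
        simp only [p, this, if_true]
        exact le_mul_of_one_le_left (h.pos i).le (one_le_pow₀ hK1)
      · exact hp0 i
    | succ N ih =>
      intro i
      calc classOrbit A α η (N + 1) i ≤ ∑ j, (A i j : ℝ) * (ρ α ^ N * p j) :=
            Finset.sum_le_sum fun j _ => mul_le_mul_of_nonneg_left (ih j) (Nat.cast_nonneg _)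
        _ = ρ α ^ N * ∑ j, (A i j : ℝ) * p j := by
            rw [Finset.mul_sum]; exact Finset.sum_congr rfl fun j _ => by ring
        _ ≤ ρ α ^ N * (ρ α * p i) :=
            mul_le_mul_of_nonneg_left (hsup i) (pow_nonneg (h.nonneg α) N)
        _ = _ := by ring
  refine ⟨∑ j, p j, fun N i => (hmain N i).trans ?_⟩
  rw [mul_comm]
  exact mul_le_mul_of_nonneg_right (Finset.single_le_sum (fun j _ => hp0 j) (Finset.mem_univ i))
    (pow_nonneg (h.nonneg α) N)

/-- The eigenvector equation on `α` gives the start, and the non-negative matrix `A` propagates it.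
Consequently the orbit divided by `ρ α ^ N` is increasing. -/
theorem classOrbit_le_succ (h : IsBlockEigenvector A η ρ) (N : ℕ) (i : ι) :
    ρ α * classOrbit A α η N i ≤ classOrbit A α η (N + 1) i := by
  classical
  induction N generalizing i with
  | zero =>
    by_cases hi : cls A i = α
    · have h1 := h.eigen i
      simp only [hi] at h1
      simp only [classOrbit, hi, if_true]
      exact h1.ge
    · have : classOrbit A α η 0 i = 0 := by simp [classOrbit, hi]
      rw [this, mul_zero]
      exact classOrbit_nonneg h 1 i
  | succ N ih =>
    calc ρ α * classOrbit A α η (N + 1) i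
        = ∑ j, (A i j : ℝ) * (ρ α * classOrbit A α η N j) := by
          rw [classOrbit, Finset.mul_sum]; exact Finset.sum_congr rfl fun j _ => by ring
      _ ≤ _ := Finset.sum_le_sum fun j _ => mul_le_mul_of_nonneg_left (ih j) (Nat.cast_nonneg _)

/-- If the orbit grows at most like the powers of the eigenvalue of `α`, then all the other
classes with access to `α` have smaller eigenvalue. -/
theorem lt_of_classOrbit_le (h : IsBlockEigenvector A η ρ) (hα : 0 < ρ α)
    (hbdd : ∃ K, ∀ N i, classOrbit A α η N i ≤ K * ρ α ^ N) {β : ReducedVertex A} (hβ : β ≠ α)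
    (hacc : ClassAccess A β α) : ρ β < ρ α := by
  classical
  by_contra! hle
  obtain ⟨K, hK⟩ := hbdd
  let b : ι → ℕ → ℝ := fun i N => classOrbit A α η N i / ρ α ^ N
  have hmono : ∀ i, Monotone (b i) := fun i => monotone_nat_of_le_succ fun N => by
    simp only [b]
    rw [div_le_div_iff₀ (pow_pos hα _) (pow_pos hα _), pow_succ]
    have := mul_le_mul_of_nonneg_left (classOrbit_le_succ (α := α) h N i) (pow_pos hα N).le
    linarith
  have hlim : ∀ i, ∃ s, Filter.Tendsto (b i) Filter.atTop (nhds s) := fun i =>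
    ⟨_, tendsto_atTop_ciSup (hmono i) ⟨K, by
      rintro _ ⟨N, rfl⟩
      exact (div_le_iff₀ (pow_pos hα N)).2 (hK N i)⟩⟩
  choose s hs using hlim
  have hs0 : ∀ i, 0 ≤ s i := fun i => ge_of_tendsto' (hs i) fun N =>
    div_nonneg (classOrbit_nonneg h N i) (pow_pos hα N).le
  have hsα : ∀ i, cls A i = α → 0 < s i := fun i hi => by
    have h1 : b i 0 ≤ s i := (hmono i).ge_of_tendsto (hs i) 0
    have h2 : b i 0 = η i := by simp [b, classOrbit, hi]
    linarith [h.pos i]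
  -- The limit is an eigenvector of all of `A`, not only of a block.
  have heig : ∀ i, ∑ j, (A i j : ℝ) * s j = ρ α * s i := fun i => by
    refine tendsto_nhds_unique (f := fun N => ρ α * b i (N + 1)) (l := Filter.atTop) ?_
      (((Filter.tendsto_add_atTop_iff_nat 1).2 (hs i)).const_mul _)
    refine (tendsto_finsetSum Finset.univ fun j _ => (hs j).const_mul (A i j : ℝ)).congr
      fun N => ?_
    simp only [b, classOrbit, pow_succ]
    rw [Finset.sum_div, Finset.mul_sum]
    refine Finset.sum_congr rfl fun j _ => ?_
    field_simp
  have hsD : ∀ i k, cls A k = α → Access A i k → 0 < s i := by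
    intro i k hk hik
    induction hik using Relation.ReflTransGen.head_induction_on with
    | refl => exact hsα k hk
    | @head i j hij _ ih =>
      have h1 : (A i j : ℝ) * s j ≤ ∑ j, (A i j : ℝ) * s j :=
        Finset.single_le_sum (f := fun j => (A i j : ℝ) * s j)
          (fun j _ => mul_nonneg (Nat.cast_nonneg _) (hs0 j)) (Finset.mem_univ j)
      rw [heig] at h1
      have h2 : 0 < (A i j : ℝ) * s j := mul_pos (by exact_mod_cast hij) ih
      exact (pos_iff_pos_of_mul_pos (h2.trans_le h1)).1 hα
  obtain ⟨i₁, hi₁, k₁, hk₁, hik⟩ := hacc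
  have hk₁' : cls A k₁ = α := hk₁
  obtain ⟨⟨i₀, hi₀⟩, hmin⟩ := (⟨⟨i₁, hi₁⟩⟩ : Nonempty (classSet A β)).elim fun o =>
    haveI : Nonempty (classSet A β) := ⟨o⟩
    Finite.exists_min fun i : classSet A β => s i / η i
  have hi₀' : cls A i₀ = β := hi₀
  set t := s i₀ / η i₀ with ht
  have htη : ∀ k, cls A k = β → t * η k ≤ s k := fun k hk =>
    (le_div_iff₀ (h.pos k)).1 (hmin ⟨k, hk⟩)
  -- Since `ρ β ≥ ρ α`, contact of `s` with `t η` at `k` leaves no slack in the eigenvalue equation.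
  -- Contact passes to every successor, and `s` vanishes at successors outside `β`.
  have hstep : ∀ k, cls A k = β → s k = t * η k → ∀ l, 0 < A k l →
      s l = t * (if cls A l = β then η l else 0) := by
    intro k hk hsk l hkl
    have hterm : ∀ j, 0 ≤ (A k j : ℝ) * (s j - t * (if cls A j = β then η j else 0)) := fun j => by
      refine mul_nonneg (Nat.cast_nonneg _) ?_
      split_ifs with hj
      · exact sub_nonneg.2 (htη j hj)
      · simpa using hs0 j
    have hsum : ∑ j, (A k j : ℝ) * (s j - t * (if cls A j = β then η j else 0)) ≤ 0 := by
      have h1 := h.eigen k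
      simp only [hk] at h1
      have h2 : ∑ j, (A k j : ℝ) * (s j - t * (if cls A j = β then η j else 0))
          = ρ α * s k - t * (ρ β * η k) := by
        rw [← heig, ← h1, Finset.mul_sum, ← Finset.sum_sub_distrib]
        exact Finset.sum_congr rfl fun j _ => by ring
      rw [h2, hsk]
      have h3 : 0 ≤ t * η k := hsk ▸ hs0 k
      have := mul_le_mul_of_nonneg_right hle h3
      linarith
    have h0 := (Finset.sum_eq_zero_iff_of_nonneg fun j _ => hterm j).1
      (le_antisymm hsum (Finset.sum_nonneg fun j _ => hterm j)) l (Finset.mem_univ l)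
    rcases mul_eq_zero.1 h0 with h0 | h0
    · exact (hkl.ne' (by exact_mod_cast h0)).elim
    · exact sub_eq_zero.1 h0
  -- On a route to `α` the vector `s` stays positive, so the route could never leave `β`.
  have hprop : ∀ k, Access A i₀ k → Access A k k₁ → cls A k = β ∧ s k = t * η k := by
    intro k hk
    induction hk with
    | refl => exact fun _ => ⟨hi₀', by rw [ht, div_mul_cancel₀ _ (h.pos i₀).ne']⟩
    | @tail k l hk hkl ih =>
      intro hl
      obtain ⟨h1, h2⟩ := ih ((Access.single hkl).trans hl)
      have h3 := hstep k h1 h2 l hkl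
      by_cases hlβ : cls A l = β
      · rw [if_pos hlβ] at h3; exact ⟨hlβ, h3⟩
      · rw [if_neg hlβ, mul_zero] at h3
        exact ((hsD l k₁ hk₁' hl).ne' h3).elim
  have hi₁' : cls A i₁ = cls A i₀ := Eq.trans hi₁ hi₀'.symm
  have := (hprop k₁ ((cls_eq_iff.1 hi₁').2.trans hik) Relation.ReflTransGen.refl).1
  exact hβ (this.symm.trans hk₁')

end Growth

end NonnegMatrix

namespace BratteliDiagram

open NonnegMatrix

variable {B : BratteliDiagram.{u, v}} {ι : Type w} {lab : ∀ n, ι ≃ B.V (n + 1)}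
  {A : Matrix ι ι ℕ} {C : Set ι}

/-! ### Labels of the vertices of a path -/

/-- The label of the vertex of `x` at level `n + 1`. -/
def lbl (lab : ∀ n, ι ≃ B.V (n + 1)) (x : B.PathSpace) (n : ℕ) : ι :=
  (lab n).symm (B.rng n (x.1 n))

theorem lbl_eq_iff {x y : B.PathSpace} {n : ℕ} :
    lbl lab x n = lbl lab y n ↔ B.rng n (x.1 n) = B.rng n (y.1 n) :=
  (lab n).symm.injective.eq_iff

theorem lbl_of_mem_cyl {x y : B.PathSpace} {n k : ℕ} (h : y ∈ cyl x n) (hk : k ≤ n) :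
    lbl lab y k = lbl lab x k := by rw [lbl_eq_iff, h k hk]

theorem lbl_splice_of_ge {b x : B.PathSpace} {n k : ℕ} (h : lbl lab b n = lbl lab x n)
    (hk : n ≤ k) : lbl lab (splice b n x) k = lbl lab x k := by
  rw [lbl_eq_iff]
  rcases hk.eq_or_lt with rfl | hk
  · rw [splice_apply_le (lbl_eq_iff.1 h) le_rfl, lbl_eq_iff.1 h]
  · rw [splice_apply_gt hk]

theorem lbl_splice_of_le {b x : B.PathSpace} {n k : ℕ} (h : lbl lab b n = lbl lab x n)
    (hk : k ≤ n) : lbl lab (splice b n x) k = lbl lab b k := by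
  rw [lbl_eq_iff, splice_apply_le (lbl_eq_iff.1 h) hk]

theorem exists_lbl_eq (lab : ∀ n, ι ≃ B.V (n + 1)) (n : ℕ) (i : ι) :
    ∃ x : B.PathSpace, lbl lab x n = i := by
  obtain ⟨e, he⟩ := B.rng_surjective n (lab n i)
  obtain ⟨x, hx⟩ := exists_path n e
  exact ⟨x, by rw [lbl, hx, he, Equiv.symm_apply_apply]⟩

theorem IsStationary.card_edges (hst : B.IsStationary lab A.transpose) (n : ℕ) (i j : ι) :
    Nat.card {e : B.E (n + 1) // B.rng (n + 1) e = lab (n + 1) j ∧ B.src (n + 1) e = lab n i}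
      = A i j := by
  have := congrFun (congrFun (hst n) j) i
  exact this

theorem IsStationary.exists_edge (hst : B.IsStationary lab A.transpose) {x : B.PathSpace} {n : ℕ}
    {j : ι} (h : 0 < A (lbl lab x n) j) : ∃ y ∈ cyl x n, lbl lab y (n + 1) = j := by
  rw [← hst.card_edges n] at h
  obtain ⟨⟨e, he, he'⟩⟩ := (Nat.card_pos_iff.1 h).1
  rw [lbl, Equiv.apply_symm_apply] at he'
  obtain ⟨y, hy, hye⟩ := exists_mem_cyl_succ x n e he'
  exact ⟨y, hy, by rw [lbl, hye, he, Equiv.symm_apply_apply]⟩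

theorem IsStationary.pos_lbl_succ (hst : B.IsStationary lab A.transpose) (x : B.PathSpace)
    (n : ℕ) : 0 < A (lbl lab x n) (lbl lab x (n + 1)) := by
  have := B.finite_E (n + 1)
  rw [← hst.card_edges n]
  have : Nonempty {e : B.E (n + 1) // B.rng (n + 1) e = lab (n + 1) (lbl lab x (n + 1)) ∧
    B.src (n + 1) e = lab n (lbl lab x n)} :=
    ⟨⟨x.1 (n + 1), by simp [lbl], by simp [lbl, x.2 n]⟩⟩
  exact Nat.card_pos

theorem IsStationary.access_lbl (hst : B.IsStationary lab A.transpose) (x : B.PathSpace)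
    {m n : ℕ} (h : m ≤ n) : Access A (lbl lab x m) (lbl lab x n) := by
  induction n, h using Nat.le_induction with
  | base => exact Relation.ReflTransGen.refl
  | succ n _ ih => exact ih.tail (hst.pos_lbl_succ x n)

theorem IsStationary.sum_edges [Fintype ι] (hst : B.IsStationary lab A.transpose) (x : B.PathSpace)
    (n : ℕ) (g : ι → ℝ≥0∞) :
    ∑' e : {e : B.E (n + 1) // B.src (n + 1) e = B.rng n (x.1 n)},
      g ((lab (n + 1)).symm (B.rng (n + 1) e)) = ∑ j, (A (lbl lab x n) j : ℝ≥0∞) * g j := by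
  classical
  have := B.finite_E (n + 1)
  have := Fintype.ofFinite {e : B.E (n + 1) // B.src (n + 1) e = B.rng n (x.1 n)}
  rw [tsum_fintype, ← Finset.sum_fiberwise Finset.univ
    (fun e : {e : B.E (n + 1) // B.src (n + 1) e = B.rng n (x.1 n)} =>
      (lab (n + 1)).symm (B.rng (n + 1) e))]
  refine Finset.sum_congr rfl fun j _ => ?_
  rw [Finset.sum_congr rfl (g := fun _ => g j) fun e he => by rw [(Finset.mem_filter.1 he).2],
    Finset.sum_const, nsmul_eq_mul, ← hst.card_edges n]
  congr 2
  rw [← Fintype.card_subtype, ← Nat.card_eq_fintype_card]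
  refine Nat.card_congr
    ⟨fun e => ⟨e.1.1, ?_, ?_⟩, fun e => ⟨⟨e.1, ?_⟩, ?_⟩, fun e => rfl, fun e => rfl⟩
  · exact ((lab (n + 1)).symm_apply_eq).1 e.2
  · rw [e.1.2, lbl, Equiv.apply_symm_apply]
  · rw [e.2.2, lbl, Equiv.apply_symm_apply]
  · simp only [e.2.1, Equiv.symm_apply_apply]

/-- Splitting a cylinder according to the next edge. -/
theorem IsStationary.measure_cyl_inter [Fintype ι] (hst : B.IsStationary lab A.transpose)
    {μ : Measure B.PathSpace} {x : B.PathSpace} {n : ℕ} {S : Set B.PathSpace}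
    (hS : MeasurableSet S) (g : ι → ℝ≥0∞)
    (hg : ∀ y ∈ cyl x n, μ (cyl y (n + 1) ∩ S) = g (lbl lab y (n + 1))) :
    μ (cyl x n ∩ S) = ∑ j, (A (lbl lab x n) j : ℝ≥0∞) * g j := by
  have := B.finite_E (n + 1)
  choose y hyx hye using fun e : {e : B.E (n + 1) // B.src (n + 1) e = B.rng n (x.1 n)} =>
    exists_mem_cyl_succ x n e.1 e.2
  have hU : cyl x n ∩ S = ⋃ e, cyl (y e) (n + 1) ∩ S := by
    rw [← iUnion_inter]
    congr 1
    ext z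
    simp only [mem_iUnion]
    constructor
    · intro hz
      refine ⟨⟨z.1 (n + 1), by rw [← z.2 n, hz n le_rfl]⟩, fun i hi => ?_⟩
      rcases Nat.le_succ_iff.1 hi with hi | rfl
      · rw [hz i hi, hyx _ i hi]
      · rw [hye]
    · rintro ⟨e, hz⟩ i hi
      rw [hz i (hi.trans n.le_succ), hyx e i hi]
  rw [← hst.sum_edges, hU, measure_iUnion]
  · refine tsum_congr fun e => ?_
    rw [hg _ (hyx e), lbl, hye]
  · intro e e' hne
    refine disjoint_left.2 fun z hz hz' => hne (Subtype.ext ?_)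
    rw [← hye e, ← hye e', ← hz.1 (n + 1) le_rfl, ← hz'.1 (n + 1) le_rfl]
  · exact fun e => (measurableSet_cyl _ _).inter hS

theorem exists_limit (f : ℕ → B.PathSpace) (h : ∀ m, f (m + 1) ∈ cyl (f m) m) :
    ∃ z, ∀ m, z ∈ cyl (f m) m := by
  have hstab : ∀ m k, m ≤ k → ∀ i ≤ m, (f k).1 i = (f m).1 i := by
    intro m k hmk
    induction k, hmk using Nat.le_induction with
    | base => exact fun i _ => rfl
    | succ k hk ih => exact fun i hi => (h k i (hi.trans hk)).trans (ih i hi)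
  refine ⟨⟨fun i => (f i).1 i, fun i => ?_⟩, fun m i hi => (hstab i m hi i le_rfl).symm⟩
  change B.rng i ((f i).1 i) = B.src (i + 1) ((f (i + 1)).1 (i + 1))
  rw [← hstab i (i + 1) i.le_succ i le_rfl]
  exact (f (i + 1)).2 i

theorem IsStationary.exists_forall_ge (hst : B.IsStationary lab A.transpose)
    (hC : ∀ i ∈ C, ∃ j ∈ C, 0 < A i j) (x : B.PathSpace) (n : ℕ) (hx : lbl lab x n ∈ C) :
    ∃ y ∈ cyl x n, ∀ k ≥ n, lbl lab y k ∈ C := by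
  have hstep : ∀ (k : ℕ) (y : {y : B.PathSpace // lbl lab y (n + k) ∈ C}),
      ∃ z : {y : B.PathSpace // lbl lab y (n + (k + 1)) ∈ C}, z.1 ∈ cyl y.1 (n + k) := by
    rintro k ⟨y, hy⟩
    obtain ⟨j, hj, hpos⟩ := hC _ hy
    obtain ⟨z, hz, hzj⟩ := hst.exists_edge hpos
    exact ⟨⟨z, by rw [← add_assoc, hzj]; exact hj⟩, hz⟩
  choose next hnext using hstep
  obtain ⟨f, hf0, hfC, hf⟩ : ∃ f : ℕ → B.PathSpace, f 0 = x ∧ (∀ k, lbl lab (f k) (n + k) ∈ C) ∧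
      ∀ k, f (k + 1) ∈ cyl (f k) (n + k) := by
    let f : ∀ k, {y : B.PathSpace // lbl lab y (n + k) ∈ C} := fun k =>
      Nat.rec (motive := fun k => {y : B.PathSpace // lbl lab y (n + k) ∈ C}) ⟨x, hx⟩ next k
    exact ⟨fun k => (f k).1, rfl, fun k => (f k).2, fun k => hnext k (f k)⟩
  -- Truncated subtraction keeps the shifted sequence equal to `x` below index `n`.
  have hpre : ∀ m < n, f (m + 1 - n) ∈ cyl (f (m - n)) m := fun m hm => by
    rw [Nat.sub_eq_zero_of_le hm, Nat.sub_eq_zero_of_le hm.le]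
    exact mem_cyl_self _ m
  obtain ⟨z, hz⟩ := exists_limit (fun m => f (m - n)) (fun m => by
    rcases lt_or_ge m n with h | h
    · exact hpre m h
    · obtain ⟨k, rfl⟩ := Nat.exists_eq_add_of_le h
      simp only [Nat.add_sub_cancel_left, add_assoc]
      exact hf k)
  refine ⟨z, by simpa [hf0] using hz n, fun k hk => ?_⟩
  obtain ⟨k, rfl⟩ := Nat.exists_eq_add_of_le hk
  rw [lbl_of_mem_cyl (hz (n + k)) le_rfl]
  simp only [Nat.add_sub_cancel_left]
  exact hfC k

/-- Predecessors within `C` supply a prefix ending at `i`, and successors within `C` an infinite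
continuation. -/
theorem IsStationary.exists_mem_subPaths (hst : B.IsStationary lab A.transpose)
    (hC : ∀ i ∈ C, ∃ j ∈ C, 0 < A i j) (hC' : ∀ j ∈ C, ∃ i ∈ C, 0 < A i j) (n : ℕ) {i : ι}
    (hi : i ∈ C) : ∃ x ∈ B.subPaths lab C, lbl lab x n = i := by
  have hback : ∃ x : B.PathSpace, lbl lab x n = i ∧ ∀ k ≤ n, lbl lab x k ∈ C := by
    induction n generalizing i with
    | zero =>
      obtain ⟨x, hx⟩ := exists_lbl_eq lab 0 i
      refine ⟨x, hx, fun k hk => ?_⟩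
      rw [Nat.le_zero.1 hk, hx]; exact hi
    | succ n ih =>
      obtain ⟨j, hj, hpos⟩ := hC' i hi
      obtain ⟨x, hx, hxC⟩ := ih hj
      rw [← hx] at hpos
      obtain ⟨y, hy, hyi⟩ := hst.exists_edge hpos
      refine ⟨y, hyi, fun k hk => ?_⟩
      rcases Nat.le_succ_iff.1 hk with hk | rfl
      · rw [lbl_of_mem_cyl hy hk]; exact hxC k hk
      · rw [hyi]; exact hi
  obtain ⟨x, hx, hxC⟩ := hback
  obtain ⟨y, hy, hyC⟩ := hst.exists_forall_ge hC x n (hxC n le_rfl)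
  refine ⟨y, fun k => ?_, by rw [lbl_of_mem_cyl hy le_rfl, hx]⟩
  rcases le_total k n with h | h
  · change lbl lab y k ∈ C
    rw [lbl_of_mem_cyl hy h]; exact hxC k h
  · exact hyC k h

/-! ### Paths which are eventually in a set of vertices -/

/-- The paths whose vertices have labels in `C` from level `n + 1` on. -/
def tailSet (lab : ∀ n, ι ≃ B.V (n + 1)) (C : Set ι) (n : ℕ) : Set B.PathSpace :=
  {x | ∀ k ≥ n, lbl lab x k ∈ C}

theorem tailSet_zero : tailSet lab C 0 = B.subPaths lab C := by
  ext x
  exact ⟨fun h k => h k (Nat.zero_le k), fun h k _ => h k⟩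

theorem isClosed_tailSet (lab : ∀ n, ι ≃ B.V (n + 1)) (C : Set ι) (n : ℕ) :
    IsClosed (tailSet lab C n : Set B.PathSpace) := by
  have : (tailSet lab C n : Set B.PathSpace) = ⋂ k ≥ n, {x | lbl lab x k ∈ C} := by
    ext x; simp [tailSet]
  rw [this]
  refine isClosed_biInter fun k _ => isClosed_of_cyl k fun x hx z hz => ?_
  change lbl lab z k ∈ C
  rw [lbl_of_mem_cyl hz le_rfl]
  exact hx

theorem measurableSet_tailSet (lab : ∀ n, ι ≃ B.V (n + 1)) (C : Set ι) (n : ℕ) :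
    MeasurableSet (tailSet lab C n : Set B.PathSpace) := (isClosed_tailSet lab C n).measurableSet

theorem isClosed_subPaths (lab : ∀ n, ι ≃ B.V (n + 1)) (C : Set ι) :
    IsClosed (B.subPaths lab C) := tailSet_zero (B := B) ▸ isClosed_tailSet lab C 0

theorem measurableSet_subPaths (lab : ∀ n, ι ≃ B.V (n + 1)) (C : Set ι) :
    MeasurableSet (B.subPaths lab C) := (isClosed_subPaths lab C).measurableSet

theorem monotone_tailSet (lab : ∀ n, ι ≃ B.V (n + 1)) (C : Set ι) :
    Monotone (tailSet lab C : ℕ → Set B.PathSpace) :=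
  fun _ _ hmn _ hx k hk => hx k (hmn.trans hk)

theorem splice_mem_subPaths {x y : B.PathSpace} (hx : x ∈ B.subPaths lab C)
    (hy : y ∈ B.subPaths lab C) (n : ℕ) (h : B.rng n (x.1 n) = B.rng n (y.1 n)) :
    splice x n y ∈ B.subPaths lab C := by
  intro k
  have h' : lbl lab x n = lbl lab y n := lbl_eq_iff.2 h
  change lbl lab _ k ∈ C
  rcases le_total k n with hk | hk
  · rw [lbl_splice_of_le h' hk]; exact hx k
  · rw [lbl_splice_of_ge h' hk]; exact hy k

/-- A path eventually in `C` enters the subdiagram once its prefix is exchanged for one inside `C`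
with the same end vertex. -/
theorem IsStationary.saturation_eq (hst : B.IsStationary lab A.transpose)
    (hC : ∀ i ∈ C, ∃ j ∈ C, 0 < A i j) (hC' : ∀ j ∈ C, ∃ i ∈ C, 0 < A i j) :
    B.saturation lab C = ⋃ n, tailSet lab C n := by
  ext x
  simp only [mem_iUnion]
  constructor
  · rintro ⟨y, hy, n, hn⟩
    refine ⟨n, fun k hk => ?_⟩
    have : lbl lab x k = lbl lab y k := by rw [lbl_eq_iff, hn k hk]
    rw [this]; exact hy k
  · rintro ⟨n, hn⟩
    obtain ⟨y, hy, hyx⟩ := hst.exists_mem_subPaths hC hC' n (hn n le_rfl)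
    refine ⟨splice y n x, fun k => ?_, tail_splice _ _ _⟩
    change lbl lab _ k ∈ C
    rcases le_total k n with hk | hk
    · rw [lbl_splice_of_le hyx hk]; exact hy k
    · rw [lbl_splice_of_ge hyx hk]; exact hn k hk

/-- The part of a cylinder which eventually stays in `C` has a mass which only depends on the end
vertex. -/
theorem measure_cyl_inter_tailSet_eq {μ : Measure B.PathSpace}
    (hμ : PartialInvariant B.tail univ μ) {x y : B.PathSpace} {n m : ℕ} (hnm : n ≤ m)
    (h : lbl lab x n = lbl lab y n) :
    μ (cyl x n ∩ tailSet lab C m) = μ (cyl y n ∩ tailSet lab C m) := by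
  have hxy := lbl_eq_iff.1 h
  have hmaps : ∀ a b : B.PathSpace, lbl lab a n = lbl lab b n → ∀ z ∈ cyl a n ∩ tailSet lab C m,
      splice b n z ∈ cyl b n ∩ tailSet lab C m := by
    intro a b hab z hz
    have hbz : lbl lab b n = lbl lab z n := by rw [lbl_of_mem_cyl hz.1 le_rfl, hab]
    refine ⟨splice_mem_cyl (lbl_eq_iff.1 hbz), fun k hk => ?_⟩
    rw [lbl_splice_of_ge hbz (hnm.trans hk)]
    exact hz.2 k hk
  have himg : splice y n '' (cyl x n ∩ tailSet lab C m) = cyl y n ∩ tailSet lab C m := by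
    refine Subset.antisymm ?_ fun z hz => ?_
    · rintro _ ⟨z, hz, rfl⟩
      exact hmaps x y h z hz
    · exact ⟨splice x n z, hmaps y x h.symm z hz, splice_splice hxy.symm hz.1⟩
  rw [← himg]
  exact (hμ _ _ (measurable_splice y n) ((measurableSet_cyl x n).inter
    (measurableSet_tailSet lab C m)) ((injOn_splice hxy).mono inter_subset_left) (subset_univ _)
    (subset_univ _) fun z _ => tail_splice _ _ _).symm

end BratteliDiagram

/-! ### Classes, diagonal blocks and transposition -/

namespace NonnegMatrix

variable {ι : Type w} {A : Matrix ι ι ℕ} {α : ReducedVertex A}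

theorem mem_classSet {i : ι} : i ∈ classSet A α ↔ cls A i = α := Iff.rfl

theorem access_of_mem_classSet {i j : ι} (hi : i ∈ classSet A α) (hj : j ∈ classSet A α) :
    Access A i j := (cls_eq_iff.1 (Eq.trans hi (Eq.symm hj))).1

theorem mem_classSet_of_access {i j k : ι} (hi : i ∈ classSet A α) (hk : k ∈ classSet A α)
    (hij : Access A i j) (hjk : Access A j k) : j ∈ classSet A α :=
  (cls_eq_iff.2 ⟨hjk.trans (access_of_mem_classSet hk hi), hij⟩ : cls A j = cls A i).trans hi

theorem exists_pos_of_block_ne_zero (h : block A α ≠ 0) :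
    ∃ i ∈ classSet A α, ∃ j ∈ classSet A α, 0 < A i j := by
  by_contra! h0
  refine h ?_
  ext i j
  exact Nat.le_zero.1 (h0 i i.2 j j.2)

theorem exists_succ_of_block_ne_zero (h : block A α ≠ 0) :
    ∀ i ∈ classSet A α, ∃ j ∈ classSet A α, 0 < A i j := by
  intro k hk
  obtain ⟨i, hi, j, hj, hij⟩ := exists_pos_of_block_ne_zero h
  rcases (access_of_mem_classSet hk hi).cases_head with rfl | ⟨l, hkl, hli⟩
  · exact ⟨j, hj, hij⟩
  · exact ⟨l, mem_classSet_of_access hk hi (Access.single hkl) hli, hkl⟩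

theorem exists_pred_of_block_ne_zero (h : block A α ≠ 0) :
    ∀ j ∈ classSet A α, ∃ i ∈ classSet A α, 0 < A i j := by
  intro k hk
  obtain ⟨i, hi, j, hj, hij⟩ := exists_pos_of_block_ne_zero h
  rcases (access_of_mem_classSet hj hk).cases_tail with rfl | ⟨l, hjl, hlk⟩
  · exact ⟨i, hi, hij⟩
  · exact ⟨l, mem_classSet_of_access hj hk hjl (Access.single hlk), hlk⟩

theorem access_transpose {i j : ι} : Access A.transpose i j ↔ Access A j i :=
  Relation.reflTransGen_swap

/-- Transposition keeps the classes and transposes the blocks, so primitivity passes from `F` to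
`A`. -/
theorem exists_pow_block_pos [Fintype ι] [Fintype (classSet A α)] [DecidableEq (classSet A α)]
    (hprim : PrimitiveBlocks A.transpose) (h : block A α ≠ 0) :
    ∃ k, ∀ i j, 0 < (block A α ^ k) i j := by
  classical
  obtain ⟨i₀, hi₀⟩ := Quotient.exists_rep α
  set α' : ReducedVertex A.transpose := cls A.transpose i₀ with hα'
  have hset : classSet A.transpose α' = classSet A α := by
    ext j
    rw [mem_classSet, mem_classSet, hα', ← hi₀]
    change _ ↔ cls A j = cls A i₀
    rw [cls_eq_iff, cls_eq_iff, access_transpose, access_transpose, and_comm]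
  let e : classSet A.transpose α' ≃ classSet A α := Equiv.setCongr hset
  have hblock : block A.transpose α' = (block A α).transpose.submatrix e e := rfl
  have hne : block A.transpose α' ≠ 0 := by
    intro h0
    refine h ?_
    ext i j
    have := congrFun (congrFun h0 (e.symm j)) (e.symm i)
    rw [hblock] at this
    simpa using this
  obtain ⟨-, k, -, hk⟩ := hprim α' hne
  refine ⟨k, fun i j => ?_⟩
  have h1 := hk (e.symm j) (e.symm i)
  rw [show (fun k : ℕ => (k : ℤ)) = Nat.castRingHom ℤ from rfl, ← Matrix.map_pow, hblock] at h1
  have h2 : ((block A α).transpose.submatrix e e) ^ k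
      = ((block A α ^ k).transpose).submatrix e e := by
    rw [Matrix.transpose_pow]
    exact (map_pow (Matrix.reindexAlgEquiv ℕ ℕ e.symm) (block A α).transpose k).symm
  simp only [Matrix.map_apply] at h1
  have h3 := (Int.natCast_pos (n := _)).1 h1
  have h4 := congrFun (congrFun h2 (e.symm j)) (e.symm i)
  simp only [Matrix.submatrix_apply, Matrix.transpose_apply, Equiv.apply_symm_apply] at h4
  rw [← h4]
  convert h3

open Classical in
theorem sum_classSet [Fintype ι] {R : Type*} [NonUnitalNonAssocSemiring R] (C : Set ι)
    (a f : ι → R) : ∑ j : C, a j * f j = ∑ j, a j * (if j ∈ C then f j else 0) := by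
  simp only [mul_ite, mul_zero]
  rw [← Finset.sum_filter]
  exact (Finset.sum_subtype (Finset.univ.filter (· ∈ C)) (by simp) fun j => a j * f j).symm

open Classical in
theorem classRadius_eq_of_pos_eigenvector [Fintype ι] {η : ι → ℝ}
    (hη : ∀ i ∈ classSet A α, 0 < η i) {ρ : ℝ} (hρ : 0 ≤ ρ)
    (h : ∀ i ∈ classSet A α, ∑ j, (A i j : ℝ) * (if j ∈ classSet A α then η j else 0) = ρ * η i) :
    classRadius A α = ENNReal.ofReal ρ := by
  obtain ⟨i₀, hi₀⟩ := Quotient.exists_rep α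
  have : Nonempty (classSet A α) := ⟨⟨i₀, hi₀⟩⟩
  refine spectralRadius_eq_of_pos_eigenvector (block A α) (η := fun i => η i)
    (fun i => hη i i.2) hρ fun i => ?_
  rw [← h i i.2, ← sum_classSet]
  rfl

end NonnegMatrix

/-! ### Cylinder masses as backward orbits of the block -/

namespace BratteliDiagram

open NonnegMatrix

variable {B : BratteliDiagram.{u, v}} {ι : Type w} [Fintype ι] {lab : ∀ n, ι ≃ B.V (n + 1)}
  {A : Matrix ι ι ℕ} {α : ReducedVertex A}

/-- The mass of the paths which pass through a given initial segment ending at the vertex `i` of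
level `n + 1` and stay in `C` from there on. -/
noncomputable def massVec (lab : ∀ n, ι ≃ B.V (n + 1)) (C : Set ι) (μ : Measure B.PathSpace)
    (n : ℕ) (i : ι) : ℝ≥0∞ :=
  μ (cyl (exists_lbl_eq lab n i).choose n ∩ tailSet lab C n)

omit [Fintype ι] in
theorem measure_cyl_inter_tailSet {C : Set ι} {μ : Measure B.PathSpace}
    (hμ : PartialInvariant B.tail univ μ) (x : B.PathSpace) (n : ℕ) :
    μ (cyl x n ∩ tailSet lab C n) = massVec lab C μ n (lbl lab x n) :=
  measure_cyl_inter_tailSet_eq hμ le_rfl (exists_lbl_eq lab n (lbl lab x n)).choose_spec.symm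

open Classical in
theorem IsStationary.massVec_eq_sum (hst : B.IsStationary lab A.transpose) {C : Set ι}
    {μ : Measure B.PathSpace} (hμ : PartialInvariant B.tail univ μ) (n : ℕ) {i : ι} (hi : i ∈ C) :
    massVec lab C μ n i =
      ∑ j, (A i j : ℝ≥0∞) * (if j ∈ C then massVec lab C μ (n + 1) j else 0) := by
  set x := (exists_lbl_eq (B := B) lab n i).choose
  have hx : lbl lab x n = i := (exists_lbl_eq lab n i).choose_spec
  have := hst.measure_cyl_inter (μ := μ) (x := x) (n := n) (measurableSet_tailSet lab C n)
    (fun j => if j ∈ C then massVec lab C μ (n + 1) j else 0) fun y hy => ?_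
  · rw [hx] at this
    exact this
  · split_ifs with h
    · rw [← measure_cyl_inter_tailSet hμ]
      congr 1
      ext z
      refine and_congr_right fun hz => ⟨fun hzt k hk => hzt k (n.le_succ.trans hk),
        fun hzt k hk => ?_⟩
      rcases hk.eq_or_lt with rfl | hk
      · rw [lbl_of_mem_cyl hz n.le_succ, lbl_of_mem_cyl hy le_rfl, hx]; exact hi
      · exact hzt k hk
    · convert measure_empty (μ := μ)
      refine eq_empty_of_forall_notMem fun z hz => h ?_
      rw [← lbl_of_mem_cyl hz.1 le_rfl]
      exact hz.2 _ n.le_succ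

variable (hst : B.IsStationary lab A.transpose) (hprim : PrimitiveBlocks A.transpose)
  (hα : block A α ≠ 0)
include hst hα

omit [Fintype ι] in
theorem IsStationary.exists_mem_subPaths_class (n : ℕ) {i : ι} (hi : i ∈ classSet A α) :
    ∃ x ∈ B.subPaths lab (classSet A α), lbl lab x n = i :=
  hst.exists_mem_subPaths (exists_succ_of_block_ne_zero hα) (exists_pred_of_block_ne_zero hα) n hi

omit [Fintype ι] in
-- The mass may be computed with a prefix lying inside the subdiagram, and is then that of a subset
-- of `Y_α`.
theorem IsStationary.massVec_le {μ : Measure B.PathSpace} (hμ : PartialInvariant B.tail univ μ)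
    (n : ℕ) {i : ι} (hi : i ∈ classSet A α) :
    massVec lab (classSet A α) μ n i ≤ μ (B.subPaths lab (classSet A α)) := by
  obtain ⟨x, hx, rfl⟩ := hst.exists_mem_subPaths_class hα n hi
  rw [← measure_cyl_inter_tailSet hμ]
  refine measure_mono fun z hz k => ?_
  rcases le_total k n with hk | hk
  · change lbl lab z k ∈ _
    rw [lbl_of_mem_cyl hz.1 hk]; exact hx k
  · exact hz.2 k hk

omit [Fintype ι] hst hα in
theorem exists_massVec_ne_zero {μ : Measure B.PathSpace} (hμ : PartialInvariant B.tail univ μ)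
    (h0 : μ (B.subPaths lab (classSet A α)) ≠ 0) :
    ∃ i ∈ classSet A α, massVec lab (classSet A α) μ 0 i ≠ 0 := by
  by_contra! h
  refine h0 ?_
  obtain ⟨s, hs⟩ := exists_seq_dense B
  have hsub : B.subPaths lab (classSet A α) ⊆
      ⋃ k, cyl (s k) 0 ∩ tailSet lab (classSet A α) 0 := fun x hx => by
    obtain ⟨k, hk⟩ := hs x 0
    refine mem_iUnion.2 ⟨k, ?_, tailSet_zero (B := B) ▸ hx⟩
    rw [cyl_eq_of_mem hk]; exact mem_cyl_self x 0
  refine measure_mono_null hsub (measure_iUnion_null fun k => ?_)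
  by_cases hk : lbl lab (s k) 0 ∈ classSet A α
  · rw [measure_cyl_inter_tailSet hμ]; exact h _ hk
  · convert measure_empty (μ := μ)
    refine eq_empty_of_forall_notMem fun z hz => hk ?_
    rw [← lbl_of_mem_cyl hz.1 le_rfl]
    exact hz.2 0 le_rfl

include hprim

open Classical in
-- The masses are a backward orbit of a primitive matrix, hence geometric. The Perron eigenvector is
-- thus obtained from a measure.
theorem IsStationary.exists_eigenvector {μ : Measure B.PathSpace}
    (hμ : PartialInvariant B.tail univ μ)
    (h0 : μ (B.subPaths lab (classSet A α)) ≠ 0) (htop : μ (B.subPaths lab (classSet A α)) ≠ ∞) :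
    ∃ (η : ι → ℝ) (ρ : ℝ), 0 < ρ ∧ (∀ i ∈ classSet A α, 0 < η i) ∧
      (∀ i ∈ classSet A α,
        ∑ j, (A i j : ℝ) * (if j ∈ classSet A α then η j else 0) = ρ * η i) ∧
      ∀ n, ∀ i ∈ classSet A α,
        massVec lab (classSet A α) μ n i = ENNReal.ofReal (η i / ρ ^ n) := by
  set C := classSet A α with hC
  let M : Matrix C C ℝ := (block A α).map (fun k : ℕ => (k : ℝ))
  have hM : ∀ i j, 0 ≤ M i j := fun i j => Nat.cast_nonneg _
  have hMp : ∃ k, ∀ i j, 0 < (M ^ k) i j := by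
    obtain ⟨k, hk⟩ := exists_pow_block_pos hprim hα
    refine ⟨k, fun i j => ?_⟩
    have : M ^ k = (block A α ^ k).map (Nat.castRingHom ℝ) := by
      rw [Matrix.map_pow]; rfl
    rw [this]
    exact Nat.cast_pos.2 (hk i j)
  have hfin : ∀ n, ∀ i ∈ C, massVec lab C μ n i ≠ ∞ := fun n i hi =>
    ((hst.massVec_le hα hμ n hi).trans_lt htop.lt_top).ne
  let p : ℕ → C → ℝ := fun n i => (massVec lab C μ n i).toReal
  have hp0 : ∀ n i, 0 ≤ p n i := fun n i => ENNReal.toReal_nonneg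
  have hp : ∀ n, p n = M.mulVec (p (n + 1)) := fun n => by
    funext i
    change (massVec lab C μ n i).toReal = ∑ j, M i j * p (n + 1) j
    rw [hst.massVec_eq_sum hμ n i.2, ← sum_classSet C, ENNReal.toReal_sum]
    · refine Finset.sum_congr rfl fun j _ => ?_
      rw [ENNReal.toReal_mul, ENNReal.toReal_natCast]
      rfl
    · exact fun j _ => ENNReal.mul_ne_top (ENNReal.natCast_ne_top _) (hfin _ _ j.2)
  obtain ⟨i₁, hi₁, hne⟩ := exists_massVec_ne_zero hμ h0
  have : Nonempty C := ⟨⟨i₁, hi₁⟩⟩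
  -- One vanishing mass would, by positivity of `M ^ k`, annihilate the whole level `n + k` and with
  -- it level `0`.
  have hpos : ∀ n i, 0 < p n i := by
    intro n i
    refine (hp0 n i).lt_of_ne fun h => hne ?_
    obtain ⟨k, hk⟩ := hMp
    have h1 := congrFun (mulVec_pow_iterate hp n k) i
    rw [← h] at h1
    have h2 := (Finset.sum_eq_zero_iff_of_nonneg fun j _ =>
      mul_nonneg (hk i j).le (hp0 (n + k) j)).1 h1.symm
    have h3 : p (n + k) = 0 := funext fun j =>
      (mul_eq_zero.1 (h2 j (Finset.mem_univ j))).resolve_left (hk i j).ne'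
    have h4 := mulVec_pow_iterate hp 0 (n + k)
    rw [zero_add, h3, Matrix.mulVec_zero] at h4
    have h5 : (massVec lab C μ 0 i₁).toReal = 0 := congrFun h4 ⟨i₁, hi₁⟩
    exact ((ENNReal.toReal_eq_zero_iff _).1 h5).resolve_right (hfin 0 i₁ hi₁)
  obtain ⟨l, hl, heig, hgeo⟩ := exists_eigenvector_of_backward hM hMp hpos hp
  refine ⟨fun i => (massVec lab C μ 0 i).toReal, l, hl, fun i hi => hpos 0 ⟨i, hi⟩,
    fun i hi => ?_, fun n i hi => ?_⟩
  · rw [← heig ⟨i, hi⟩, ← sum_classSet C (fun j => (A i j : ℝ))]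
    rfl
  · have := hgeo n ⟨i, hi⟩
    rw [← this, ENNReal.ofReal_toReal (hfin n i hi)]

end BratteliDiagram

theorem PartialInvariant.restrict_saturated {X : Type*} [MeasurableSpace X] [StandardBorelSpace X]
    {r : Setoid X} {μ : Measure X} (h : PartialInvariant r univ μ) {S : Set X}
    (hS : MeasurableSet S) (hsat : ∀ x y, r x y → x ∈ S → y ∈ S) :
    PartialInvariant r univ (μ.restrict S) := by
  intro f T hf hT hi _ _ hr
  rw [Measure.restrict_apply (hT.image_of_measurable_injOn hf hi), Measure.restrict_apply hT]
  have : f '' T ∩ S = f '' (T ∩ S) := by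
    ext y
    constructor
    · rintro ⟨⟨x, hx, rfl⟩, hy⟩
      exact ⟨x, ⟨hx, hsat _ _ (r.symm (hr x hx)) hy⟩, rfl⟩
    · rintro ⟨x, hx, rfl⟩
      exact ⟨⟨x, hx.1, rfl⟩, hsat _ _ (hr x hx.1) hx.2⟩
  rw [this]
  exact h f _ hf (hT.inter hS) (hi.mono inter_subset_left) (subset_univ _) (subset_univ _)
    fun x hx => hr x hx.1

/-! ### Normalized extensions: existence, uniqueness, finiteness, ergodicity -/

namespace BratteliDiagram

open NonnegMatrix

variable {B : BratteliDiagram.{u, v}} {ι : Type w} {lab : ∀ n, ι ≃ B.V (n + 1)}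
  {A : Matrix ι ι ℕ} {α : ReducedVertex A}

/-- The tail invariant measures which are carried by the saturation of the path space of a
subdiagram, and which give unit mass to this path space. -/
structure IsNormalizedExtension (lab : ∀ n, ι ≃ B.V (n + 1)) (C : Set ι)
    (μ : Measure B.PathSpace) : Prop where
  invariant : PartialInvariant B.tail univ μ
  null_compl : μ (B.saturation lab C)ᶜ = 0
  mass : μ (B.subPaths lab C) = 1

theorem exists_extension (lab : ∀ n, ι ≃ B.V (n + 1)) (C : Set ι) {ν : Measure B.PathSpace}
    (hν : PartialInvariant B.tail (B.subPaths lab C) ν) :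
    ∃ μ : Measure B.PathSpace, PartialInvariant B.tail univ μ ∧ μ (B.saturation lab C)ᶜ = 0 ∧
      ∀ T, MeasurableSet T → T ⊆ B.subPaths lab C → μ T = ν T := by
  obtain ⟨D, G, hG, -⟩ := exists_generatedBy_tail B
  have hY := measurableSet_subPaths (B := B) lab C
  exact ⟨satExtension D G (B.subPaths lab C) ν, hG.partialInvariant_satExtension hY hν,
    hG.satExtension_compl hY, fun T hT hTY => hG.satExtension_apply_of_subset hY hν hT hTY⟩

theorem ext_of_subPaths {C : Set ι} {μ μ' : Measure B.PathSpace}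
    (hμ : PartialInvariant B.tail univ μ) (hμ' : PartialInvariant B.tail univ μ')
    (h0 : μ (B.saturation lab C)ᶜ = 0) (h0' : μ' (B.saturation lab C)ᶜ = 0)
    (h : ∀ T, MeasurableSet T → T ⊆ B.subPaths lab C → μ T = μ' T) : μ = μ' := by
  obtain ⟨D, G, hG, -⟩ := exists_generatedBy_tail B
  exact hG.ext_of_partialInvariant (measurableSet_subPaths lab C) hμ hμ' h0 h0' h

theorem measure_eq_zero_of_saturated {C : Set ι} {μ : Measure B.PathSpace}
    (hμ : PartialInvariant B.tail univ μ) (h0 : μ (B.saturation lab C)ᶜ = 0)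
    {S : Set B.PathSpace} (hS : MeasurableSet S) (hsat : ∀ x y, B.tail x y → x ∈ S → y ∈ S)
    (h : μ (S ∩ B.subPaths lab C) = 0) : μ S = 0 := by
  obtain ⟨D, G, hG, -⟩ := exists_generatedBy_tail B
  exact hG.measure_saturated_eq_zero (measurableSet_subPaths lab C) hμ h0 hS hsat h

theorem IsNormalizedExtension.sigmaFinite {C : Set ι} {μ : Measure B.PathSpace}
    (h : IsNormalizedExtension lab C μ) : SigmaFinite μ := by
  obtain ⟨D, G, hG, -⟩ := exists_generatedBy_tail B
  exact hG.sigmaFinite (measurableSet_subPaths lab C) h.invariant h.null_compl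
    (by rw [h.mass]; exact ENNReal.one_ne_top)

theorem isFiniteMeasure_of_cyl {μ : Measure B.PathSpace} (n : ℕ) (h : ∀ x, μ (cyl x n) < ∞) :
    IsFiniteMeasure μ := by
  have : IsLocallyFiniteMeasure μ :=
    ⟨fun x => ⟨cyl x n, (isOpen_cyl x n).mem_nhds (mem_cyl_self x n), h x⟩⟩
  exact ⟨isCompact_univ.measure_lt_top⟩

section

variable (hst : B.IsStationary lab A.transpose) (hα : block A α ≠ 0)
include hst hα

theorem IsStationary.exists_isNormalizedExtension :
    ∃ μ : Measure B.PathSpace, IsNormalizedExtension lab (classSet A α) μ := by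
  obtain ⟨i, hi, -⟩ := exists_pos_of_block_ne_zero hα
  obtain ⟨x, hx, -⟩ := hst.exists_mem_subPaths_class hα 0 hi
  obtain ⟨ν, hν, hν0, hνi⟩ := exists_partialInvariant (isClosed_subPaths lab (classSet A α))
    ⟨x, hx⟩ fun x hx y hy n h => splice_mem_subPaths hx hy n h
  obtain ⟨μ, h1, h2, h3⟩ := exists_extension lab _ hνi
  refine ⟨μ, h1, h2, ?_⟩
  rw [h3 _ (measurableSet_subPaths lab _) subset_rfl]
  exact (prob_compl_eq_zero_iff (measurableSet_subPaths lab _)).1 hν0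

theorem IsStationary.saturation_class :
    B.saturation lab (classSet A α) = ⋃ n, tailSet lab (classSet A α) n :=
  hst.saturation_eq (exists_succ_of_block_ne_zero hα) (exists_pred_of_block_ne_zero hα)

theorem IsStationary.disjoint_saturation {β : ReducedVertex A} (hβ : block A β ≠ 0) (hne : α ≠ β) :
    Disjoint (B.saturation lab (classSet A α)) (B.saturation lab (classSet A β)) := by
  rw [hst.saturation_class hα, hst.saturation_class hβ]
  refine disjoint_left.2 fun x hx hx' => hne ?_
  obtain ⟨n, hn⟩ := mem_iUnion.1 hx
  obtain ⟨m, hm⟩ := mem_iUnion.1 hx'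
  exact Eq.trans (Eq.symm (hn (max n m) (le_max_left _ _))) (hm (max n m) (le_max_right _ _))

end

variable [Fintype ι]

/-- A zero block has eigenvalue zero with the constant vector; for the others the eigenvector comes
from a measure on `Y_α`, whose existence rests on compactness only. -/
theorem IsStationary.exists_isBlockEigenvector (hst : B.IsStationary lab A.transpose)
    (hprim : PrimitiveBlocks A.transpose) :
    ∃ (η : ι → ℝ) (ρ : ReducedVertex A → ℝ), IsBlockEigenvector A η ρ ∧
      (∀ β, classRadius A β = ENNReal.ofReal (ρ β)) ∧ ∀ β, block A β ≠ 0 → 0 < ρ β := by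
  classical
  have hclass : ∀ β : ReducedVertex A, ∃ (η : ι → ℝ) (ρ : ℝ), 0 ≤ ρ ∧
      (∀ i ∈ classSet A β, 0 < η i) ∧ (∀ i ∈ classSet A β,
        ∑ j, (A i j : ℝ) * (if j ∈ classSet A β then η j else 0) = ρ * η i) ∧
      (block A β ≠ 0 → 0 < ρ) := by
    intro β
    by_cases hβ : block A β = 0
    · refine ⟨fun _ => 1, 0, le_rfl, fun _ _ => one_pos, fun i hi => ?_, fun h => (h hβ).elim⟩
      rw [zero_mul]
      refine Finset.sum_eq_zero fun j _ => ?_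
      split_ifs with hj
      · have : A i j = 0 := congrFun (congrFun hβ ⟨i, hi⟩) ⟨j, hj⟩
        simp [this]
      · simp
    · obtain ⟨μ, hμ⟩ := hst.exists_isNormalizedExtension hβ
      obtain ⟨η, ρ, hρ, hη, heig, -⟩ := hst.exists_eigenvector hprim hβ hμ.invariant
        (by rw [hμ.mass]; exact one_ne_zero) (by rw [hμ.mass]; exact ENNReal.one_ne_top)
      exact ⟨η, ρ, hρ.le, hη, heig, fun _ => hρ⟩
  choose η ρ hρ hη heig hpos using hclass
  refine ⟨fun i => η (cls A i) i, ρ, ⟨fun i => hη _ i rfl, hρ, fun i => ?_⟩,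
    fun β => classRadius_eq_of_pos_eigenvector (hη β) (hρ β) (heig β), hpos⟩
  rw [← heig (cls A i) i rfl]
  refine Finset.sum_congr rfl fun j _ => ?_
  congr 1
  by_cases h : cls A j = cls A i
  · have h' : j ∈ classSet A (cls A i) := h
    rw [if_pos h, if_pos h', h]
  · have h' : j ∉ classSet A (cls A i) := h
    rw [if_neg h, if_neg h']

section

variable (hst : B.IsStationary lab A.transpose) (hprim : PrimitiveBlocks A.transpose)
  {η : ι → ℝ} {ρ : ReducedVertex A → ℝ} (hη : IsBlockEigenvector A η ρ)
  (hρ : ∀ β, classRadius A β = ENNReal.ofReal (ρ β)) (hα : block A α ≠ 0)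
include hst hprim hη hρ hα

/-- The masses of the cylinders are determined up to a constant. -/
theorem IsStationary.exists_massVec_eq {μ : Measure B.PathSpace}
    (hμ : IsNormalizedExtension lab (classSet A α) μ) :
    ∃ t > 0, ∀ n, ∀ i ∈ classSet A α,
      massVec lab (classSet A α) μ n i = ENNReal.ofReal (t * (η i / ρ α ^ n)) := by
  classical
  obtain ⟨ξ, l, hl, hξ, heig, hmass⟩ := hst.exists_eigenvector hprim hα hμ.invariant
    (by rw [hμ.mass]; exact one_ne_zero) (by rw [hμ.mass]; exact ENNReal.one_ne_top)
  have hlρ : l = ρ α := by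
    have := classRadius_eq_of_pos_eigenvector hξ hl.le heig
    rw [hρ, ENNReal.ofReal_eq_ofReal_iff (hη.nonneg α) hl.le] at this
    exact this.symm
  set C := classSet A α with hC
  let M : Matrix C C ℝ := (block A α).map (fun k : ℕ => (k : ℝ))
  have hM : ∀ i j, 0 ≤ M i j := fun i j => Nat.cast_nonneg _
  have hMp : ∃ k, ∀ i j, 0 < (M ^ k) i j := by
    obtain ⟨k, hk⟩ := exists_pow_block_pos hprim hα
    refine ⟨k, fun i j => ?_⟩
    have : M ^ k = (block A α ^ k).map (Nat.castRingHom ℝ) := by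
      rw [Matrix.map_pow]; rfl
    rw [this]
    exact Nat.cast_pos.2 (hk i j)
  have hback : ∀ ζ : ι → ℝ, (∀ i ∈ C, ∑ j, (A i j : ℝ) * (if j ∈ C then ζ j else 0) = l * ζ i) →
      ∀ n, (fun i : C => ζ i / l ^ n) = M.mulVec (fun i : C => ζ i / l ^ (n + 1)) := by
    intro ζ hζ n
    funext i
    change ζ i / l ^ n = ∑ j, M i j * (ζ j / l ^ (n + 1))
    have h1 : ∑ j, M i j * ζ j = l * ζ i := by
      rw [← hζ i i.2, ← sum_classSet C (fun j => (A i j : ℝ))]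
      rfl
    have h2 : ∑ j, M i j * (ζ j / l ^ (n + 1)) = (∑ j, M i j * ζ j) / l ^ (n + 1) := by
      rw [Finset.sum_div]
      exact Finset.sum_congr rfl fun j _ => by ring
    rw [h2, h1, pow_succ]
    field_simp
  have hηC : ∀ i ∈ C, ∑ j, (A i j : ℝ) * (if j ∈ C then η j else 0) = l * η i := by
    intro i hi
    have h1 := hη.eigen i
    rw [show cls A i = α from hi, ← hlρ] at h1
    convert h1
    exact Iff.rfl
  -- Both eigenvectors give backward orbits with the same ratio `l`, so they lie on one ray.
  obtain ⟨t, ht0, ht⟩ := exists_eq_mul_of_backward hM hMp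
    (p := fun n (i : C) => ξ i / l ^ n) (q := fun n (i : C) => η i / l ^ n)
    (fun n i => (div_pos (hξ i i.2) (pow_pos hl n)).le)
    (fun n i => div_pos (hη.pos i) (pow_pos hl n)) (hback ξ heig) (hback η hηC)
  obtain ⟨i, hi, -⟩ := exists_pos_of_block_ne_zero hα
  refine ⟨t, ht0.lt_of_ne fun h => ?_, fun n i hi => ?_⟩
  · have := ht 0 ⟨i, hi⟩
    rw [← h, zero_mul, pow_zero, div_one] at this
    exact (hξ i hi).ne' this
  · rw [hmass n i hi, ← hlρ]
    exact congrArg _ (ht n ⟨i, hi⟩)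

omit hprim hρ hα in
-- Here `k` counts the free steps before the path must be in `α`; splitting along the next edge
-- turns each of them into one application of `A`.
theorem IsStationary.measure_cyl_inter_tailSet_add {μ : Measure B.PathSpace}
    (hμ : PartialInvariant B.tail univ μ) {t : ℝ} (ht : 0 < t)
    (hmass : ∀ n, ∀ i ∈ classSet A α,
      massVec lab (classSet A α) μ n i = ENNReal.ofReal (t * (η i / ρ α ^ n)))
    (k n : ℕ) (x : B.PathSpace) :
    μ (cyl x n ∩ tailSet lab (classSet A α) (n + k))
      = ENNReal.ofReal (t * (classOrbit A α η k (lbl lab x n) / ρ α ^ (n + k))) := by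
  classical
  induction k generalizing n x with
  | zero =>
    rw [add_zero]
    by_cases hx : lbl lab x n ∈ classSet A α
    · have horb : classOrbit A α η 0 (lbl lab x n) = η (lbl lab x n) := if_pos hx
      rw [measure_cyl_inter_tailSet hμ, hmass n _ hx, horb]
    · have horb : classOrbit A α η 0 (lbl lab x n) = 0 := if_neg hx
      rw [horb, zero_div, mul_zero, ENNReal.ofReal_zero]
      convert measure_empty (μ := μ)
      refine eq_empty_of_forall_notMem fun z hz => hx ?_
      rw [← lbl_of_mem_cyl hz.1 le_rfl]
      exact hz.2 n le_rfl
  | succ k ih =>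
    rw [show n + (k + 1) = n + 1 + k by ring]
    rw [hst.measure_cyl_inter (measurableSet_tailSet lab _ _)
      (fun j => ENNReal.ofReal (t * (classOrbit A α η k j / ρ α ^ (n + 1 + k))))
      fun y _ => ih (n + 1) y]
    have h0 : ∀ j, 0 ≤ t * (classOrbit A α η k j / ρ α ^ (n + 1 + k)) := fun j =>
      mul_nonneg ht.le (div_nonneg (classOrbit_nonneg hη k j) (pow_nonneg (hη.nonneg α) _))
    have h1 : ∀ j, (A (lbl lab x n) j : ℝ≥0∞) *
        ENNReal.ofReal (t * (classOrbit A α η k j / ρ α ^ (n + 1 + k)))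
        = ENNReal.ofReal ((A (lbl lab x n) j : ℝ) *
          (t * (classOrbit A α η k j / ρ α ^ (n + 1 + k)))) := fun j => by
      rw [ENNReal.ofReal_mul (Nat.cast_nonneg _), ENNReal.ofReal_natCast]
    simp only [h1]
    rw [← ENNReal.ofReal_sum_of_nonneg fun j _ => mul_nonneg (Nat.cast_nonneg _) (h0 j)]
    congr 1
    rw [classOrbit, Finset.sum_div, Finset.mul_sum]
    exact Finset.sum_congr rfl fun j _ => by ring

/-- The extension is finite if and only if the class is distinguished. -/
theorem IsStationary.isFiniteMeasure_iff (hpos : 0 < ρ α) {μ : Measure B.PathSpace}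
    (hμ : IsNormalizedExtension lab (classSet A α) μ) :
    μ univ < ∞ ↔ Distinguished A α := by
  obtain ⟨t, ht, hmass⟩ := hst.exists_massVec_eq hprim hη hρ hα hμ
  have hform := hst.measure_cyl_inter_tailSet_add hη hμ.invariant ht hmass
  have hdist : Distinguished A α ↔ ∀ β ≠ α, ClassAccess A β α → ρ β < ρ α := by
    unfold Distinguished
    simp only [hρ, ENNReal.ofReal_lt_ofReal_iff hpos]
  rw [hdist]
  constructor
  · intro hfin β hβ hacc
    refine lt_of_classOrbit_le hη hpos ⟨(μ univ).toReal / t, fun N i => ?_⟩ hβ hacc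
    obtain ⟨x, hx⟩ := exists_lbl_eq (B := B) lab 0 i
    have h1 : ENNReal.ofReal (t * (classOrbit A α η N i / ρ α ^ N)) ≤ μ univ := by
      have := hform N 0 x
      rw [hx, zero_add] at this
      rw [← this]
      exact measure_mono (subset_univ _)
    rw [ENNReal.ofReal_le_iff_le_toReal hfin.ne] at h1
    rw [← div_le_iff₀ (pow_pos hpos N), le_div_iff₀ ht, mul_comm]
    exact h1
  · intro hlt
    obtain ⟨K, hK⟩ := exists_classOrbit_le hη hlt
    -- By compactness the first cylinders suffice. Up to a null set each is an increasing union over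
    -- `k`, with masses bounded by `t * K`.
    have hcyl : ∀ x : B.PathSpace, μ (cyl x 0) < ∞ := by
      intro x
      have h1 : μ (cyl x 0) ≤ μ (⋃ k, cyl x 0 ∩ tailSet lab (classSet A α) k) := by
        rw [← inter_iUnion, ← hst.saturation_class hα]
        have hsub : cyl x 0 ⊆ cyl x 0 ∩ B.saturation lab (classSet A α) ∪
            (B.saturation lab (classSet A α))ᶜ := by
          intro z hz
          by_cases h : z ∈ B.saturation lab (classSet A α)
          · exact Or.inl ⟨hz, h⟩
          · exact Or.inr h
        exact (measure_mono hsub).trans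
            ((measure_union_le _ _).trans_eq (by rw [hμ.null_compl, add_zero]))
      refine h1.trans_lt ?_
      rw [Monotone.measure_iUnion fun m n hmn =>
        inter_subset_inter_right _ (monotone_tailSet lab _ hmn)]
      refine (iSup_le fun k => ?_).trans_lt (ENNReal.ofReal_lt_top (r := t * K))
      have := hform k 0 x
      rw [zero_add] at this
      rw [this]
      refine ENNReal.ofReal_le_ofReal (mul_le_mul_of_nonneg_left ?_ ht.le)
      rw [div_le_iff₀ (pow_pos hpos k)]
      exact hK k _
    have := isFiniteMeasure_of_cyl 0 hcyl
    exact measure_lt_top μ univ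

/-- On `Y_α` the cylinder masses are those of the Perron eigenvector up to factors `t` and `s`,
which the normalization forces to agree; outside `Y_α`, invariance decides. -/
theorem IsStationary.isNormalizedExtension_unique {μ μ' : Measure B.PathSpace}
    (hμ : IsNormalizedExtension lab (classSet A α) μ)
    (hμ' : IsNormalizedExtension lab (classSet A α) μ') : μ = μ' := by
  classical
  obtain ⟨t, ht, hmass⟩ := hst.exists_massVec_eq hprim hη hρ hα hμ
  obtain ⟨s, hs, hmass'⟩ := hst.exists_massVec_eq hprim hη hρ hα hμ'
  have hfin : IsFiniteMeasure (μ.restrict (B.subPaths lab (classSet A α))) :=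
    ⟨by simp [hμ.mass]⟩
  have hcyl : ∀ (τ : Measure B.PathSpace) (x : B.PathSpace) (n : ℕ),
      (PartialInvariant B.tail univ τ) → τ.restrict (B.subPaths lab (classSet A α)) (cyl x n) =
      (if ∀ k ≤ n, lbl lab x k ∈ classSet A α then
        massVec lab (classSet A α) τ n (lbl lab x n) else 0) := by
    intro τ x n hτ
    rw [Measure.restrict_apply (measurableSet_cyl x n)]
    split_ifs with h
    · rw [← measure_cyl_inter_tailSet hτ]
      congr 1
      ext z
      refine and_congr_right fun hz => ⟨fun hzY k _ => hzY k, fun hzt k => ?_⟩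
      rcases le_total k n with hk | hk
      · change lbl lab z k ∈ _
        rw [lbl_of_mem_cyl hz hk]; exact h k hk
      · exact hzt k hk
    · convert measure_empty (μ := τ)
      refine eq_empty_of_forall_notMem fun z hz => h fun k hk => ?_
      rw [← lbl_of_mem_cyl hz.1 hk]
      exact hz.2 k
  have key : ENNReal.ofReal s • μ.restrict (B.subPaths lab (classSet A α))
      = ENNReal.ofReal t • μ'.restrict (B.subPaths lab (classSet A α)) := by
    have : IsFiniteMeasure (ENNReal.ofReal s • μ.restrict (B.subPaths lab (classSet A α))) :=
      Measure.smul_finite _ ENNReal.ofReal_ne_top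
    refine ext_of_cyl 0 fun x n _ => ?_
    rw [Measure.smul_apply, Measure.smul_apply, hcyl μ x n hμ.invariant,
      hcyl μ' x n hμ'.invariant]
    split_ifs with h
    · rw [hmass n _ (h n le_rfl), hmass' n _ (h n le_rfl), smul_eq_mul, smul_eq_mul,
        ENNReal.ofReal_mul ht.le, ENNReal.ofReal_mul hs.le, mul_left_comm]
    · simp
  have hst' : ENNReal.ofReal s = ENNReal.ofReal t := by
    have := congrArg (fun m => m univ) key
    simpa [hμ.mass, hμ'.mass] using this
  refine ext_of_subPaths hμ.invariant hμ'.invariant hμ.null_compl hμ'.null_compl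
    fun T hT hTY => ?_
  have := congrArg (fun m => m T) key
  simp only [Measure.smul_apply, Measure.restrict_apply hT, inter_eq_left.2 hTY, hst',
    smul_eq_mul] at this
  exact (ENNReal.mul_right_inj (ENNReal.ofReal_pos.2 ht).ne' ENNReal.ofReal_ne_top).1 this

/-- Uniqueness implies ergodicity: the restriction to a saturated set charging `Y_α`, once
normalized, must be `μ` itself. -/
theorem IsStationary.relErgodic {μ : Measure B.PathSpace}
    (hμ : IsNormalizedExtension lab (classSet A α) μ) : RelErgodic B.tail μ := by
  intro S hS hsat
  by_cases h0 : μ (S ∩ B.subPaths lab (classSet A α)) = 0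
  · exact Or.inl (measure_eq_zero_of_saturated hμ.invariant hμ.null_compl hS hsat h0)
  right
  set c := μ (S ∩ B.subPaths lab (classSet A α)) with hc
  have hctop : c ≠ ∞ := ((measure_mono inter_subset_right).trans_lt
    (by rw [hμ.mass]; exact ENNReal.one_lt_top)).ne
  have hext : IsNormalizedExtension lab (classSet A α) (c⁻¹ • μ.restrict S) := by
    refine ⟨(hμ.invariant.restrict_saturated hS hsat).smul _, ?_, ?_⟩
    · rw [Measure.smul_apply, Measure.absolutelyContinuous_of_le Measure.restrict_le_self
        hμ.null_compl, smul_zero]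
    · rw [Measure.smul_apply, Measure.restrict_apply (measurableSet_subPaths lab _), inter_comm,
        smul_eq_mul, ENNReal.inv_mul_cancel h0 hctop]
  rw [hst.isNormalizedExtension_unique hprim hη hρ hα hμ hext]
  rw [Measure.smul_apply, Measure.restrict_apply hS.compl]
  simp

end

end BratteliDiagram

namespace BratteliDiagram

open NonnegMatrix

variable {B : BratteliDiagram.{u, v}} {ι : Type w} {lab : ∀ n, ι ≃ B.V (n + 1)}
  {A : Matrix ι ι ℕ} {α : ReducedVertex A}

/-! ### Atoms -/

/-- With a single loop available at each level, a path is determined by its first edge. -/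
theorem IsStationary.finite_subPaths_of_isUnitBlock (hst : B.IsStationary lab A.transpose)
    (h : IsUnitBlock A α) : (B.subPaths lab (classSet A α)).Finite := by
  obtain ⟨i, hset, hii⟩ := h
  have := B.finite_E 0
  refine Set.Finite.of_injOn (f := fun x => x.1 0) (t := univ) (fun _ _ => mem_univ _) ?_
    finite_univ
  intro x hx y hy hxy
  refine ext_path fun n => ?_
  have hi : ∀ z ∈ B.subPaths lab (classSet A α), ∀ n, lbl lab z n = i := fun z hz n => by
    have : lbl lab z n ∈ classSet A α := hz n
    rwa [hset] at this
  induction n with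
  | zero => exact hxy
  | succ n ih =>
    have hcard := hst.card_edges n i i
    rw [hii, Nat.card_eq_one_iff_unique] at hcard
    have := hcard.1
    have hmem : ∀ z ∈ B.subPaths lab (classSet A α),
        B.rng (n + 1) (z.1 (n + 1)) = lab (n + 1) i ∧ B.src (n + 1) (z.1 (n + 1)) = lab n i :=
      fun z hz => by
        refine ⟨((lab (n + 1)).symm_apply_eq).1 (hi z hz (n + 1)), ?_⟩
        rw [← z.2 n]
        exact ((lab n).symm_apply_eq).1 (hi z hz n)
    exact congrArg Subtype.val (Subsingleton.elim
      (⟨x.1 (n + 1), hmem x hx⟩ : {e : B.E (n + 1) // B.rng (n + 1) e = lab (n + 1) i ∧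
        B.src (n + 1) e = lab n i}) ⟨y.1 (n + 1), hmem y hy⟩)

/-- For the block `[1]` a finite set has mass one. Otherwise `ρ α > 1`, and the cylinder pieces
shrinking to a point of `X_α` have mass `O(ρ α ^ (-n))`. -/
theorem IsStationary.measure_singleton_eq_zero_iff [Fintype ι]
    (hst : B.IsStationary lab A.transpose)
    (hprim : PrimitiveBlocks A.transpose) {η : ι → ℝ} {ρ : ReducedVertex A → ℝ}
    (hη : IsBlockEigenvector A η ρ) (hρ : ∀ β, classRadius A β = ENNReal.ofReal (ρ β))
    (hα : block A α ≠ 0) (hpos : 0 < ρ α) {μ : Measure B.PathSpace}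
    (hμ : IsNormalizedExtension lab (classSet A α) μ) :
    (∀ x, μ {x} = 0) ↔ ¬ IsUnitBlock A α := by
  classical
  constructor
  · intro h hunit
    have hfin := hst.finite_subPaths_of_isUnitBlock hunit
    have h0 : μ (B.subPaths lab (classSet A α)) = 0 := by
      rw [← biUnion_of_singleton (B.subPaths lab (classSet A α))]
      exact (measure_biUnion_null_iff hfin.countable).2 fun x _ => h x
    rw [hμ.mass] at h0
    exact one_ne_zero h0
  · intro hunit x
    have hone : 1 < ρ α := by
      by_contra! hle
      obtain ⟨hsub, hdiag⟩ := subsingleton_of_eigenvalue_le_one (block A α)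
        (exists_pow_block_pos hprim hα) (η := fun i => η i) (fun i => hη.pos i) hpos hle
        fun i => by
          have h1 := hη.eigen i
          rw [show cls A i = α from i.2] at h1
          rw [← h1]
          refine (sum_classSet (classSet A α) (fun j => (A i j : ℝ)) η).trans ?_
          refine Finset.sum_congr rfl fun j _ => ?_
          congr 1
          exact if_congr Iff.rfl rfl rfl
      obtain ⟨i, hi, -⟩ := exists_pos_of_block_ne_zero hα
      refine hunit ⟨i, ?_, hdiag ⟨i, hi⟩⟩
      ext j
      refine ⟨fun hj => congrArg Subtype.val (hsub.elim ⟨j, hj⟩ ⟨i, hi⟩), fun hj => ?_⟩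
      rw [mem_singleton_iff.1 hj]; exact hi
    by_cases hx : x ∈ B.saturation lab (classSet A α)
    swap
    · exact measure_mono_null (singleton_subset_iff.2 hx) hμ.null_compl
    rw [hst.saturation_class hα] at hx
    obtain ⟨m, hm⟩ := mem_iUnion.1 hx
    obtain ⟨t, ht, hmass⟩ := hst.exists_massVec_eq hprim hη hρ hα hμ
    have hle : ∀ n ≥ m, μ {x} ≤ ENNReal.ofReal (t * ((∑ i, η i) / ρ α ^ n)) := by
      intro n hn
      have hxn : lbl lab x n ∈ classSet A α := hm n hn
      calc μ {x} ≤ μ (cyl x n ∩ tailSet lab (classSet A α) n) :=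
            measure_mono (singleton_subset_iff.2
              ⟨mem_cyl_self x n, monotone_tailSet lab _ hn hm⟩)
        _ = ENNReal.ofReal (t * (η (lbl lab x n) / ρ α ^ n)) := by
            rw [measure_cyl_inter_tailSet hμ.invariant, hmass n _ hxn]
        _ ≤ _ := by
            refine ENNReal.ofReal_le_ofReal (mul_le_mul_of_nonneg_left ?_ ht.le)
            exact div_le_div_of_nonneg_right (Finset.single_le_sum
              (fun j _ => (hη.pos j).le) (Finset.mem_univ _)) (pow_nonneg hpos.le n)
    have hlim : Filter.Tendsto (fun n : ℕ => ENNReal.ofReal (t * ((∑ i, η i) / ρ α ^ n)))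
        Filter.atTop (nhds 0) := by
      rw [← ENNReal.ofReal_zero]
      refine ENNReal.tendsto_ofReal ?_
      rw [← mul_zero t]
      exact ((tendsto_pow_atTop_atTop_of_one_lt hone).const_div_atTop _).const_mul t
    refine le_antisymm (ge_of_tendsto hlim ?_) zero_le
    filter_upwards [Filter.eventually_ge_atTop m] with n hn using hle n hn

/-! ### Open sets of finite measure -/

/-- A path starting in `α` cannot leave the class and return, so up to a null set the first cylinder
at a vertex of `α` consists of paths that stay in `α`. -/
theorem IsStationary.exists_open [Fintype ι] (hst : B.IsStationary lab A.transpose)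
    (hprim : PrimitiveBlocks A.transpose) {η : ι → ℝ} {ρ : ReducedVertex A → ℝ}
    (hη : IsBlockEigenvector A η ρ) (hρ : ∀ β, classRadius A β = ENNReal.ofReal (ρ β))
    (hα : block A α ≠ 0) {μ : Measure B.PathSpace}
    (hμ : IsNormalizedExtension lab (classSet A α) μ) :
    ∃ U : Set B.PathSpace, IsOpen U ∧ 0 < μ U ∧ μ U < ∞ := by
  obtain ⟨t, ht, hmass⟩ := hst.exists_massVec_eq hprim hη hρ hα hμ
  obtain ⟨i, hi, -⟩ := exists_pos_of_block_ne_zero hα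
  obtain ⟨x, hx⟩ := exists_lbl_eq (B := B) lab 0 i
  have hle : μ (cyl x 0) = μ (cyl x 0 ∩ tailSet lab (classSet A α) 0) := by
    refine le_antisymm ?_ (measure_mono inter_subset_left)
    have hsub : cyl x 0 ⊆ cyl x 0 ∩ tailSet lab (classSet A α) 0 ∪
        (B.saturation lab (classSet A α))ᶜ := by
      intro z hz
      by_cases h : z ∈ B.saturation lab (classSet A α)
      · rw [hst.saturation_class hα] at h
        obtain ⟨n, hn⟩ := mem_iUnion.1 h
        refine Or.inl ⟨hz, fun k _ => ?_⟩
        have hz0 : lbl lab z 0 ∈ classSet A α := by rw [lbl_of_mem_cyl hz le_rfl, hx]; exact hi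
        exact mem_classSet_of_access hz0 (hn (max n k) (le_max_left _ _))
          (hst.access_lbl z (Nat.zero_le k)) (hst.access_lbl z (le_max_right n k))
      · exact Or.inr h
    exact (measure_mono hsub).trans
      ((measure_union_le _ _).trans_eq (by rw [hμ.null_compl, add_zero]))
  rw [measure_cyl_inter_tailSet hμ.invariant, hx, hmass 0 i hi] at hle
  refine ⟨cyl x 0, isOpen_cyl x 0, ?_, ?_⟩
  · rw [hle, ENNReal.ofReal_pos, pow_zero, div_one]
    exact mul_pos ht (hη.pos i)
  · rw [hle]; exact ENNReal.ofReal_lt_top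

/-! ### Ergodic measures -/

/-- From a level where the height is minimal along the path, the class can no longer change. -/
theorem IsStationary.exists_mem_tailSet [Fintype ι] (hst : B.IsStationary lab A.transpose)
    (x : B.PathSpace) : ∃ α n, x ∈ tailSet lab (classSet A α) n := by
  let f : ℕ → ℕ := fun k => {l | Access A (lbl lab x k) l}.ncard
  let n := Function.argmin f
  have hcls : ∀ k ≥ n, cls A (lbl lab x k) = cls A (lbl lab x n) ∧ f k = f n := by
    intro k hk
    induction k, hk using Nat.le_induction with
    | base => exact ⟨rfl, rfl⟩
    | succ k _ ih =>
      have heq : cls A (lbl lab x (k + 1)) = cls A (lbl lab x k) := by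
        by_contra h
        have h1 : f (k + 1) < f k := ncard_access_lt (hst.pos_lbl_succ x k) h
        have h2 : f n ≤ f (k + 1) := Function.argmin_le f (k + 1)
        omega
      refine ⟨heq.trans ih.1, ?_⟩
      rw [← ih.2]
      obtain ⟨h1, h2⟩ := cls_eq_iff.1 heq
      change {l | _}.ncard = {l | _}.ncard
      congr 1
      ext l
      exact ⟨fun h => h2.trans h, fun h => h1.trans h⟩
  exact ⟨cls A (lbl lab x n), n, fun k hk => (hcls k hk).1⟩

theorem tail_mem_iUnion_tailSet {C : Set ι} {x y : B.PathSpace} (h : B.tail x y)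
    (hx : x ∈ ⋃ n, tailSet lab C n) : y ∈ ⋃ n, tailSet lab C n := by
  obtain ⟨m, hm⟩ := mem_iUnion.1 hx
  obtain ⟨n, hn⟩ := h
  refine mem_iUnion.2 ⟨max m n, fun k hk => ?_⟩
  have : lbl lab y k = lbl lab x k := by
    rw [lbl_eq_iff, hn k ((le_max_right _ _).trans hk)]
  rw [this]
  exact hm k ((le_max_left _ _).trans hk)

/-- Finitely many saturated Borel sets cover `X_B`, and ergodicity selects one. A zero block is
excluded because a path remaining in its class uses arrows inside it. -/
theorem IsStationary.exists_class_of_relErgodic [Fintype ι] (hst : B.IsStationary lab A.transpose)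
    {μ : Measure B.PathSpace} (herg : RelErgodic B.tail μ) (h0 : μ univ ≠ 0) :
    ∃ α : ReducedVertex A, block A α ≠ 0 ∧ μ (B.saturation lab (classSet A α))ᶜ = 0 := by
  have : Finite (ReducedVertex A) := Quotient.finite _
  have hex : ∃ α : ReducedVertex A, μ (⋃ n, tailSet lab (classSet A α) n) ≠ 0 := by
    by_contra! h
    refine h0 (measure_mono_null ?_ (measure_iUnion_null h))
    intro x _
    obtain ⟨α, n, h⟩ := hst.exists_mem_tailSet x
    exact mem_iUnion.2 ⟨α, mem_iUnion.2 ⟨n, h⟩⟩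
  obtain ⟨α, hα⟩ := hex
  have hblock : block A α ≠ 0 := by
    intro hb
    obtain ⟨x, hx⟩ := nonempty_of_measure_ne_zero hα
    obtain ⟨n, hn⟩ := mem_iUnion.1 hx
    have h1 := congrFun (congrFun hb ⟨_, hn n le_rfl⟩) ⟨_, hn (n + 1) n.le_succ⟩
    exact (hst.pos_lbl_succ x n).ne' h1
  refine ⟨α, hblock, ?_⟩
  rw [hst.saturation_class hblock]
  exact (herg _ (MeasurableSet.iUnion fun n => measurableSet_tailSet lab _ n)
    fun x y h hx => tail_mem_iUnion_tailSet h hx).resolve_left hα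

theorem IsStationary.exists_path_of_pow_block_pos [Fintype (classSet A α)]
    [DecidableEq (classSet A α)] (hst : B.IsStationary lab A.transpose) (x : B.PathSpace) (m k : ℕ)
    (i j : classSet A α) (hx : lbl lab x m = i) (h : 0 < (block A α ^ k) i j) :
    ∃ y ∈ cyl x m, lbl lab y (m + k) = j := by
  induction k generalizing j with
  | zero =>
    rw [pow_zero, Matrix.one_apply] at h
    have hij : i = j := by
      by_contra hij
      simp [hij] at h
    exact ⟨x, mem_cyl_self x m, by rw [add_zero, hx, hij]⟩
  | succ k ih =>
    rw [pow_succ, Matrix.mul_apply] at h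
    obtain ⟨l, -, hl⟩ := Finset.exists_ne_zero_of_sum_ne_zero h.ne'
    obtain ⟨y, hy, hyl⟩ := ih l (Nat.pos_of_ne_zero (left_ne_zero_of_mul hl))
    have hlj : 0 < A (lbl lab y (m + k)) j := by
      rw [hyl]; exact Nat.pos_of_ne_zero (right_ne_zero_of_mul hl)
    obtain ⟨z, hz, hzj⟩ := hst.exists_edge hlj
    refine ⟨z, ?_, hzj⟩
    rw [← cyl_eq_of_mem hy]
    exact cyl_anti y (Nat.le_add_right m k) hz

/-- The open set contains a cylinder ending in `α`. By primitivity its continuations reach all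
vertices of `α` on one later level, so by invariance all masses on that level are finite. -/
theorem IsStationary.measure_subPaths_lt_top [Fintype ι] (hst : B.IsStationary lab A.transpose)
    (hprim : PrimitiveBlocks A.transpose) (hα : block A α ≠ 0) {μ : Measure B.PathSpace}
    (hμ : PartialInvariant B.tail univ μ) (h0 : μ (B.saturation lab (classSet A α))ᶜ = 0)
    {U : Set B.PathSpace} (hU : IsOpen U) (hUpos : 0 < μ U) (hUtop : μ U < ∞) :
    μ (B.subPaths lab (classSet A α)) < ∞ := by
  classical
  have hne : (U ∩ B.saturation lab (classSet A α)).Nonempty := by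
    by_contra! h
    exact hUpos.ne' (measure_mono_null
      (subset_compl_iff_disjoint_right.2 (disjoint_iff_inter_eq_empty.2 h)) h0)
  obtain ⟨x, hxU, hxs⟩ := hne
  rw [hst.saturation_class hα] at hxs
  obtain ⟨n, hn⟩ := mem_iUnion.1 hxs
  obtain ⟨_, ⟨y, m, hm, rfl⟩, hxy, hyU⟩ := (isTopologicalBasis_cyl n).exists_subset_of_mem_open
    hxU hU
  rw [← cyl_eq_of_mem hxy] at hyU
  obtain ⟨k, hk⟩ := exists_pow_block_pos hprim hα
  have hxm : lbl lab x m ∈ classSet A α := hn m hm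
  have hfin : ∀ i ∈ classSet A α, massVec lab (classSet A α) μ (m + k) i < ∞ := by
    intro i hi
    obtain ⟨z, hz, rfl⟩ := hst.exists_path_of_pow_block_pos x m k ⟨_, hxm⟩ ⟨i, hi⟩ rfl (hk _ _)
    rw [← measure_cyl_inter_tailSet hμ]
    refine (measure_mono (inter_subset_left.trans (Subset.trans ?_ hyU))).trans_lt hUtop
    rw [← cyl_eq_of_mem hz]
    exact cyl_anti z (Nat.le_add_right m k)
  have hres : IsFiniteMeasure (μ.restrict (B.subPaths lab (classSet A α))) := by
    refine isFiniteMeasure_of_cyl (m + k) fun z => ?_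
    rw [Measure.restrict_apply (measurableSet_cyl z _)]
    by_cases hz : lbl lab z (m + k) ∈ classSet A α
    · have hlt := hfin _ hz
      rw [← measure_cyl_inter_tailSet hμ] at hlt
      have hsub : B.subPaths lab (classSet A α) ⊆ tailSet lab (classSet A α) (m + k) :=
        fun y hy k _ => hy k
      exact (measure_mono (inter_subset_inter_right _ hsub)).trans_lt hlt
    · have : cyl z (m + k) ∩ B.subPaths lab (classSet A α) = ∅ :=
        eq_empty_of_forall_notMem fun y hy => hz (by
          rw [← lbl_of_mem_cyl hy.1 le_rfl]; exact hy.2 _)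
      rw [this, measure_empty]
      exact ENNReal.zero_lt_top
  have := measure_lt_top (μ.restrict (B.subPaths lab (classSet A α))) univ
  rwa [Measure.restrict_apply_univ] at this

end BratteliDiagram

namespace BratteliDiagram

open NonnegMatrix

variable {B : BratteliDiagram.{u, v}} {ι : Type w} {lab : ∀ n, ι ≃ B.V (n + 1)}
  {A : Matrix ι ι ℕ} {α : ReducedVertex A} {C : Set ι}

/-! ### Measures on the subdiagram -/

theorem relInvariant_subTail_iff (ν : Measure (B.subPaths lab C)) :
    RelInvariant (B.subTail lab C) ν ↔
      PartialInvariant B.tail (B.subPaths lab C) (ν.map Subtype.val) :=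
  relInvariant_comap_iff (measurableSet_subPaths lab C) ν

theorem map_val_image (ν : Measure (B.subPaths lab C)) {S : Set (B.subPaths lab C)}
    (hS : MeasurableSet S) : ν.map Subtype.val (Subtype.val '' S) = ν S := by
  rw [Measure.map_apply measurable_subtype_coe ((measurableSet_subPaths lab C).subtype_image hS),
    preimage_image_eq _ Subtype.val_injective]

theorem image_preimage_val {T : Set B.PathSpace} (hT : T ⊆ B.subPaths lab C) :
    Subtype.val '' (Subtype.val ⁻¹' T : Set (B.subPaths lab C)) = T := by
  rw [image_preimage_eq_inter_range, Subtype.range_coe, inter_eq_left.2 hT]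

theorem isInvariantExtension_iff {ν : Measure (B.subPaths lab C)} {μ : Measure B.PathSpace} :
    B.IsInvariantExtension lab C ν μ ↔ PartialInvariant B.tail univ μ ∧
      μ (B.saturation lab C)ᶜ = 0 ∧
      ∀ T, MeasurableSet T → T ⊆ B.subPaths lab C → μ T = ν.map Subtype.val T := by
  constructor
  · rintro ⟨h1, h2, h3⟩
    refine ⟨h1.partialInvariant, h3, fun T hT hTY => ?_⟩
    rw [← image_preimage_val hTY, h2 _ (measurable_subtype_coe hT),
      map_val_image _ (measurable_subtype_coe hT)]
  · rintro ⟨h1, h2, h3⟩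
    refine ⟨h1.relInvariant, fun S hS => ?_, h2⟩
    rw [h3 _ ((measurableSet_subPaths lab C).subtype_image hS) (Subtype.coe_image_subset _ _),
      map_val_image _ hS]

theorem IsSubInvariantProb.exists_isInvariantExtension {ν : Measure (B.subPaths lab C)}
    (hν : B.IsSubInvariantProb lab C ν) : ∃ μ, B.IsInvariantExtension lab C ν μ := by
  obtain ⟨μ, h1, h2, h3⟩ := exists_extension lab C ((relInvariant_subTail_iff ν).1 hν.2)
  exact ⟨μ, isInvariantExtension_iff.2 ⟨h1, h2, h3⟩⟩

theorem IsInvariantExtension.unique {ν : Measure (B.subPaths lab C)} {μ μ' : Measure B.PathSpace}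
    (h : B.IsInvariantExtension lab C ν μ) (h' : B.IsInvariantExtension lab C ν μ') : μ = μ' := by
  obtain ⟨h1, h2, h3⟩ := isInvariantExtension_iff.1 h
  obtain ⟨h1', h2', h3'⟩ := isInvariantExtension_iff.1 h'
  exact ext_of_subPaths h1 h1' h2 h2' fun T hT hTY => (h3 T hT hTY).trans (h3' T hT hTY).symm

theorem IsInvariantExtension.isNormalizedExtension {ν : Measure (B.subPaths lab C)}
    {μ : Measure B.PathSpace} (hν : B.IsSubInvariantProb lab C ν)
    (h : B.IsInvariantExtension lab C ν μ) : IsNormalizedExtension lab C μ := by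
  have := hν.1
  refine ⟨h.invariant.partialInvariant, h.null_compl, ?_⟩
  have h1 := h.extends_sub univ MeasurableSet.univ
  rwa [image_univ, Subtype.range_coe, measure_univ] at h1

theorem IsNormalizedExtension.exists_isSubInvariantProb {μ : Measure B.PathSpace}
    (h : IsNormalizedExtension lab C μ) :
    ∃ ν, B.IsSubInvariantProb lab C ν ∧ B.IsInvariantExtension lab C ν μ := by
  have hY := measurableSet_subPaths (B := B) lab C
  have hmap : (μ.comap Subtype.val : Measure (B.subPaths lab C)).map Subtype.val
      = μ.restrict (B.subPaths lab C) := map_comap_subtype_coe hY μ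
  refine ⟨μ.comap Subtype.val, ⟨⟨?_⟩, ?_⟩, isInvariantExtension_iff.2
    ⟨h.invariant, h.null_compl, fun T hT hTY => ?_⟩⟩
  · rw [comap_subtype_coe_apply hY, image_univ, Subtype.range_coe, h.mass]
  · rw [relInvariant_subTail_iff, hmap]
    intro f S hf hS hi hSY hfY hr
    rw [Measure.restrict_apply (hS.image_of_measurable_injOn hf hi), Measure.restrict_apply hS,
      inter_eq_left.2 hSY, inter_eq_left.2 hfY]
    exact h.invariant f S hf hS hi (subset_univ _) (subset_univ _) hr
  · rw [hmap, Measure.restrict_apply hT, inter_eq_left.2 hTY]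

end BratteliDiagram
-- The correspondence between classes and infinite ergodic measures
open NonnegMatrix BratteliDiagram in
theorem BratteliDiagram.IsStationary.classification {B : BratteliDiagram.{u, v}} {ι : Type w}
    [Fintype ι] {lab : ∀ n, ι ≃ B.V (n + 1)} {A : Matrix ι ι ℕ}
    (hst : B.IsStationary lab A.transpose) (hprim : PrimitiveBlocks A.transpose) :
    (∀ α : ReducedVertex A, block A α ≠ 0 →
      ∃! ν, B.IsSubInvariantProb lab (classSet A α) ν) ∧
    (∀ α : ReducedVertex A, block A α ≠ 0 → ∀ ν, B.IsSubInvariantProb lab (classSet A α) ν →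
      ∃! μ, B.IsInvariantExtension lab (classSet A α) ν μ) ∧
    ∃ Φ : {α : ReducedVertex A // block A α ≠ 0 ∧ ¬ Distinguished A α} ≃
        Quotient (scalingSetoid B.tail),
      ∀ α ν μ, B.IsSubInvariantProb lab (classSet A α.1) ν →
        B.IsInvariantExtension lab (classSet A α.1) ν μ →
          (∃ h : IsErgodicInfinite B.tail μ,
            Φ α = Quotient.mk (scalingSetoid B.tail) ⟨μ, h⟩) ∧
          ((∀ x, μ {x} = 0) ↔ ¬ IsUnitBlock A α.1) := by
  obtain ⟨η, ρ, hη, hρ, hpos⟩ := hst.exists_isBlockEigenvector hprim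
  have hmass : ∀ (α : ReducedVertex A) (μ : Measure B.PathSpace),
      IsNormalizedExtension lab (classSet A α) μ →
      μ (B.saturation lab (classSet A α)) ≠ 0 := fun α μ hμ h0 => by
    have := measure_mono_null (subset_relSaturation B.tail _) h0
    rw [hμ.mass] at this
    exact one_ne_zero this
  have herg : ∀ (α : ReducedVertex A) (μ : Measure B.PathSpace), block A α ≠ 0 →
      ¬ Distinguished A α → IsNormalizedExtension lab (classSet A α) μ →
      IsErgodicInfinite B.tail μ := fun α μ hα hd hμ =>
    ⟨hμ.invariant.relInvariant, hst.relErgodic hprim hη hρ hα hμ, hμ.sigmaFinite,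
      not_lt_top_iff.1 fun h => hd ((hst.isFiniteMeasure_iff hprim hη hρ hα (hpos α hα) hμ).1 h),
      hst.exists_open hprim hη hρ hα hμ⟩
  refine ⟨fun α hα => ?_, fun α hα ν hν => ?_, ?_⟩
  · obtain ⟨μ, hμ⟩ := hst.exists_isNormalizedExtension hα
    obtain ⟨ν, hν, hνμ⟩ := hμ.exists_isSubInvariantProb
    refine ⟨ν, hν, fun ν' hν' => ?_⟩
    obtain ⟨μ', hμ'⟩ := hν'.exists_isInvariantExtension
    have := hst.isNormalizedExtension_unique hprim hη hρ hα hμ (hμ'.isNormalizedExtension hν')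
    subst this
    ext S hS
    rw [← hμ'.extends_sub S hS, ← hνμ.extends_sub S hS]
  · obtain ⟨μ, hμ⟩ := hν.exists_isInvariantExtension
    exact ⟨μ, hμ, fun μ' hμ' => hμ'.unique hμ⟩
  · choose m hm using fun α : {α : ReducedVertex A // block A α ≠ 0 ∧ ¬ Distinguished A α} =>
      hst.exists_isNormalizedExtension α.2.1
    let φ : {α : ReducedVertex A // block A α ≠ 0 ∧ ¬ Distinguished A α} →
        Quotient (scalingSetoid B.tail) := fun α =>
      Quotient.mk (scalingSetoid B.tail) ⟨m α, herg α.1 (m α) α.2.1 α.2.2 (hm α)⟩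
    have hinj : Function.Injective φ := by
      intro α β h
      obtain ⟨c, hc, h⟩ := Quotient.exact h
      have h' : m β = c • m α := h
      by_contra hne
      -- Proportional measures would be carried by two disjoint saturations.
      have hd := hst.disjoint_saturation α.2.1 β.2.1 fun h => hne (Subtype.ext h)
      refine hmass β.1 (m β) (hm β) ?_
      rw [h', Measure.smul_apply, measure_mono_null hd.subset_compl_left (hm α).null_compl,
        smul_zero]
    have hsurj : Function.Surjective φ := by
      intro q
      obtain ⟨⟨μ, hμ⟩, rfl⟩ := Quotient.exists_rep q
      have hinv := hμ.invariant.partialInvariant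
      have hne : μ univ ≠ 0 := by rw [hμ.infinite]; exact ENNReal.top_ne_zero
      obtain ⟨α, hα, hα0⟩ := hst.exists_class_of_relErgodic hμ.ergodic hne
      obtain ⟨U, hU, hU0, hUtop⟩ := hμ.exists_open
      have htop := hst.measure_subPaths_lt_top hprim hα hinv hα0 hU hU0 hUtop
      -- The whole space is saturated, so a null `Y_α` would make `μ` vanish.
      have hY0 : μ (B.subPaths lab (classSet A α)) ≠ 0 := fun h =>
        hne (measure_eq_zero_of_saturated hinv hα0 MeasurableSet.univ (fun _ _ _ _ => mem_univ _)
          (by rwa [univ_inter]))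
      set a := μ (B.subPaths lab (classSet A α)) with ha
      have hnorm : IsNormalizedExtension lab (classSet A α) (a⁻¹ • μ) :=
        ⟨hinv.smul _, by rw [Measure.smul_apply, hα0, smul_zero],
          ENNReal.inv_mul_cancel hY0 htop.ne⟩
      have hdist : ¬ Distinguished A α := fun h => by
        have := (hst.isFiniteMeasure_iff hprim hη hρ hα (hpos α hα) hnorm).2 h
        rw [Measure.smul_apply, hμ.infinite, smul_eq_mul,
          ENNReal.mul_top (ENNReal.inv_ne_zero.2 htop.ne)] at this
        exact lt_irrefl _ this
      refine ⟨⟨α, hα, hdist⟩, Quotient.sound ⟨a.toNNReal, ?_, ?_⟩⟩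
      · exact (ENNReal.toNNReal_pos hY0 htop.ne).ne'
      · change μ = a.toNNReal • m ⟨α, hα, hdist⟩
        rw [hst.isNormalizedExtension_unique hprim hη hρ hα (hm ⟨α, hα, hdist⟩) hnorm,
          ENNReal.smul_def, ENNReal.coe_toNNReal htop.ne, smul_smul,
          ENNReal.mul_inv_cancel hY0 htop.ne, one_smul]
    refine ⟨Equiv.ofBijective φ ⟨hinj, hsurj⟩, fun α ν μ hν hμ => ?_⟩
    have hμ' := hμ.isNormalizedExtension hν
    have := hst.isNormalizedExtension_unique hprim hη hρ α.2.1 (hm α) hμ'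
    subst this
    exact ⟨⟨herg α.1 (m α) α.2.1 α.2.2 (hm α), rfl⟩,
      hst.measure_singleton_eq_zero_iff hprim hη hρ α.2.1 (hpos _ α.2.1) (hm α)⟩

theorem mainTheorem2
    (B : BratteliDiagram.{u, v}) {ι : Type w} [Fintype ι]
    (lab : ∀ n, ι ≃ B.V (n + 1)) (F A : Matrix ι ι ℕ) (hA : A = F.transpose)
    (hstat : B.IsStationary lab F)
    (haper : RelAperiodic B.tail)
    (hprim : NonnegMatrix.PrimitiveBlocks F) :
    -- each simple subdiagram has a unique invariant probability measure
    (∀ α : NonnegMatrix.ReducedVertex A, NonnegMatrix.block A α ≠ 0 →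
      ∃! ν, B.IsSubInvariantProb lab (NonnegMatrix.classSet A α) ν) ∧
    -- this measure has a unique invariant extension
    (∀ α : NonnegMatrix.ReducedVertex A, NonnegMatrix.block A α ≠ 0 →
      ∀ ν, B.IsSubInvariantProb lab (NonnegMatrix.classSet A α) ν →
        ∃! μ, B.IsInvariantExtension lab (NonnegMatrix.classSet A α) ν μ) ∧
    -- taking the class of the extension is a one-to-one correspondence
    ∃ Φ : {α : NonnegMatrix.ReducedVertex A //
          NonnegMatrix.block A α ≠ 0 ∧ ¬ NonnegMatrix.Distinguished A α} ≃
        Quotient (scalingSetoid B.tail),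
      ∀ α ν μ, B.IsSubInvariantProb lab (NonnegMatrix.classSet A α.1) ν →
        B.IsInvariantExtension lab (NonnegMatrix.classSet A α.1) ν μ →
          (∃ h : IsErgodicInfinite B.tail μ,
            Φ α = Quotient.mk (scalingSetoid B.tail) ⟨μ, h⟩) ∧
          ((∀ x, μ {x} = 0) ↔ ¬ NonnegMatrix.IsUnitBlock A α.1) := by
  subst hA
  exact BratteliDiagram.IsStationary.classification (A := F.transpose) hstat hprim
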